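/- Let $p$ be a prime, let $\Delta$ be a $4$-simplex with boundary $\partial\Delta$ and $2$-skeleton $\Delta^{(2)}$, and let $S^3=\{(z,w)\in\mathbb C^2:|z|^2+|w|^2=1\}$, on which $\mathbb T=\mathbb R/\mathbb Z$ acts by $t\cdot(z,w)=(z,e^{2\pi i t}w)$, with fixed circle $S^1=\{w=0\}$; let $\mathbb Z_p\subset\mathbb T$ be the subgroup of order $p$. Identify $S^3$ with $\partial\Delta$ by a homeomorphism for which $S^1$ meets each $3$-simplex $\Delta'$ of $\Delta$ in an arc whose end-points are in $\partial\Delta'$ and whose interior is in the interior of $\Delta'$. Let $I_1,\dots,I_5\subset S^1$ be closed non-degenerate arcs and let $0<r<1$ be such that the balls $B_i=\{(z,w)\in S^3: |w|\le r,\ z/|z|\in I_i\}$ lie in the interiors of the five different $3$-simplexes of $\Delta$. Put $M=S^3\setminus\operatorname{int}(B_1\cup\dots\cup B_5)$, let $\Gamma_{\partial M}$ be the quotient of $M$ obtained by collapsing to a point each $\mathbb Z_p$-orbit contained in $\partial M$, with projection $\mu:M\to\Gamma_{\partial M}$, put $\Gamma_M=M/\mathbb Z_p$, and let $\Gamma$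 be the mapping cylinder of the natural map $\alpha:\Gamma_{\partial M}\to\Gamma_M$. Let $\delta:\Gamma\to\Delta$ be a continuous map which sends $\Gamma_{\partial M}$ to $\partial\Delta$ and $\Gamma_M$ to the barycenter of $\Delta$, is the identity on $\Delta^{(2)}\subset\Gamma_{\partial M}$, sends $\mu(M\cap\Delta')$ to $\Delta'$ for every $3$-simplex $\Delta'$ of $\Delta$, is one-to-one over $\Delta^{(2)}$, and is linear along the intervals of the mapping cylinder. Let $L$ be a finite simplicial complex of dimension at most $4$ and let $\lambda:L\to\Delta$ be a simplicial map that is one-to-one on each simplex of $L$. Let $L'=\{(x,y)\in L\times\Gamma:\lambda(x)=\delta(y)\}$ be the pull-back of $\lambda$ and $\delta$, and let $\Omega:L'\to L$ be the projection. Then $\Omega$ induces an isomorphism $H_4(L';\mathbb Z_p)\to H_4(L;\mathbb Z_p)$. -/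

import Mathlib

open CategoryTheory

noncomputable section

/-! ### The 4-simplex and its skeleta -/

/-- The `4`-simplex `Δ`. -/
abbrev Simplex4 : Type := stdSimplex ℝ (Fin 5)

/-- The closed `3`-dimensional face `Δᵢ` of `Δ`, opposite to the `i`-th vertex. -/
def face3 (i : Fin 5) : Set Simplex4 := {x | x i = 0}

/-- The relative interior of the face `Δᵢ`. -/
def openFace3 (i : Fin 5) : Set Simplex4 := {x | x i = 0 ∧ ∀ j, j ≠ i → 0 < x j}

/-- The relative boundary `∂Δᵢ` of the face `Δᵢ`. -/
def bdryFace3 (i : Fin 5) : Set Simplex4 := {x | x i = 0 ∧ ∃ j, j ≠ i ∧ x j = 0}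

/-- The boundary `∂Δ`, the union of the five closed `3`-faces. -/
def bdrySimplex4 : Set Simplex4 := {x | ∃ i, x i = 0}

/-- The `2`-skeleton `Δ⁽²⁾`: at least two barycentric coordinates vanish. -/
def skel2 : Set Simplex4 := {x | ∃ i j, i ≠ j ∧ x i = 0 ∧ x j = 0}

/-! ### The 3-sphere with its circle action -/

/-- The unit `3`-sphere in `ℂ × ℂ = ℝ² × ℝ²`. -/
abbrev Sphere3 : Type := {q : ℂ × ℂ // ‖q.1‖ ^ 2 + ‖q.2‖ ^ 2 = 1}

/-- The action of `T = ℝ / ℤ` on `S³` by rotations of the second coordinate. It is free off the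
circle `S¹ = {w = 0}`, which it fixes pointwise. -/
def rot (t : UnitAddCircle) (q : Sphere3) : Sphere3 :=
  ⟨(q.1.1, (AddCircle.toCircle t : ℂ) * q.1.2), by
    rw [norm_mul, Circle.norm_coe, one_mul]; exact q.2⟩

/-- The orbit relation of the subgroup `ℤ_p = ℤ / pℤ` of `T`. -/
def SameOrbit (p : ℕ) [NeZero p] (x y : Sphere3) : Prop :=
  ∃ k : ZMod p, rot (ZMod.toAddCircle k) x = y

/-- The fixed circle `S¹ = {w = 0}` in `S³`. -/
def fixedCircle : Set Sphere3 := {q | q.1.2 = 0}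

/-- The product `I × D'` of the arc `I = {e^{iθ} : a ≤ θ ≤ b}` of `S¹` with the concentric disk
`D'` given by `|w| ≤ r`, inside the tubular neighbourhood `S¹ × D` of `S¹` in `S³`. -/
def tubeBall (a b r : ℝ) : Set Sphere3 :=
  {q | ‖q.1.2‖ ≤ r ∧
    ∃ θ ∈ Set.Icc a b, q.1.1 = (‖q.1.1‖ : ℂ) * Complex.exp ((θ : ℂ) * Complex.I)}

/-- The choices entering the construction: an identification of `S³` with `∂Δ` in which `S¹` meets
each `3`-simplex of `Δ` in a proper arc, and five balls `Bᵢ = Iᵢ × D'`, one in the interior of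
each `3`-simplex. -/
structure BallSystem where
  /-- The identification of `S³` with `∂Δ`. -/
  h : Sphere3 ≃ₜ bdrySimplex4
  /-- In each `3`-simplex the circle is an arc with end-points in the boundary of the simplex and
  interior in the interior of the simplex. -/
  arc : ∀ i : Fin 5, ∃ c : unitInterval → Simplex4,
    Continuous c ∧ Function.Injective c ∧
    Set.range c = (fun q => (h q : Simplex4)) '' fixedCircle ∩ face3 i ∧
    c 0 ∈ bdryFace3 i ∧ c 1 ∈ bdryFace3 i ∧
    ∀ t, t ≠ 0 → t ≠ 1 → c t ∈ openFace3 i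
  /-- Starting angle of the arc `Iᵢ`. -/
  a : Fin 5 → ℝ
  /-- Final angle of the arc `Iᵢ`. -/
  b : Fin 5 → ℝ
  /-- The radius of the disk `D'`. -/
  r : ℝ
  a_lt_b : ∀ i, a i < b i
  b_lt : ∀ i, b i < a i + 2 * Real.pi
  r_pos : 0 < r
  r_lt_one : r < 1
  /-- `Bᵢ` lies in the interior of the `3`-simplex `Δᵢ`. -/
  ball_subset : ∀ i, ∀ q ∈ tubeBall (a i) (b i) r, (h q : Simplex4) ∈ openFace3 i

/-! ### Mapping cylinders -/

/-- The gluing relation `(x, 1) ∼ f x` of the mapping cylinder. -/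
inductive MapCylRel {X Y : Type*} (f : X → Y) : (X × unitInterval) ⊕ Y → (X × unitInterval) ⊕ Y → Prop
  | glue (x : X) : MapCylRel f (Sum.inl (x, 1)) (Sum.inr (f x))

/-- The mapping cylinder of `f`, with the quotient topology: `X × [0,1] ⊔ Y` with `(x, 1)` glued
to `f x`. -/
abbrev MapCyl {X Y : Type*} (f : X → Y) : Type _ := Quot (MapCylRel f)

/-- The point `(x, t)` of the mapping cylinder. -/
def MapCyl.pt {X Y : Type*} (f : X → Y) (x : X) (t : unitInterval) : MapCyl f :=
  Quot.mk _ (Sum.inl (x, t))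

/-- The point of the top `Y` of the mapping cylinder given by `y`. -/
def MapCyl.top {X Y : Type*} (f : X → Y) (y : Y) : MapCyl f := Quot.mk _ (Sum.inr y)

namespace BallSystem

/-- `M = S³ ∖ int (B₁ ∪ ⋯ ∪ B₅)`, as a subset of `S³`. -/
def compl (S : BallSystem) : Set Sphere3 :=
  {q | q ∉ interior (⋃ i, tubeBall (S.a i) (S.b i) S.r)}

/-- The space `M`. -/
abbrev M (S : BallSystem) : Type := S.compl

/-- The orbit space `Γ_M = M / ℤ_p`. -/
abbrev GammaTop (S : BallSystem) (p : ℕ) [NeZero p] : Type :=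
  Quot (fun x y : S.M => SameOrbit p (x : Sphere3) y)

/-- The space `Γ_∂M`, obtained from `M` by collapsing to points the `ℤ_p`-orbits lying
in `∂M`. -/
abbrev GammaBot (S : BallSystem) (p : ℕ) [NeZero p] : Type :=
  Quot (fun x y : S.M => (x : Sphere3) ∈ frontier S.compl ∧ SameOrbit p (x : Sphere3) y)

/-- The projection `μ : M → Γ_∂M`. -/
def mu (S : BallSystem) (p : ℕ) [NeZero p] (x : S.M) : S.GammaBot p := Quot.mk _ x

/-- The natural map `α : Γ_∂M → Γ_M`. -/
def alpha (S : BallSystem) (p : ℕ) [NeZero p] : S.GammaBot p → S.GammaTop p :=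
  Quot.map id fun _ _ hxy => hxy.2

/-- The space `Γ`, the mapping cylinder of `α : Γ_∂M → Γ_M`. -/
abbrev Gamma (S : BallSystem) (p : ℕ) [NeZero p] : Type := MapCyl (S.alpha p)

/-- The conditions defining the maps `δ : Γ → Δ`. -/
structure IsDelta (S : BallSystem) (p : ℕ) [NeZero p] (δ : S.Gamma p → Simplex4) : Prop where
  continuous : Continuous δ
  /-- `δ` sends `Γ_∂M` to `∂Δ`. -/
  bot_mem : ∀ x, δ (MapCyl.pt (S.alpha p) x 0) ∈ bdrySimplex4
  /-- `δ` sends `Γ_M` to the barycenter of `Δ`. -/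
  top_eq : ∀ y, δ (MapCyl.top (S.alpha p) y) = stdSimplex.barycenter
  /-- `δ` is the identity map on `Δ⁽²⁾ ⊆ Γ_∂M`. -/
  skel2_eq : ∀ x : S.M, (S.h x : Simplex4) ∈ skel2 →
    δ (MapCyl.pt (S.alpha p) (S.mu p x) 0) = S.h x
  /-- `δ` sends `μ (M ∩ Δᵢ)` to `Δᵢ`. -/
  face3_mem : ∀ (i : Fin 5) (x : S.M), (S.h x : Simplex4) ∈ face3 i →
    δ (MapCyl.pt (S.alpha p) (S.mu p x) 0) ∈ face3 i
  /-- `δ` is one-to-one over `Δ⁽²⁾`. -/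
  injOn_skel2 : Set.InjOn δ (δ ⁻¹' skel2)
  /-- `δ` is linear along the intervals of the mapping cylinder. -/
  linear : ∀ (x : S.GammaBot p) (t : unitInterval) (j : Fin 5),
    δ (MapCyl.pt (S.alpha p) x t) j =
      (1 - (t : ℝ)) * δ (MapCyl.pt (S.alpha p) x 0) j
        + (t : ℝ) * (stdSimplex.barycenter : Simplex4) j

end BallSystem

/-! ### Simplicial complexes and simplicial maps to the 4-simplex -/

/-- The geometric realization of a finite simplicial complex `L` with vertices in `V`: the union,
over the faces `s` of `L`, of the simplices spanned by `s`. -/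
abbrev Realization {V : Type} [Fintype V] (L : PreAbstractSimplicialComplex V) : Type :=
  {x : stdSimplex ℝ V // ∃ s ∈ L, ∀ v, v ∉ s → x v = 0}

/-- The map `|L| → Δ` which is affine on every simplex and is given on the vertices by
`lam : V → {0, …, 4}`. Every set of vertices of `Δ` spans a face, so every vertex map is
simplicial. -/
def realizationMap {V : Type} [Fintype V] (L : PreAbstractSimplicialComplex V)
    (lam : V → Fin 5) (x : Realization L) : Simplex4 :=
  stdSimplex.map lam x.1

/-- The pull-back `L'` of a map `f : X → Δ` along `δ : Γ → Δ`, with the subspace topology. -/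
abbrev PullbackSpace {X G Z : Type} (f : X → Z) (δ : G → Z) : Type :=
  {q : X × G // f q.1 = δ q.2}

/-- The projection `Ω : L' → L`. -/
def pullbackFst {X G Z : Type} [TopologicalSpace X] [TopologicalSpace G] (f : X → Z) (δ : G → Z) :
    C(PullbackSpace f δ, X) :=
  ⟨fun q => q.1.1, by fun_prop⟩

/-- The homomorphism induced by `f : X → Y` in singular homology `Hₙ(-; ℤ_p)`. -/
abbrev singularHomologyMap (p n : ℕ) {X Y : Type} [TopologicalSpace X] [TopologicalSpace Y]
    (f : C(X, Y)) :=
  ((AlgebraicTopology.singularHomologyFunctor (ModuleCat.{0} (ZMod p)) n).obj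
    (ModuleCat.of (ZMod p) (ZMod p))).map (TopCat.ofHom f)

end

/-! The projection `Ω` is compared with the identity of `L` one simplex at a time, so everything
rests on the fibres of `δ`, whose relevant properties are collected in `FiberData`.

Over `Δ⁽²⁾` the map `δ` has a continuous inverse. Over a 3-face `Δᵢ` the inverse image is the face
with an open ball removed and the `ℤ_p`-orbits in the boundary sphere of that ball collapsed; this
is an instance of `Surgery`. In suitable coordinates the orbit map of the sphere is the suspension
of `w ↦ wᵖ / |w|ᵖ⁻¹`, so the quotient is again a sphere and the quotient map has degree `p`. Across
the shell between `∂Δᵢ` and the ball, a 2-cycle on `∂Δᵢ` is homologous to one near the small sphere,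
whose image is `p` times a class and hence zero mod `p`. So 2-cycles over `∂Δᵢ` bound over `Δᵢ`,
exactly as in a true simplex (`exists_bd_of_zOuter`, `kills_face`), and the fibre has no homology in
degrees at least 3 (`Surgery.acycOn_univ`). Over the whole of `Δ` the inverse image is `Γ`. It
deforms onto `Γ_M = M / ℤ_p`, which the winding map identifies with `M`, a 3-sphere with five holes,
and this too has no homology in degrees at least 3 (`acycOn_gammaTop`).

The degree `p` enters through `kills_punctured`. A 1-cycle in the punctured plane is cut along the
inverse images of two opposite slit planes. Since rotation by a primitive root of unity is isotopic
to the identity, the boundary of one half has the same number of points, with coefficients, in each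
of the `p` sectors over a given half-plane, so the image of this boundary has augmentation `p · (…)
= 0` there and the two halves can be closed up separately.

The comparison is an induction over subcomplexes `K`, attaching simplices of top dimension.
`Compares` carries three statements: injectivity and surjectivity of the projection in the top
degree, and a lifting property one degree lower, namely that a cycle over the lower skeleton bounds
over `K` once its image bounds in `K`. The last is what surjectivity needs: the intersection cycle
of a cycle in `L` lies on the boundary of the new simplex, and a filling of it has to be found
upstairs. `compares_three` starts from complexes of dimension 2, `compares_four` starts from
`compares_three`, and the latter in degree 4 is the theorem.

Homology is handled throughout by explicit singular chains, with Mayer-Vietoris arguments replaced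
by the splitting property `Excisive`. Open couples have it by barycentric subdivision; closed
couples have it when their intersection has a collar (`excisive_of_collar`), the collars being
pushes from barycenters. `isIso_singularHomologyMap` turns the chain statements into one about
singular homology. -/

noncomputable section

/-! ### Chains of ordered tuples -/

namespace TupleChain

variable {k : Type} [CommRing k] {P Q : Type}

/-- Chains of ordered `n`-simplices with vertices in `P`. -/
abbrev Chain (k : Type) [CommRing k] (P : Type) (n : ℕ) : Type := (Fin (n + 1) → P) →₀ k

/-- The simplicial boundary. -/
def bd (n : ℕ) : Chain k P (n + 1) →ₗ[k] Chain k P n :=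
  Finsupp.linearCombination k fun w =>
    ∑ i : Fin (n + 2), (-1 : k) ^ (i : ℕ) • Finsupp.single (w ∘ i.succAbove) 1

/-- The cone with apex `b`. -/
def cone (b : P) (n : ℕ) : Chain k P n →ₗ[k] Chain k P (n + 1) :=
  Finsupp.lmapDomain k k fun w => (Fin.cons b w : Fin (n + 2) → P)

/-- The map induced by a map of vertices. -/
def map (f : P → Q) (n : ℕ) : Chain k P n →ₗ[k] Chain k Q n :=
  Finsupp.lmapDomain k k fun w => f ∘ w

/-- The augmentation. -/
def aug : Chain k P 0 →ₗ[k] k := Finsupp.linearCombination k fun _ => 1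

@[simp] lemma bd_single (n : ℕ) (w : Fin (n + 2) → P) :
    bd (k := k) n (Finsupp.single w 1) =
      ∑ i : Fin (n + 2), (-1 : k) ^ (i : ℕ) • Finsupp.single (w ∘ i.succAbove) 1 := by
  simp [bd]

@[simp] lemma cone_single (b : P) (n : ℕ) (w : Fin (n + 1) → P) (c : k) :
    cone b n (Finsupp.single w c) = Finsupp.single (Fin.cons b w : Fin (n + 2) → P) c := by
  simp [cone]

@[simp] lemma map_single (f : P → Q) (n : ℕ) (w : Fin (n + 1) → P) (c : k) :
    map f n (Finsupp.single w c) = Finsupp.single (f ∘ w) c := by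
  simp [map]

lemma hom_ext {M : Type} [AddCommGroup M] [Module k M] {S : Type} {f g : (S →₀ k) →ₗ[k] M}
    (h : ∀ s, f (Finsupp.single s 1) = g (Finsupp.single s 1)) : f = g :=
  Finsupp.lhom_ext' fun s => LinearMap.ext_ring (h s)

lemma map_bd (f : P → Q) (n : ℕ) (c : Chain k P (n + 1)) :
    map f n (bd n c) = bd n (map f (n + 1) c) := by
  refine LinearMap.congr_fun (f := map f n ∘ₗ bd n) (g := bd n ∘ₗ map f (n + 1)) (hom_ext ?_) c
  intro w
  simp [map_sum, Function.comp_assoc]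

lemma map_cone (f : P → Q) (b : P) (n : ℕ) (c : Chain k P n) :
    map f (n + 1) (cone b n c) = cone (f b) n (map f n c) := by
  refine LinearMap.congr_fun (f := map f _ ∘ₗ cone b n) (g := cone (f b) n ∘ₗ map f n)
    (hom_ext ?_) c
  intro w
  simp only [LinearMap.comp_apply, cone_single, map_single]
  congr 1
  exact Fin.comp_cons f b w

/-- Omitting the apex returns the simplex; omitting any other vertex gives the cone over a face,
with the index, and so the sign, shifted by one. -/
lemma bd_cone (b : P) (n : ℕ) (c : Chain k P (n + 1)) :
    bd (n + 1) (cone b (n + 1) c) = c - cone b n (bd n c) := by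
  refine LinearMap.congr_fun (f := bd (n + 1) ∘ₗ cone b (n + 1))
    (g := LinearMap.id - cone b n ∘ₗ bd n) (hom_ext ?_) c
  intro w
  simp only [LinearMap.comp_apply, cone_single, bd_single, LinearMap.sub_apply, LinearMap.id_apply,
    map_sum, map_smul]
  rw [Fin.sum_univ_succ]
  rw [sub_eq_add_neg, ← Finset.sum_neg_distrib]
  congr 1
  · simp only [Fin.val_zero, pow_zero, one_smul]
    congr 1
  · refine Finset.sum_congr rfl fun i _ => ?_
    rw [Fin.val_succ, pow_succ, mul_neg_one, neg_smul]
    congr 3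
    ext j
    refine Fin.cases ?_ (fun j => ?_) j
    · simp
    · simp

/-- In degree 0 omitting the only base vertex leaves the apex itself, so the augmentation takes the
place of the cone over the boundary. -/
lemma bd_cone_zero (b : P) (c : Chain k P 0) :
    bd 0 (cone b 0 c) = c - aug c • Finsupp.single (fun _ => b) 1 := by
  refine LinearMap.congr_fun (f := bd 0 ∘ₗ cone b 0)
    (g := LinearMap.id - aug.smulRight (Finsupp.single (fun _ => b) 1)) (hom_ext ?_) c
  intro w
  have h0 : (Fin.cons b w : Fin 2 → P) ∘ (0 : Fin 2).succAbove = w := by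
    ext j; simp
  have h1 : (Fin.cons b w : Fin 2 → P) ∘ (1 : Fin 2).succAbove = fun _ => b := by
    ext j; fin_cases j; simp
  simp only [LinearMap.comp_apply, cone_single, bd_single, LinearMap.sub_apply, LinearMap.id_apply,
    LinearMap.smulRight_apply, aug]
  rw [Fin.sum_univ_two, h0, h1]
  simp [sub_eq_add_neg]

lemma aug_bd (c : Chain k P 1) : aug (bd 0 c) = 0 := by
  refine LinearMap.congr_fun (f := aug ∘ₗ bd 0) (g := 0) (hom_ext ?_) c
  intro w
  simp [Fin.sum_univ_two, aug]

/-- Every tuple is the cone over its tail with apex its first vertex, so the cone formula and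
induction replace the pairwise cancellation of faces. -/
lemma bd_bd (n : ℕ) (c : Chain k P (n + 2)) : bd n (bd (n + 1) c) = 0 := by
  induction n with
  | zero =>
    refine LinearMap.congr_fun (f := bd 0 ∘ₗ bd 1) (g := 0) (hom_ext fun w => ?_) c
    have hw : (Finsupp.single w 1 : Chain k P 2) = cone (w 0) 1 (Finsupp.single (Fin.tail w) 1) := by
      simp
    rw [LinearMap.comp_apply, hw, bd_cone, map_sub, bd_cone_zero, aug_bd]
    simp
  | succ n ih =>
    refine LinearMap.congr_fun (f := bd (n + 1) ∘ₗ bd (n + 2)) (g := 0) (hom_ext fun w => ?_) c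
    have hw : (Finsupp.single w 1 : Chain k P (n + 3)) =
        cone (w 0) (n + 2) (Finsupp.single (Fin.tail w) 1) := by
      simp
    rw [LinearMap.comp_apply, hw, bd_cone, map_sub, bd_cone, ih]
    simp

end TupleChain

/-! ### Affine simplices in the standard simplex -/

/-- The standard topological `n`-simplex. -/
abbrev Simp (n : ℕ) : Type := stdSimplex ℝ (Fin (n + 1))

namespace Simp

/-- The affine simplex with given vertices. -/
def aff {m n : ℕ} (w : Fin (n + 1) → Simp m) : C(Simp n, Simp m) where
  toFun x := ⟨∑ i, x i • (w i : Fin (m + 1) → ℝ),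
    (convex_stdSimplex ℝ (Fin (m + 1))).sum_mem (fun i _ => x.2.1 i) x.2.2 fun i _ => (w i).2⟩
  continuous_toFun := by
    refine Continuous.subtype_mk (continuous_finsetSum _ fun i _ => ?_) _
    exact ((continuous_apply i).comp continuous_subtype_val).smul continuous_const

lemma aff_apply {m n : ℕ} (w : Fin (n + 1) → Simp m) (x : Simp n) (j : Fin (m + 1)) :
    aff w x j = ∑ i, x i * w i j := by
  change (∑ i, x i • (w i : Fin (m + 1) → ℝ)) j = _
  rw [Finset.sum_apply]
  rfl

/-- Affine combinations compose. This naturality is what allows constructions on tuples to be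
transported to singular simplices. -/
lemma aff_aff {l m n : ℕ} (v : Fin (m + 1) → Simp l) (w : Fin (n + 1) → Simp m) :
    aff (aff v ∘ w) = (aff v).comp (aff w) := by
  ext x j
  simp only [ContinuousMap.comp_apply, aff_apply, Function.comp_apply, Finset.mul_sum,
    Finset.sum_mul]
  rw [Finset.sum_comm]
  simp only [mul_assoc]

/-- The vertices of the standard simplex. -/
def vert (n : ℕ) (i : Fin (n + 1)) : Simp n := stdSimplex.vertex i

lemma vert_apply (n : ℕ) (i j : Fin (n + 1)) : vert n i j = if j = i then 1 else 0 := by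
  simp [vert, Pi.single_apply]

lemma aff_vert (n : ℕ) : aff (vert n) = ContinuousMap.id (Simp n) := by
  ext x j
  simp [aff_apply, vert_apply]

lemma aff_apply_vert {m n : ℕ} (w : Fin (n + 1) → Simp m) (i : Fin (n + 1)) :
    aff w (vert n i) = w i := by
  ext j
  simp [aff_apply, vert_apply]

lemma aff_comp_vert {m n : ℕ} (w : Fin (n + 1) → Simp m) : aff w ∘ vert n = w :=
  funext (aff_apply_vert w)

/-- The inclusion of the `i`-th face. -/
def face (n : ℕ) (i : Fin (n + 2)) : C(Simp n, Simp (n + 1)) :=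
  ⟨stdSimplex.map i.succAbove, stdSimplex.continuous_map _⟩

lemma face_eq (n : ℕ) (i : Fin (n + 2)) : face n i = aff (vert (n + 1) ∘ i.succAbove) := by
  ext x j
  change (FunOnFinite.linearMap ℝ ℝ i.succAbove x) j = _
  rw [FunOnFinite.linearMap_apply_apply, aff_apply]
  simp [vert_apply, Finset.sum_filter, eq_comm]

lemma aff_comp_face {m n : ℕ} (w : Fin (n + 2) → Simp m) (i : Fin (n + 2)) :
    (aff w).comp (face n i) = aff (w ∘ i.succAbove) := by
  rw [face_eq, ← aff_aff, ← Function.comp_assoc, aff_comp_vert]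

/-- The barycenter of a tuple. -/
def bary {m n : ℕ} (w : Fin (n + 1) → Simp m) : Simp m := aff w stdSimplex.barycenter

lemma aff_bary {l m n : ℕ} (v : Fin (m + 1) → Simp l) (w : Fin (n + 1) → Simp m) :
    aff v (bary w) = bary (aff v ∘ w) := by
  simp only [bary, aff_aff]
  rfl

end Simp

end

/-! ### Barycentric subdivision of affine chains and its mesh -/

noncomputable section

namespace TupleChain

variable {k : Type} [CommRing k] {l m : ℕ}

/-- Barycentric subdivision. -/
def sd : ∀ n : ℕ, Chain k (Simp m) n →ₗ[k] Chain k (Simp m) n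
  | 0 => LinearMap.id
  | n + 1 => Finsupp.linearCombination k fun w =>
      cone (Simp.bary w) n (sd n (bd n (Finsupp.single w 1)))

/-- The chain homotopy from the identity to the barycentric subdivision. -/
def sdHom : ∀ n : ℕ, Chain k (Simp m) n →ₗ[k] Chain k (Simp m) (n + 1)
  | 0 => 0
  | n + 1 => Finsupp.linearCombination k fun w =>
      cone (Simp.bary w) (n + 1) (Finsupp.single w 1 - sdHom n (bd n (Finsupp.single w 1)))

lemma sd_succ_single (n : ℕ) (w : Fin (n + 2) → Simp m) :
    sd (k := k) (n + 1) (Finsupp.single w 1) =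
      cone (Simp.bary w) n (sd n (bd n (Finsupp.single w 1))) := by
  simp [sd]

lemma sdHom_succ_single (n : ℕ) (w : Fin (n + 2) → Simp m) :
    sdHom (k := k) (n + 1) (Finsupp.single w 1) = cone (Simp.bary w) (n + 1)
      (Finsupp.single w 1 - sdHom n (bd n (Finsupp.single w 1))) := by
  simp [sdHom]

/-- Subdivision is a cone over the subdivided boundary, so the cone formula returns that subdivided
boundary up to a term which dies by `bd_bd`, or by `aug_bd` in the lowest degree. -/
lemma bd_sd (n : ℕ) (c : Chain k (Simp m) (n + 1)) : bd n (sd (n + 1) c) = sd n (bd n c) := by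
  induction n with
  | zero =>
    refine LinearMap.congr_fun (f := bd 0 ∘ₗ sd 1) (g := sd 0 ∘ₗ bd 0) (hom_ext fun w => ?_) c
    rw [LinearMap.comp_apply, LinearMap.comp_apply, sd_succ_single, bd_cone_zero]
    simp [sd, aug_bd, -bd_single]
  | succ n ih =>
    refine LinearMap.congr_fun (f := bd (n + 1) ∘ₗ sd (n + 2)) (g := sd (n + 1) ∘ₗ bd (n + 1))
      (hom_ext fun w => ?_) c
    rw [LinearMap.comp_apply, LinearMap.comp_apply, sd_succ_single, bd_cone, ih, bd_bd]
    simp [-bd_single]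

lemma bd_sdHom_zero (c : Chain k (Simp m) 0) : bd 0 (sdHom 0 c) = c - sd 0 c := by
  simp [sdHom, sd]

lemma bd_sdHom (n : ℕ) (c : Chain k (Simp m) (n + 1)) :
    bd (n + 1) (sdHom (n + 1) c) = c - sd (n + 1) c - sdHom n (bd n c) := by
  -- The inductive step for a single simplex: the cone formula reduces the claim to the homotopy
  -- identity for its boundary.
  have key : ∀ (n : ℕ) (w : Fin (n + 2) → Simp m),
      bd n (sdHom n (bd n (Finsupp.single w (1 : k)))) =
        bd n (Finsupp.single w 1) - sd n (bd n (Finsupp.single w 1)) →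
      bd (n + 1) (sdHom (n + 1) (Finsupp.single w (1 : k))) = Finsupp.single w 1 -
        sd (n + 1) (Finsupp.single w 1) - sdHom n (bd n (Finsupp.single w 1)) := by
    intro n w h
    rw [sdHom_succ_single, bd_cone, map_sub, h, sd_succ_single, sub_sub_cancel]
    abel
  induction n with
  | zero =>
    refine LinearMap.congr_fun (f := bd 1 ∘ₗ sdHom 1)
      (g := LinearMap.id - sd 1 - sdHom 0 ∘ₗ bd 0) (hom_ext fun w => ?_) c
    exact key 0 w (bd_sdHom_zero _)
  | succ n ih =>
    refine LinearMap.congr_fun (f := bd (n + 2) ∘ₗ sdHom (n + 2))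
      (g := LinearMap.id - sd (n + 2) - sdHom (n + 1) ∘ₗ bd (n + 1)) (hom_ext fun w => ?_) c
    exact key (n + 1) w (by rw [ih, bd_bd, map_zero, sub_zero])

/-- Affine maps take barycenters to barycenters, and cones and boundaries are natural. -/
lemma map_sd (v : Fin (m + 1) → Simp l) (n : ℕ) (c : Chain k (Simp m) n) :
    map (Simp.aff v) n (sd n c) = sd n (map (Simp.aff v) n c) := by
  induction n with
  | zero => simp [sd]
  | succ n ih =>
    refine LinearMap.congr_fun (f := map (Simp.aff v) (n + 1) ∘ₗ sd (n + 1))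
      (g := sd (n + 1) ∘ₗ map (Simp.aff v) (n + 1)) (hom_ext fun w => ?_) c
    rw [LinearMap.comp_apply, LinearMap.comp_apply, sd_succ_single, map_cone, ih, map_bd,
      map_single, sd_succ_single, Simp.aff_bary]

lemma map_sdHom (v : Fin (m + 1) → Simp l) (n : ℕ) (c : Chain k (Simp m) n) :
    map (Simp.aff v) (n + 1) (sdHom n c) = sdHom n (map (Simp.aff v) n c) := by
  induction n with
  | zero => simp [sdHom]
  | succ n ih =>
    refine LinearMap.congr_fun (f := map (Simp.aff v) (n + 2) ∘ₗ sdHom (n + 1))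
      (g := sdHom (n + 1) ∘ₗ map (Simp.aff v) (n + 1)) (hom_ext fun w => ?_) c
    rw [LinearMap.comp_apply, LinearMap.comp_apply, sdHom_succ_single, map_cone, map_sub, ih,
      map_bd, map_single, sdHom_succ_single, Simp.aff_bary]

lemma mem_supported_of_single {S T : Type} {s : Set S} {t : Set T} {f : (S →₀ k) →ₗ[k] (T →₀ k)}
    (h : ∀ x ∈ s, f (Finsupp.single x 1) ∈ Finsupp.supported k k t) {c : S →₀ k}
    (hc : c ∈ Finsupp.supported k k s) : f c ∈ Finsupp.supported k k t := by
  rw [Finsupp.supported_eq_span_single] at hc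
  induction hc using Submodule.span_induction with
  | mem x hx => obtain ⟨y, hy, rfl⟩ := hx; exact h y hy
  | zero => simp
  | add x y _ _ hx hy => rw [map_add]; exact Submodule.add_mem _ hx hy
  | smul a x _ hx => rw [map_smul]; exact Submodule.smul_mem _ _ hx

/-- The tuples of diameter at most `d` in the set `C`. -/
def tuples (C : Set (Simp m)) (d : ℝ) (n : ℕ) : Set (Fin (n + 1) → Simp m) :=
  {w | (∀ i, w i ∈ C) ∧ ∀ i j, dist (w i) (w j) ≤ d}

lemma bd_tuples {C : Set (Simp m)} {d : ℝ} {n : ℕ} {w : Fin (n + 2) → Simp m}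
    (hw : w ∈ tuples C d (n + 1)) :
    bd n (Finsupp.single w (1 : k)) ∈ Finsupp.supported k k (tuples C d n) := by
  rw [bd_single]
  refine Submodule.sum_mem _ fun i _ => Submodule.smul_mem _ _ (Finsupp.single_mem_supported _ _ ?_)
  exact ⟨fun j => hw.1 _, fun j j' => hw.2 _ _⟩

/-- The difference of the barycenter and a vertex is the average of the `n + 1` differences of
vertices from that vertex, one of which is zero; hence the factor `n / (n + 1)`. -/
lemma dist_bary_le {d : ℝ} {n : ℕ} (w : Fin (n + 1) → Simp m)
    (hw : ∀ i j, dist (w i) (w j) ≤ d) (i : Fin (n + 1)) :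
    dist (Simp.bary w) (w i) ≤ (n / (n + 1 : ℝ)) * d := by
  have hd : 0 ≤ d := dist_nonneg.trans (hw i i)
  have hn : (0 : ℝ) < n + 1 := by positivity
  rw [Subtype.dist_eq, dist_pi_le_iff (by positivity)]
  intro j
  change dist (Simp.bary w j) (w i j) ≤ _
  have e : Simp.bary w j - w i j = ∑ l, ((n : ℝ) + 1)⁻¹ * (w l j - w i j) := by
    rw [← Finset.mul_sum, Finset.sum_sub_distrib, Simp.bary, Simp.aff_apply]
    have : ∀ l, (stdSimplex.barycenter : Simp n) l = ((n : ℝ) + 1)⁻¹ := by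
      intro l
      change ((Fintype.card (Fin (n + 1)) : ℝ))⁻¹ = _
      simp
    simp only [this, ← Finset.mul_sum, Finset.sum_const, Finset.card_univ, Fintype.card_fin,
      nsmul_eq_mul]
    push_cast
    field_simp
  rw [Real.dist_eq, e]
  refine (Finset.abs_sum_le_sum_abs _ _).trans ?_
  have hb : ∀ l, |((n : ℝ) + 1)⁻¹ * (w l j - w i j)| ≤ if l = i then 0 else ((n : ℝ) + 1)⁻¹ * d := by
    intro l
    split_ifs with h
    · simp [h]
    · rw [abs_mul, abs_of_pos (inv_pos.2 hn)]
      refine mul_le_mul_of_nonneg_left ?_ (inv_pos.2 hn).le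
      rw [← Real.dist_eq]
      exact (dist_le_pi_dist (w l : Fin (m + 1) → ℝ) (w i) j).trans (hw l i)
  refine (Finset.sum_le_sum fun l _ => hb l).trans ?_
  rw [Finset.sum_ite]
  simp [Finset.filter_ne']
  rw [div_eq_mul_inv, mul_assoc]

/-- Convexity of a set of points of the standard simplex. -/
def SConvex (C : Set (Simp m)) : Prop :=
  ∀ (n : ℕ) (w : Fin (n + 1) → Simp m) (x : Simp n), (∀ i, w i ∈ C) → Simp.aff w x ∈ C

lemma sConvex_closedBall (a : Simp m) (r : ℝ) : SConvex (Metric.closedBall a r) := by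
  intro n w x hw
  exact (convex_closedBall (a : Fin (m + 1) → ℝ) r).sum_mem (fun i _ => x.2.1 i) x.2.2
    fun i _ => hw i

/-- The convex set `C` varies in the induction: besides the pairwise distances in the subdivided
boundary, one must bound the distances to the new apex, and this bound is stored as membership in a
convex ball. -/
lemma sd_tuples {d : ℝ} (n : ℕ) : ∀ (C : Set (Simp m)), SConvex C → ∀ (w : Fin (n + 1) → Simp m),
    w ∈ tuples C d n →
    sd n (Finsupp.single w (1 : k)) ∈ Finsupp.supported k k (tuples C ((n / (n + 1 : ℝ)) * d) n) := by
  induction n with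
  | zero =>
    intro C _ w hw
    refine Finsupp.single_mem_supported _ _ ⟨hw.1, fun i j => ?_⟩
    obtain rfl : i = j := Fin.ext (by omega)
    simp
  | succ n ih =>
    intro C hC w hw
    have hd : 0 ≤ d := dist_nonneg.trans (hw.2 0 0)
    set b := Simp.bary w with hb
    -- The ball about the apex contains all vertices of `w`, hence by convexity all vertices created
    -- by subdividing its boundary.
    set D := C ∩ Metric.closedBall b (((n + 1 : ℕ) / ((n + 1 : ℕ) + 1 : ℝ)) * d) with hD
    have hDc : SConvex D := fun n w x h =>
      ⟨hC n w x fun i => (h i).1, sConvex_closedBall _ _ n w x fun i => (h i).2⟩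
    have hwD : w ∈ tuples D d (n + 1) := by
      refine ⟨fun i => ⟨hw.1 i, ?_⟩, hw.2⟩
      rw [Metric.mem_closedBall, dist_comm]
      exact dist_bary_le w hw.2 i
    rw [sd_succ_single]
    have h1 := mem_supported_of_single (ih D hDc) (bd_tuples (k := k) hwD)
    refine mem_supported_of_single (f := cone b n) ?_ h1
    rintro v ⟨hv1, hv2⟩
    rw [cone_single]
    -- The contraction factor `n / (n + 1)` increases with `n`, so the bound from the faces is the
    -- better one.
    have hle : ((n : ℝ) / (n + 1 : ℝ)) * d ≤ ((n + 1 : ℕ) / ((n + 1 : ℕ) + 1 : ℝ)) * d := by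
      refine mul_le_mul_of_nonneg_right ?_ hd
      push_cast
      rw [div_le_div_iff₀ (by positivity) (by positivity)]
      nlinarith
    have hbC : b ∈ C := hC _ w _ hw.1
    refine Finsupp.single_mem_supported _ _ ⟨fun i => ?_, fun i j => ?_⟩
    · refine Fin.cases ?_ (fun i => ?_) i
      · simpa using hbC
      · simpa using (hv1 i).1
    · refine Fin.cases (Fin.cases ?_ (fun j => ?_) j) (fun i => Fin.cases ?_ (fun j => ?_) j) i
      · simp; positivity
      · simpa [dist_comm] using (hv1 j).2
      · simpa using (hv1 i).2
      · simpa using (hv2 i j).trans (by simpa using hle)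

lemma sd_iterate_tuples {d : ℝ} (n : ℕ) (C : Set (Simp m)) (hC : SConvex C) (r : ℕ)
    (w : Fin (n + 1) → Simp m) (hw : w ∈ tuples C d n) :
    (sd n)^[r] (Finsupp.single w (1 : k)) ∈
      Finsupp.supported k k (tuples C ((n / (n + 1 : ℝ)) ^ r * d) n) := by
  induction r with
  | zero => simpa using Finsupp.single_mem_supported k (1 : k) hw
  | succ r ih =>
    rw [Function.iterate_succ_apply', pow_succ', mul_assoc]
    exact mem_supported_of_single (sd_tuples n C hC) ih

end TupleChain

end

noncomputable section

/-! ### Singular chains -/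

namespace SingChain

open TupleChain (Chain)

variable {k : Type} [CommRing k] {X Y Z : Type} [TopologicalSpace X] [TopologicalSpace Y]
  [TopologicalSpace Z]

/-- Singular `n`-chains. -/
abbrev Ch (k : Type) [CommRing k] (X : Type) [TopologicalSpace X] (n : ℕ) : Type :=
  C(Simp n, X) →₀ k

/-- The boundary of singular chains. -/
def bd (n : ℕ) : Ch k X (n + 1) →ₗ[k] Ch k X n :=
  Finsupp.linearCombination k fun σ =>
    ∑ i : Fin (n + 2), (-1 : k) ^ (i : ℕ) • Finsupp.single (σ.comp (Simp.face n i)) 1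

/-- The map induced by a continuous map. -/
def push (f : C(X, Y)) (n : ℕ) : Ch k X n →ₗ[k] Ch k Y n :=
  Finsupp.lmapDomain k k fun σ => f.comp σ

/-- The chains supported in the subset `A`. -/
def sub (k : Type) [CommRing k] (A : Set X) (n : ℕ) : Submodule k (Ch k X n) :=
  Finsupp.supported k k {σ | ∀ x, σ x ∈ A}

/-- The singular chain given by a chain of affine simplices in the source of `σ`. -/
def real {m : ℕ} (σ : C(Simp m, X)) (n : ℕ) : Chain k (Simp m) n →ₗ[k] Ch k X n :=
  Finsupp.lmapDomain k k fun w => σ.comp (Simp.aff w)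

lemma bd_single (n : ℕ) (σ : C(Simp (n + 1), X)) :
    bd (k := k) n (Finsupp.single σ 1) =
      ∑ i : Fin (n + 2), (-1 : k) ^ (i : ℕ) • Finsupp.single (σ.comp (Simp.face n i)) 1 := by
  simp [bd]

@[simp] lemma push_single (f : C(X, Y)) (n : ℕ) (σ : C(Simp n, X)) (a : k) :
    push f n (Finsupp.single σ a) = Finsupp.single (f.comp σ) a := by
  simp [push]

@[simp] lemma real_single {m : ℕ} (σ : C(Simp m, X)) (n : ℕ) (w : Fin (n + 1) → Simp m) (a : k) :
    real σ n (Finsupp.single w a) = Finsupp.single (σ.comp (Simp.aff w)) a := by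
  simp [real]

lemma real_vert (n : ℕ) (σ : C(Simp n, X)) :
    real σ n (Finsupp.single (Simp.vert n) (1 : k)) = Finsupp.single σ 1 := by
  rw [real_single, Simp.aff_vert, ContinuousMap.comp_id]

lemma bd_real {m : ℕ} (σ : C(Simp m, X)) (n : ℕ) (c : Chain k (Simp m) (n + 1)) :
    bd n (real σ (n + 1) c) = real σ n (TupleChain.bd n c) := by
  refine LinearMap.congr_fun (f := bd n ∘ₗ real σ (n + 1)) (g := real σ n ∘ₗ TupleChain.bd n)
    (TupleChain.hom_ext fun w => ?_) c
  simp only [LinearMap.comp_apply, real_single, bd_single, TupleChain.bd_single, map_sum, map_smul,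
    ContinuousMap.comp_assoc, Simp.aff_comp_face]

/-- A singular simplex is the realization of the tuple of vertices of its own source, so identities
of natural operators reduce to identities for affine chains. -/
lemma ext_real {M : Type} [AddCommGroup M] [Module k M] {n : ℕ} {f g : Ch k X n →ₗ[k] M}
    (h : ∀ σ : C(Simp n, X), f (real σ n (Finsupp.single (Simp.vert n) 1)) =
      g (real σ n (Finsupp.single (Simp.vert n) 1))) : f = g :=
  TupleChain.hom_ext fun σ => by rw [← real_vert]; exact h σ

lemma bd_bd (n : ℕ) (c : Ch k X (n + 2)) : bd n (bd (n + 1) c) = 0 := by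
  refine LinearMap.congr_fun (f := bd n ∘ₗ bd (n + 1)) (g := 0) (ext_real fun σ => ?_) c
  rw [LinearMap.comp_apply, bd_real, bd_real, TupleChain.bd_bd]
  simp

lemma push_bd (f : C(X, Y)) (n : ℕ) (c : Ch k X (n + 1)) :
    push f n (bd n c) = bd n (push f (n + 1) c) := by
  refine LinearMap.congr_fun (f := push f n ∘ₗ bd n) (g := bd n ∘ₗ push f (n + 1))
    (TupleChain.hom_ext fun w => ?_) c
  simp only [LinearMap.comp_apply, push_single, bd_single, map_sum, map_smul,
    ContinuousMap.comp_assoc]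

lemma push_push (g : C(Y, Z)) (f : C(X, Y)) (n : ℕ) (c : Ch k X n) :
    push g n (push f n c) = push (g.comp f) n c := by
  refine LinearMap.congr_fun (f := push g n ∘ₗ push f n) (g := push (g.comp f) n)
    (TupleChain.hom_ext fun w => ?_) c
  simp [ContinuousMap.comp_assoc]

lemma push_id (n : ℕ) (c : Ch k X n) : push (ContinuousMap.id X) n c = c := by
  refine LinearMap.congr_fun (f := push (ContinuousMap.id X) n) (g := LinearMap.id)
    (TupleChain.hom_ext fun w => ?_) c
  simp

lemma single_mem_sub {A : Set X} {n : ℕ} {σ : C(Simp n, X)} (h : ∀ x, σ x ∈ A) (a : k) :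
    Finsupp.single σ a ∈ sub k A n :=
  Finsupp.single_mem_supported _ _ h

lemma sub_mono {A B : Set X} (h : A ⊆ B) (n : ℕ) : sub k A n ≤ sub k B n :=
  Finsupp.supported_mono fun _ hσ x => h (hσ x)

lemma mem_sub_inter {A B : Set X} {n : ℕ} {c : Ch k X n} (hA : c ∈ sub k A n)
    (hB : c ∈ sub k B n) : c ∈ sub k (A ∩ B) n := by
  rw [sub, Finsupp.mem_supported] at *
  exact fun σ hσ x => ⟨hA hσ x, hB hσ x⟩

lemma mem_sub_univ {n : ℕ} (c : Ch k X n) : c ∈ sub k (Set.univ : Set X) n := by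
  rw [sub, Finsupp.mem_supported]
  exact fun σ _ x => trivial

lemma map_mem_sub {A : Set X} {B : Set Y} {n m : ℕ} {f : Ch k X n →ₗ[k] Ch k Y m}
    (h : ∀ σ : C(Simp n, X), (∀ x, σ x ∈ A) → f (Finsupp.single σ 1) ∈ sub k B m) {c : Ch k X n}
    (hc : c ∈ sub k A n) : f c ∈ sub k B m :=
  TupleChain.mem_supported_of_single h hc

lemma bd_mem_sub {A : Set X} {n : ℕ} {c : Ch k X (n + 1)} (hc : c ∈ sub k A (n + 1)) :
    bd n c ∈ sub k A n := by
  refine map_mem_sub (fun σ hσ => ?_) hc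
  rw [bd_single]
  exact Submodule.sum_mem _ fun i _ => Submodule.smul_mem _ _ (single_mem_sub (fun x => hσ (Simp.face n i x)) _)

lemma push_mem_sub {A : Set X} {B : Set Y} {f : C(X, Y)} (hf : Set.MapsTo f A B) {n : ℕ}
    {c : Ch k X n} (hc : c ∈ sub k A n) : push f n c ∈ sub k B n := by
  refine map_mem_sub (fun σ hσ => ?_) hc
  rw [push_single]
  exact single_mem_sub (fun x => hf (hσ x)) _

lemma real_mem_sub {A : Set X} {m n : ℕ} {σ : C(Simp m, X)} (hσ : ∀ x, σ x ∈ A)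
    (c : Chain k (Simp m) n) : real σ n c ∈ sub k A n := by
  induction c using Finsupp.induction_linear with
  | zero => simp
  | add x y hx hy => rw [map_add]; exact Submodule.add_mem _ hx hy
  | single w a => rw [real_single]; exact single_mem_sub (fun x => hσ (Simp.aff w x)) _

/-- Barycentric subdivision of singular chains. -/
def sd (n : ℕ) : Ch k X n →ₗ[k] Ch k X n :=
  Finsupp.linearCombination k fun σ => real σ n (TupleChain.sd n (Finsupp.single (Simp.vert n) 1))

/-- The chain homotopy from the identity to the barycentric subdivision. -/
def sdHom (n : ℕ) : Ch k X n →ₗ[k] Ch k X (n + 1) :=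
  Finsupp.linearCombination k fun σ =>
    real σ (n + 1) (TupleChain.sdHom n (Finsupp.single (Simp.vert n) 1))

lemma real_comp_aff {l m : ℕ} (σ : C(Simp m, X)) (v : Fin (l + 1) → Simp m) (n : ℕ)
    (c : Chain k (Simp l) n) :
    real (σ.comp (Simp.aff v)) n c = real σ n (TupleChain.map (Simp.aff v) n c) := by
  refine LinearMap.congr_fun (f := real (σ.comp (Simp.aff v)) n)
    (g := real σ n ∘ₗ TupleChain.map (Simp.aff v) n) (TupleChain.hom_ext fun w => ?_) c
  simp [Simp.aff_aff, ContinuousMap.comp_assoc]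

lemma sd_real {m : ℕ} (σ : C(Simp m, X)) (n : ℕ) (c : Chain k (Simp m) n) :
    sd n (real σ n c) = real σ n (TupleChain.sd n c) := by
  refine LinearMap.congr_fun (f := sd n ∘ₗ real σ n) (g := real σ n ∘ₗ TupleChain.sd n)
    (TupleChain.hom_ext fun w => ?_) c
  simp only [LinearMap.comp_apply, real_single]
  rw [sd, Finsupp.linearCombination_single, one_smul, real_comp_aff, TupleChain.map_sd,
    TupleChain.map_single, Simp.aff_comp_vert]

lemma sdHom_real {m : ℕ} (σ : C(Simp m, X)) (n : ℕ) (c : Chain k (Simp m) n) :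
    sdHom n (real σ n c) = real σ (n + 1) (TupleChain.sdHom n c) := by
  refine LinearMap.congr_fun (f := sdHom n ∘ₗ real σ n) (g := real σ (n + 1) ∘ₗ TupleChain.sdHom n)
    (TupleChain.hom_ext fun w => ?_) c
  simp only [LinearMap.comp_apply, real_single]
  rw [sdHom, Finsupp.linearCombination_single, one_smul, real_comp_aff, TupleChain.map_sdHom,
    TupleChain.map_single, Simp.aff_comp_vert]

lemma bd_sd (n : ℕ) (c : Ch k X (n + 1)) : bd n (sd (n + 1) c) = sd n (bd n c) := by
  refine LinearMap.congr_fun (f := bd n ∘ₗ sd (n + 1)) (g := sd n ∘ₗ bd n) (ext_real fun σ => ?_) c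
  simp only [LinearMap.comp_apply]
  rw [sd_real, bd_real, bd_real, sd_real, TupleChain.bd_sd]

lemma bd_sdHom (n : ℕ) (c : Ch k X (n + 1)) :
    c - sd (n + 1) c = bd (n + 1) (sdHom (n + 1) c) + sdHom n (bd n c) := by
  refine LinearMap.congr_fun (f := LinearMap.id - sd (n + 1))
    (g := bd (n + 1) ∘ₗ sdHom (n + 1) + sdHom n ∘ₗ bd n) (ext_real fun σ => ?_) c
  simp only [LinearMap.comp_apply, LinearMap.sub_apply, LinearMap.add_apply, LinearMap.id_apply]
  rw [sd_real, sdHom_real, bd_real, bd_real, sdHom_real, TupleChain.bd_sdHom, ← map_add, ← map_sub]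
  congr 1
  abel

lemma sd_mem_sub {A : Set X} {n : ℕ} {c : Ch k X n} (hc : c ∈ sub k A n) : sd n c ∈ sub k A n := by
  refine map_mem_sub (fun σ hσ => ?_) hc
  rw [sd, Finsupp.linearCombination_single, one_smul]
  exact real_mem_sub hσ _

lemma sdHom_mem_sub {A : Set X} {n : ℕ} {c : Ch k X n} (hc : c ∈ sub k A n) :
    sdHom n c ∈ sub k A (n + 1) := by
  refine map_mem_sub (fun σ hσ => ?_) hc
  rw [sdHom, Finsupp.linearCombination_single, one_smul]
  exact real_mem_sub hσ _

lemma bd_sd_iterate (r n : ℕ) (c : Ch k X (n + 1)) :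
    bd n ((sd (n + 1))^[r] c) = (sd n)^[r] (bd n c) := by
  induction r with
  | zero => rfl
  | succ r ih => rw [Function.iterate_succ_apply', Function.iterate_succ_apply', bd_sd, ih]

lemma sd_iterate_mem_sub {A : Set X} (r : ℕ) {n : ℕ} {c : Ch k X n} (hc : c ∈ sub k A n) :
    (sd n)^[r] c ∈ sub k A n := by
  induction r with
  | zero => exact hc
  | succ r ih => rw [Function.iterate_succ_apply']; exact sd_mem_sub ih

/-- Telescoping the homotopies for single subdivisions. The operators preserve every subspace at
once because they act on the source of each simplex. -/
lemma exists_sd_iterate_homotopy (r : ℕ) : ∃ D : ∀ n, Ch k X n →ₗ[k] Ch k X (n + 1),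
    (∀ n c, c - (sd (n + 1))^[r] c = bd (n + 1) (D (n + 1) c) + D n (bd n c)) ∧
    ∀ (A : Set X) n c, c ∈ sub k A n → D n c ∈ sub k A (n + 1) := by
  induction r with
  | zero => exact ⟨fun n => 0, by simp, by simp⟩
  | succ r ih =>
    obtain ⟨D, hD, hA⟩ := ih
    refine ⟨fun n => D n + sdHom n ∘ₗ (sd n) ^ r, fun n c => ?_, fun A n c hc => ?_⟩
    · simp only [LinearMap.add_apply, LinearMap.comp_apply, Module.End.pow_apply, map_add]
      rw [Function.iterate_succ_apply', ← bd_sd_iterate]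
      have h1 := hD n c
      have h2 := bd_sdHom n ((sd (n + 1))^[r] c)
      rw [← sub_add_sub_cancel c ((sd (n + 1))^[r] c), h1, h2]
      abel
    · simp only [LinearMap.add_apply, LinearMap.comp_apply, Module.End.pow_apply]
      exact Submodule.add_mem _ (hA A n c hc) (sdHom_mem_sub (sd_iterate_mem_sub r hc))

/-- `U` is open relative to `S`. -/
def RelOpen (U S : Set X) : Prop := ∃ O, IsOpen O ∧ O ∩ S = U ∩ S

lemma sd_iterate_real {m : ℕ} (σ : C(Simp m, X)) (n r : ℕ) (c : Chain k (Simp m) n) :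
    (sd n)^[r] (real σ n c) = real σ n ((TupleChain.sd n)^[r] c) := by
  induction r with
  | zero => rfl
  | succ r ih => rw [Function.iterate_succ_apply', Function.iterate_succ_apply', ih, sd_real]

/-- The Lebesgue number lemma on the source of `σ`. Relative openness suffices because `σ` never
leaves `U ∪ V`. -/
lemma exists_sd_iterate_single_mem {U V : Set X} (hU : RelOpen U (U ∪ V)) (hV : RelOpen V (U ∪ V))
    {n : ℕ} (σ : C(Simp n, X)) (hσ : ∀ x, σ x ∈ U ∪ V) :
    ∃ r, (sd n)^[r] (Finsupp.single σ (1 : k)) ∈ sub k U n ⊔ sub k V n := by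
  obtain ⟨O, hO, hOU⟩ := hU
  obtain ⟨O', hO', hOV⟩ := hV
  have hcov : (Set.univ : Set (Simp n)) ⊆ ⋃ b : Bool, σ ⁻¹' (if b then O else O') := by
    intro x _
    rcases hσ x with h | h
    · refine Set.mem_iUnion.2 ⟨true, ?_⟩
      have : σ x ∈ U ∩ (U ∪ V) := ⟨h, Or.inl h⟩
      rw [← hOU] at this
      simpa using this.1
    · refine Set.mem_iUnion.2 ⟨false, ?_⟩
      have : σ x ∈ V ∩ (U ∪ V) := ⟨h, Or.inr h⟩
      rw [← hOV] at this
      simpa using this.1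
  have hop : ∀ b : Bool, IsOpen (σ ⁻¹' (if b then O else O')) := by
    intro b
    cases b
    · simpa using hO'.preimage σ.continuous
    · simpa using hO.preimage σ.continuous
  obtain ⟨δ, hδ, hball⟩ := lebesgue_number_lemma_of_metric isCompact_univ hop hcov
  have hlt : (n : ℝ) / (n + 1) < 1 := by
    rw [div_lt_one (by positivity)]
    linarith
  -- The standard simplex has diameter at most 1, so `r` subdivisions bring the mesh down to `(n /
  -- (n + 1)) ^ r`, below the Lebesgue number.
  obtain ⟨r, hr⟩ := exists_pow_lt_of_lt_one hδ hlt
  refine ⟨r, ?_⟩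
  have hvert : Simp.vert n ∈ TupleChain.tuples (Set.univ : Set (Simp n)) 1 n := by
    refine ⟨fun i => trivial, fun i j => ?_⟩
    exact (Metric.dist_le_diam_of_mem (bounded_stdSimplex _) (Simp.vert n i).2
      (Simp.vert n j).2).trans diam_stdSimplex_le
  have h1 := TupleChain.sd_iterate_tuples (k := k) n Set.univ (fun _ _ _ _ => trivial) r _ hvert
  rw [mul_one] at h1
  rw [← real_vert, sd_iterate_real]
  generalize (TupleChain.sd n)^[r] (Finsupp.single (Simp.vert n) (1 : k)) = c at h1
  rw [Finsupp.supported_eq_span_single] at h1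
  induction h1 using Submodule.span_induction with
  | zero => simp
  | add x y _ _ hx hy => rw [map_add]; exact Submodule.add_mem _ hx hy
  | smul a x _ hx => rw [map_smul]; exact Submodule.smul_mem _ _ hx
  | mem x hx =>
    obtain ⟨w, hw, rfl⟩ := hx
    simp only [real_single]
    obtain ⟨b, hb⟩ := hball (w 0) trivial
    -- All vertices are close to the first one and balls are convex, so the whole affine simplex
    -- stays in one member of the cover.
    have hin : ∀ x, Simp.aff w x ∈ σ ⁻¹' (if b then O else O') := by
      intro x
      refine hb (Metric.closedBall_subset_ball hr ?_)
      exact TupleChain.sConvex_closedBall _ _ n w x fun i => hw.2 i 0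
    cases b with
    | true =>
      refine Submodule.mem_sup_left (single_mem_sub (fun x => ?_) _)
      have : σ (Simp.aff w x) ∈ O ∩ (U ∪ V) := ⟨by simpa using hin x, hσ _⟩
      rw [hOU] at this
      exact this.1
    | false =>
      refine Submodule.mem_sup_right (single_mem_sub (fun x => ?_) _)
      have : σ (Simp.aff w x) ∈ O' ∩ (U ∪ V) := ⟨by simpa using hin x, hσ _⟩
      rw [hOV] at this
      exact this.1

lemma sd_iterate_mem_sup {U V : Set X} (r : ℕ) {n : ℕ} {c : Ch k X n}
    (hc : c ∈ sub k U n ⊔ sub k V n) : (sd n)^[r] c ∈ sub k U n ⊔ sub k V n := by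
  obtain ⟨a, ha, b, hb, rfl⟩ := Submodule.mem_sup.1 hc
  rw [← Module.End.pow_apply, map_add, Module.End.pow_apply, Module.End.pow_apply]
  exact Submodule.add_mem_sup (sd_iterate_mem_sub r ha) (sd_iterate_mem_sub r hb)

lemma exists_sd_iterate_mem {U V : Set X} (hU : RelOpen U (U ∪ V)) (hV : RelOpen V (U ∪ V))
    {n : ℕ} {c : Ch k X n} (hc : c ∈ sub k (U ∪ V) n) :
    ∃ r, (sd n)^[r] c ∈ sub k U n ⊔ sub k V n := by
  rw [sub, Finsupp.supported_eq_span_single] at hc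
  induction hc using Submodule.span_induction with
  | zero => exact ⟨0, by simp⟩
  | mem x hx => obtain ⟨σ, hσ, rfl⟩ := hx; exact exists_sd_iterate_single_mem hU hV σ hσ
  | smul a x _ hx =>
    obtain ⟨r, hr⟩ := hx
    refine ⟨r, ?_⟩
    rw [← Module.End.pow_apply, map_smul, Module.End.pow_apply]
    exact Submodule.smul_mem _ _ hr
  | add x y _ _ hx hy =>
    obtain ⟨r, hr⟩ := hx
    obtain ⟨s, hs⟩ := hy
    refine ⟨r + s, ?_⟩
    rw [← Module.End.pow_apply, map_add, Module.End.pow_apply, Module.End.pow_apply]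
    refine Submodule.add_mem _ ?_ ?_
    · rw [add_comm r s, Function.iterate_add_apply]; exact sd_iterate_mem_sup s hr
    · rw [Function.iterate_add_apply]; exact sd_iterate_mem_sup r hs

/-- The couple `A`, `B` is excisive: chains in `A ∪ B` whose boundary is a sum of chains in `A`
and in `B` are homologous to such sums. -/
def Excisive (k : Type) [CommRing k] (A B : Set X) : Prop :=
  ∀ (n : ℕ) (c : Ch k X (n + 1)), c ∈ sub k (A ∪ B) (n + 1) → bd n c ∈ sub k A n ⊔ sub k B n →
    ∃ d ∈ sub k (A ∪ B) (n + 2), c - bd (n + 1) d ∈ sub k A (n + 1) ⊔ sub k B (n + 1)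

/-- The chain is replaced by an iterated subdivision; the error is the boundary of `D c` plus `D` of
the boundary of `c`, and the latter respects the given splitting into `A` and `B`. The couple `A`,
`B` may differ from `U`, `V`, which is used for collars. -/
lemma exists_small {A B U V : Set X} (hU : RelOpen U (U ∪ V)) (hV : RelOpen V (U ∪ V))
    {n : ℕ} {c : Ch k X (n + 1)} (hc : c ∈ sub k (U ∪ V) (n + 1))
    (hbc : bd n c ∈ sub k A n ⊔ sub k B n) :
    ∃ d ∈ sub k (U ∪ V) (n + 2), ∃ e ∈ sub k A (n + 1) ⊔ sub k B (n + 1),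
      c - bd (n + 1) d - e ∈ sub k U (n + 1) ⊔ sub k V (n + 1) := by
  obtain ⟨r, hr⟩ := exists_sd_iterate_mem hU hV hc
  obtain ⟨D, hD, hA⟩ := exists_sd_iterate_homotopy (k := k) (X := X) r
  obtain ⟨a, ha, b, hb, hab⟩ := Submodule.mem_sup.1 hbc
  refine ⟨D (n + 1) c, hA _ _ _ hc, D n (bd n c), ?_, ?_⟩
  · rw [← hab, map_add]
    exact Submodule.add_mem_sup (hA _ _ _ ha) (hA _ _ _ hb)
  · rw [sub_sub, ← hD, sub_sub_cancel]
    exact hr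

/-- Two relatively open sets form an excisive couple. -/
theorem excisive_of_relOpen {U V : Set X} (hU : RelOpen U (U ∪ V)) (hV : RelOpen V (U ∪ V)) :
    Excisive k U V := by
  intro n c hc hbc
  obtain ⟨d, hd, e, he, h⟩ := exists_small hU hV hc hbc
  exact ⟨d, hd, by simpa using Submodule.add_mem _ h he⟩

theorem excisive_of_isOpen {U V : Set X} (hU : IsOpen U) (hV : IsOpen V) : Excisive k U V :=
  excisive_of_relOpen ⟨U, hU, rfl⟩ ⟨V, hV, rfl⟩

end SingChain

end

/-! ### Comparison with Mathlib's singular homology -/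

noncomputable section

namespace SingChain

open AlgebraicTopology Limits Simplicial

variable {k : Type} [CommRing k] {X Y Z : Type} [TopologicalSpace X] [TopologicalSpace Y]
  [TopologicalSpace Z]

/-- Mathlib's singular chain complex with coefficients in `k`. -/
abbrev cx (k : Type) [CommRing k] (X : Type) [TopologicalSpace X] : ChainComplex (ModuleCat.{0} k) ℕ :=
  ((singularChainComplexFunctor (ModuleCat.{0} k)).obj (ModuleCat.of k k)).obj (TopCat.of X)

/-- The chain map induced by a continuous map. -/
abbrev cxMap (k : Type) [CommRing k] (f : C(X, Y)) : cx k X ⟶ cx k Y :=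
  ((singularChainComplexFunctor (ModuleCat.{0} k)).obj (ModuleCat.of k k)).map (TopCat.ofHom f)

/-- The inclusion of the summand given by a singular simplex. -/
def cxι (k : Type) [CommRing k] {n : ℕ} (σ : C(Simp n, X)) : ModuleCat.of k k ⟶ (cx k X).X n :=
  (TopCat.toSSet.obj (TopCat.of X)).ιChainComplex
    ((TopCat.toSSetObjEquiv (TopCat.of X) (.op ⦋n⦌)).symm σ)

lemma cxι_d {n : ℕ} (σ : C(Simp (n + 1), X)) :
    cxι k σ ≫ (cx k X).d (n + 1) n =
      ∑ i : Fin (n + 2), (-1 : ℤ) ^ (i : ℕ) • cxι k (σ.comp (Simp.face n i)) := by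
  refine ((TopCat.toSSet.obj (TopCat.of X)).ιChainComplex_d (ModuleCat.of k k) _).trans ?_
  refine Finset.sum_congr rfl fun i _ => ?_
  rfl

lemma cxι_map {n : ℕ} (σ : C(Simp n, X)) (f : C(X, Y)) :
    cxι k σ ≫ (cxMap k f).f n = cxι k (f.comp σ) :=
  SSet.ι_chainComplexMap_f _ _ _ _ _

/-- The comparison of singular chains with Mathlib's singular chain complex. -/
def toCx (n : ℕ) : Ch k X n →ₗ[k] (cx k X).X n :=
  Finsupp.linearCombination k fun σ => (cxι k σ).hom (1 : k)

lemma toCx_single {n : ℕ} (σ : C(Simp n, X)) :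
    toCx n (Finsupp.single σ (1 : k)) = (cxι k σ).hom (1 : k) := by
  simp [toCx]

/-- The inverse of `toCx`. -/
def ofCx (n : ℕ) : (cx k X).X n ⟶ ModuleCat.of k (Ch k X n) :=
  ((TopCat.toSSet.obj (TopCat.of X)).isColimitChainComplexXCofan (ModuleCat.of k k) n).desc
    (Cofan.mk _ fun x => ModuleCat.ofHom
      (Finsupp.lsingle (TopCat.toSSetObjEquiv (TopCat.of X) (.op ⦋n⦌) x)))

lemma cxι_ofCx {n : ℕ} (σ : C(Simp n, X)) :
    cxι k σ ≫ ofCx n = ModuleCat.ofHom (Finsupp.lsingle σ) :=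
  ((TopCat.toSSet.obj (TopCat.of X)).isColimitChainComplexXCofan (ModuleCat.of k k) n).fac
    (Cofan.mk (f := fun _ : (TopCat.toSSet.obj (TopCat.of X)) _⦋n⦌ => ModuleCat.of k k) _
      fun x => ModuleCat.ofHom
        (Finsupp.lsingle (TopCat.toSSetObjEquiv (TopCat.of X) (.op ⦋n⦌) x))) ⟨_⟩

lemma ofCx_toCx (n : ℕ) (c : Ch k X n) : (ofCx n).hom (toCx n c) = c := by
  refine LinearMap.congr_fun (f := (ofCx n).hom ∘ₗ toCx n) (g := LinearMap.id)
    (TupleChain.hom_ext fun σ => ?_) c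
  rw [LinearMap.comp_apply, toCx_single]
  exact congr($(cxι_ofCx (k := k) σ) (1 : k))

lemma cx_hom_ext {n : ℕ} {M : ModuleCat.{0} k} {f g : (cx k X).X n ⟶ M}
    (h : ∀ σ : C(Simp n, X), cxι k σ ≫ f = cxι k σ ≫ g) : f = g := by
  refine SSet.chainComplex_hom_ext fun x => ?_
  have := h (TopCat.toSSetObjEquiv (TopCat.of X) (.op ⦋n⦌) x)
  rwa [cxι, Equiv.symm_apply_apply] at this

lemma toCx_ofCx (n : ℕ) (x : (cx k X).X n) : toCx n ((ofCx n).hom x) = x := by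
  have : ofCx n ≫ ModuleCat.ofHom (toCx n) = 𝟙 ((cx k X).X n) := by
    refine cx_hom_ext fun σ => ?_
    rw [← Category.assoc, cxι_ofCx, Category.comp_id]
    ext
    exact toCx_single σ
  exact congr($this x)

/-- Reconciles the integer signs of the categorical differential with signs taken in the coefficient
ring. -/
lemma hom_alternating_sum {M N : ModuleCat.{0} k} {m : ℕ} (g : Fin m → (M ⟶ N)) (x : M) :
    (∑ i : Fin m, (-1 : ℤ) ^ (i : ℕ) • g i).hom x = ∑ i : Fin m, (-1 : k) ^ (i : ℕ) • (g i).hom x := by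
  rw [ModuleCat.hom_sum, LinearMap.sum_apply]
  refine Finset.sum_congr rfl fun i _ => ?_
  rcases Nat.even_or_odd (i : ℕ) with h | h <;> simp [h.neg_one_pow]

lemma toCx_bd (n : ℕ) (c : Ch k X (n + 1)) :
    toCx n (bd n c) = ((cx k X).d (n + 1) n).hom (toCx (n + 1) c) := by
  refine LinearMap.congr_fun (f := toCx n ∘ₗ bd n) (g := ((cx k X).d (n + 1) n).hom ∘ₗ toCx (n + 1))
    (TupleChain.hom_ext fun σ => ?_) c
  rw [LinearMap.comp_apply, LinearMap.comp_apply, toCx_single, bd_single]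
  have h := congr($(cxι_d (k := k) σ) (1 : k))
  refine Eq.trans ?_ h.symm
  rw [map_sum]
  simp only [map_smul, toCx_single]
  exact (hom_alternating_sum _ _).symm

lemma toCx_push (f : C(X, Y)) (n : ℕ) (c : Ch k X n) :
    toCx n (push f n c) = ((cxMap k f).f n).hom (toCx n c) := by
  refine LinearMap.congr_fun (f := toCx n ∘ₗ push f n) (g := ((cxMap k f).f n).hom ∘ₗ toCx n)
    (TupleChain.hom_ext fun σ => ?_) c
  rw [LinearMap.comp_apply, LinearMap.comp_apply, toCx_single, push_single, toCx_single]
  exact congr($((cxι_map σ f).symm) (1 : k))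

/-- Homotopic maps agree on cycles up to boundaries. -/
theorem push_sub_push_of_homotopy {f g : C(X, Y)} (H : f.Homotopy g) (n : ℕ) {z : Ch k X (n + 1)}
    (hz : bd n z = 0) : ∃ c, bd (n + 1) c = push f (n + 1) z - push g (n + 1) z := by
  have h : Homotopy (cxMap k f) (cxMap k g) :=
    TopCat.Homotopy.singularChainComplexFunctorObjMap (f := TopCat.ofHom f) (g := TopCat.ofHom g) H
      (ModuleCat.of k k)
  refine ⟨(ofCx (n + 2)).hom ((h.hom (n + 1) (n + 2)).hom (toCx (n + 1) z)), ?_⟩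
  have e := h.comm (n + 1)
  rw [dNext_eq h.hom (show (ComplexShape.down ℕ).Rel (n + 1) n from rfl),
    prevD_eq h.hom (show (ComplexShape.down ℕ).Rel (n + 2) (n + 1) from rfl)] at e
  have e1 := congr($e (toCx (n + 1) z))
  have hz' : ((cx k X).d (n + 1) n).hom (toCx (n + 1) z) = 0 := by rw [← toCx_bd, hz, map_zero]
  have e2 : ((cxMap k f).f (n + 1)).hom (toCx (n + 1) z) =
      (h.hom n (n + 1)).hom (((cx k X).d (n + 1) n).hom (toCx (n + 1) z)) +
      ((cx k Y).d (n + 2) (n + 1)).hom ((h.hom (n + 1) (n + 2)).hom (toCx (n + 1) z)) +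
      ((cxMap k g).f (n + 1)).hom (toCx (n + 1) z) := e1
  rw [hz', map_zero, zero_add, ← toCx_push, ← toCx_push] at e2
  have inj : Function.Injective (toCx (k := k) (X := Y) (n + 1)) :=
    Function.LeftInverse.injective (ofCx_toCx (n + 1))
  apply inj
  rw [toCx_bd, toCx_ofCx, map_sub, e2, add_sub_cancel_right]

/-- Homology embeds into the cokernel of the incoming differential, where vanishing means being a
boundary. -/
lemma homologyπ_eq_zero_iff (K : ChainComplex (ModuleCat.{0} k) ℕ) (n : ℕ) (z : K.cycles (n + 1)) :
    K.homologyπ (n + 1) z = 0 ↔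
      ∃ c : K.X (n + 2), K.d (n + 2) (n + 1) c = K.iCycles (n + 1) z := by
  have h1 : K.homologyπ (n + 1) z = 0 ↔ K.homologyι (n + 1) (K.homologyπ (n + 1) z) = 0 := by
    constructor
    · intro h; rw [h, map_zero]
    · intro h
      exact (ModuleCat.mono_iff_injective (K.homologyι (n + 1))).1 inferInstance (by rw [h, map_zero])
  have h2 : K.homologyι (n + 1) (K.homologyπ (n + 1) z) =
      K.pOpcycles (n + 1) (K.iCycles (n + 1) z) :=
    congr($(K.homology_π_ι (n + 1)) z)
  rw [h1, h2]
  refine ((K.sc (n + 1)).moduleCat_pOpcycles_eq_zero_iff _).trans ?_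
  have h3 : (ComplexShape.down ℕ).prev (n + 1) = n + 2 := ChainComplex.prev ℕ (n + 1)
  change (∃ c : K.X ((ComplexShape.down ℕ).prev (n + 1)), K.d _ (n + 1) c = _) ↔ _
  rw [h3]

lemma isIso_homologyMap {K L : ChainComplex (ModuleCat.{0} k) ℕ} (φ : K ⟶ L) (n : ℕ)
    (hinj : ∀ z : K.X (n + 1), K.d (n + 1) n z = 0 →
      (∃ c : L.X (n + 2), L.d (n + 2) (n + 1) c = φ.f (n + 1) z) →
      ∃ c : K.X (n + 2), K.d (n + 2) (n + 1) c = z)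
    (hsurj : ∀ w : L.X (n + 1), L.d (n + 1) n w = 0 → ∃ z : K.X (n + 1), K.d (n + 1) n z = 0 ∧
      ∃ c : L.X (n + 2), L.d (n + 2) (n + 1) c = w - φ.f (n + 1) z) :
    IsIso (HomologicalComplex.homologyMap φ (n + 1)) := by
  have hπ : ∀ (M : ChainComplex (ModuleCat.{0} k) ℕ),
      Function.Surjective (M.homologyπ (n + 1)) := fun M =>
    (ModuleCat.epi_iff_surjective _).1 inferInstance
  have hnat : ∀ z : K.cycles (n + 1), HomologicalComplex.homologyMap φ (n + 1)
      (K.homologyπ (n + 1) z) = L.homologyπ (n + 1) (HomologicalComplex.cyclesMap φ (n + 1) z) :=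
    fun z => congr($(HomologicalComplex.homologyπ_naturality φ (n + 1)) z)
  have hi : ∀ z : K.cycles (n + 1), L.iCycles (n + 1) (HomologicalComplex.cyclesMap φ (n + 1) z) =
      φ.f (n + 1) (K.iCycles (n + 1) z) :=
    fun z => congr($(HomologicalComplex.cyclesMap_i φ (n + 1)) z)
  have hcyc : ∀ (M : ChainComplex (ModuleCat.{0} k) ℕ) (z : M.cycles (n + 1)),
      M.d (n + 1) n (M.iCycles (n + 1) z) = 0 :=
    fun M z => congr($(M.iCycles_d (n + 1) n) z)
  have hlift : ∀ (z : K.X (n + 1)), K.d (n + 1) n z = 0 →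
      ∃ z' : K.cycles (n + 1), K.iCycles (n + 1) z' = z := by
    intro z hz
    -- A cycle is lifted to the object of cycles as a morphism out of the free module of rank one.
    let t : ModuleCat.of k k ⟶ K.X (n + 1) := ModuleCat.ofHom (LinearMap.toSpanSingleton k _ z)
    have ht : t ≫ K.d (n + 1) n = 0 := by
      ext
      simpa [t] using hz
    refine ⟨K.liftCycles t n (ChainComplex.next_nat_succ n) ht (1 : k), ?_⟩
    have := congr($(K.liftCycles_i t n (ChainComplex.next_nat_succ n) ht) (1 : k))
    refine this.trans ?_
    simp [t]
  have : Function.Bijective (HomologicalComplex.homologyMap φ (n + 1)) := by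
    constructor
    · rw [injective_iff_map_eq_zero]
      intro x hx
      obtain ⟨z, rfl⟩ := hπ K x
      rw [hnat, homologyπ_eq_zero_iff, hi] at hx
      rw [homologyπ_eq_zero_iff]
      exact hinj _ (hcyc K z) hx
    · intro y
      obtain ⟨w, rfl⟩ := hπ L y
      obtain ⟨z, hz, hc⟩ := hsurj _ (hcyc L w)
      obtain ⟨z', rfl⟩ := hlift z hz
      refine ⟨K.homologyπ (n + 1) z', ?_⟩
      rw [hnat]
      symm
      rw [← sub_eq_zero, ← map_sub, homologyπ_eq_zero_iff, map_sub, hi]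
      exact hc
  exact (ConcreteCategory.isIso_iff_bijective _).2 this

/-- A criterion for a map to induce an isomorphism in singular homology, in terms of chains. -/
theorem isIso_singularHomologyMap (f : C(X, Y)) (n : ℕ)
    (hinj : ∀ z : Ch k X (n + 1), bd n z = 0 → (∃ c, bd (n + 1) c = push f (n + 1) z) →
      ∃ c, bd (n + 1) c = z)
    (hsurj : ∀ w : Ch k Y (n + 1), bd n w = 0 → ∃ z, bd n z = 0 ∧
      ∃ c, bd (n + 1) c = w - push f (n + 1) z) :
    IsIso (((singularHomologyFunctor (ModuleCat.{0} k) (n + 1)).obj (ModuleCat.of k k)).map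
      (TopCat.ofHom f)) := by
  have inj : ∀ {X : Type} [TopologicalSpace X] (m : ℕ),
      Function.Injective (toCx (k := k) (X := X) m) := fun m =>
    Function.LeftInverse.injective (ofCx_toCx m)
  have surj : ∀ {X : Type} [TopologicalSpace X] (m : ℕ),
      Function.Surjective (toCx (k := k) (X := X) m) := fun m =>
    Function.RightInverse.surjective (toCx_ofCx m)
  refine isIso_homologyMap (cxMap k f) n ?_ ?_
  · intro z hz hc
    obtain ⟨z, rfl⟩ := surj _ z
    obtain ⟨c, hc⟩ := hc
    obtain ⟨c, rfl⟩ := surj _ c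
    obtain ⟨e, he⟩ := hinj z (inj _ (by rw [toCx_bd, map_zero]; exact hz))
      ⟨c, inj _ (by rw [toCx_bd, toCx_push]; exact hc)⟩
    exact ⟨toCx _ e, by rw [← he]; exact (toCx_bd _ _).symm⟩
  · intro w hw
    obtain ⟨w, rfl⟩ := surj _ w
    obtain ⟨z, hz, c, hc⟩ := hsurj w (inj _ (by rw [toCx_bd, map_zero]; exact hw))
    refine ⟨toCx _ z, ?_, toCx _ c, ?_⟩
    · exact (toCx_bd _ _).symm.trans (by rw [hz, map_zero])
    · refine (toCx_bd _ _).symm.trans ?_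
      rw [hc, map_sub, toCx_push]

end SingChain

end

/-! ### Cycles and acyclicity on subsets -/

noncomputable section

namespace SingChain

variable {k : Type} [CommRing k] {X Y Z : Type} [TopologicalSpace X] [TopologicalSpace Y]
  [TopologicalSpace Z]

/-- Cycles relative to `A`. -/
def RelCyc (A : Set X) : ∀ {n : ℕ}, Ch k X n → Prop
  | 0, _ => True
  | n + 1, z => bd n z ∈ sub k A n

/-- Cycles. -/
def IsCyc : ∀ {n : ℕ}, Ch k X n → Prop
  | 0, _ => True
  | n + 1, z => bd n z = 0

/-- Every `n`-cycle in `A` is a boundary in `A`. -/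
def AcycOn (k : Type) [CommRing k] (A : Set X) (n : ℕ) : Prop :=
  ∀ z ∈ sub k A n, IsCyc z → ∃ c ∈ sub k A (n + 1), bd n c = z

lemma isCyc_bd {n : ℕ} (c : Ch k X (n + 1)) : IsCyc (bd n c) := by
  cases n with
  | zero => trivial
  | succ n => exact bd_bd n c

lemma IsCyc.push {n : ℕ} {z : Ch k X n} (hz : IsCyc z) (f : C(X, Y)) : IsCyc (push f n z) := by
  cases n with
  | zero => trivial
  | succ n => change bd n _ = 0; rw [← push_bd, show bd n z = 0 from hz, map_zero]

lemma push_injective {f : C(X, Y)} (hf : Function.Injective f) (n : ℕ) :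
    Function.Injective (push (k := k) f n) := by
  refine Finsupp.mapDomain_injective fun σ τ h => ?_
  ext x
  exact hf (DFunLike.congr_fun h x)

lemma IsCyc.of_push {n : ℕ} {z : Ch k X n} {f : C(X, Y)} (hf : Function.Injective f)
    (hz : IsCyc (SingChain.push f n z)) : IsCyc z := by
  cases n with
  | zero => trivial
  | succ n =>
    refine push_injective (k := k) hf n ?_
    rw [push_bd, map_zero]
    exact hz

lemma mem_sub_of_push {f : C(X, Y)} (hf : Function.Injective f) {n : ℕ} {B : Set Y} {c : Ch k X n}
    (h : push f n c ∈ sub k B n) : c ∈ sub k (f ⁻¹' B) n := by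
  classical
  rw [sub, Finsupp.mem_supported] at *
  intro σ hσ x
  have hinj : Function.Injective fun σ : C(Simp n, X) => f.comp σ := fun σ τ h => by
    ext x; exact hf (DFunLike.congr_fun h x)
  refine h (a := f.comp σ) ?_ x
  rw [Finset.mem_coe, Finsupp.mem_support_iff]
  have : (push f n c) (f.comp σ) = c σ := Finsupp.mapDomain_apply hinj c σ
  rw [this]
  exact Finsupp.mem_support_iff.1 hσ

/-- A singular simplex with image in an embedded subset lifts as a function, and the lift is
continuous because the embedding induces the topology. -/
lemma exists_push_eq {f : C(X, Y)} (hf : Topology.IsEmbedding f) {A : Set X} {n : ℕ} {c : Ch k Y n}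
    (hc : c ∈ sub k (f '' A) n) : ∃ c' ∈ sub k A n, push f n c' = c := by
  rw [sub, Finsupp.supported_eq_span_single] at hc
  induction hc using Submodule.span_induction with
  | zero => exact ⟨0, by simp⟩
  | add x y _ _ hx hy =>
    obtain ⟨x, hx, rfl⟩ := hx
    obtain ⟨y, hy, rfl⟩ := hy
    exact ⟨x + y, Submodule.add_mem _ hx hy, map_add _ _ _⟩
  | smul a x _ hx =>
    obtain ⟨x, hx, rfl⟩ := hx
    exact ⟨a • x, Submodule.smul_mem _ _ hx, map_smul _ _ _⟩
  | mem x hx =>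
    obtain ⟨σ, hσ, rfl⟩ := hx
    choose g hg using hσ
    have hg' : Continuous g := hf.isInducing.continuous_iff.2 (by
      convert σ.continuous using 1; ext x; exact (hg x).2)
    refine ⟨Finsupp.single ⟨g, hg'⟩ 1, single_mem_sub (fun x => (hg x).1) _, ?_⟩
    simp only [push_single]
    congr 1
    ext x
    exact (hg x).2

lemma AcycOn.image {f : C(X, Y)} (hf : Topology.IsEmbedding f) {A : Set X} {n : ℕ}
    (h : AcycOn k A n) : AcycOn k (f '' A) n := by
  intro z hz hc
  obtain ⟨z, hz', rfl⟩ := exists_push_eq hf hz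
  obtain ⟨c, hc', rfl⟩ := h z hz' (IsCyc.of_push hf.injective hc)
  exact ⟨push f _ c, push_mem_sub (Set.mapsTo_image f A) hc', (push_bd _ _ _).symm⟩

lemma AcycOn.of_image {f : C(X, Y)} (hf : Topology.IsEmbedding f) {A : Set X} {n : ℕ}
    (h : AcycOn k (f '' A) n) : AcycOn k A n := by
  intro z hz hc
  obtain ⟨c, hc, e⟩ := h (push f n z) (push_mem_sub (Set.mapsTo_image f A) hz) (hc.push f)
  obtain ⟨c, hc', rfl⟩ := exists_push_eq hf hc
  exact ⟨c, hc', push_injective hf.injective n (by rw [push_bd, e])⟩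

/-- The inclusion of a subspace. -/
def incl (A : Set X) : C(A, X) := ⟨Subtype.val, continuous_subtype_val⟩

lemma incl_embedding (A : Set X) : Topology.IsEmbedding (incl A) := Topology.IsEmbedding.subtypeVal

lemma image_incl_univ (A : Set X) : incl A '' Set.univ = A := by
  ext x; simp [incl]

lemma exists_push_incl {A : Set X} {n : ℕ} {c : Ch k X n} (hc : c ∈ sub k A n) :
    ∃ c' : Ch k A n, push (incl A) n c' = c := by
  rw [← image_incl_univ A] at hc
  obtain ⟨c', -, h⟩ := exists_push_eq (incl_embedding A) hc
  exact ⟨c', h⟩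

lemma push_incl_mem {A : Set X} {n : ℕ} (c : Ch k A n) : push (incl A) n c ∈ sub k A n :=
  push_mem_sub (fun x _ => x.2) (mem_sub_univ c)

lemma acycOn_subtype {A : Set X} {n : ℕ} : AcycOn k (Set.univ : Set A) n ↔ AcycOn k A n := by
  constructor
  · intro h
    have := h.image (incl_embedding A)
    rwa [image_incl_univ] at this
  · intro h
    refine AcycOn.of_image (incl_embedding A) ?_
    rwa [image_incl_univ]

theorem homotopy_push {f g : C(X, Y)} (H : f.Homotopic g) (n : ℕ) {z : Ch k X n}
    (hz : IsCyc z) : ∃ c, bd n c = push f n z - push g n z := by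
  obtain ⟨H⟩ := H
  cases n with
  | succ n => exact push_sub_push_of_homotopy H n hz
  | zero =>
    have h : Homotopy (cxMap k f) (cxMap k g) :=
      TopCat.Homotopy.singularChainComplexFunctorObjMap (f := TopCat.ofHom f) (g := TopCat.ofHom g) H
        (ModuleCat.of k k)
    refine ⟨(ofCx 1).hom ((h.hom 0 1).hom (toCx 0 z)), ?_⟩
    have e := h.comm 0
    rw [Homotopy.dNext_zero_chainComplex,
      prevD_eq h.hom (show (ComplexShape.down ℕ).Rel 1 0 from rfl), zero_add] at e
    have e2 : ((cxMap k f).f 0).hom (toCx 0 z) =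
      ((cx k Y).d 1 0).hom ((h.hom 0 1).hom (toCx 0 z)) + ((cxMap k g).f 0).hom (toCx 0 z) :=
      congr($e (toCx 0 z))
    rw [← toCx_push, ← toCx_push] at e2
    have inj : Function.Injective (toCx (k := k) (X := Y) 0) :=
      Function.LeftInverse.injective (ofCx_toCx 0)
    apply inj
    rw [toCx_bd, toCx_ofCx, map_sub, e2, add_sub_cancel_right]

/-- Only one composite need be homotopic to the identity: a cycle is homologous to its image under
`r ∘ i`, which bounds already in `Y`. -/
lemma AcycOn.of_homotopic {i : C(X, Y)} {r : C(Y, X)} (H : (r.comp i).Homotopic (.id X)) {n : ℕ}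
    (h : AcycOn k (Set.univ : Set Y) n) : AcycOn k (Set.univ : Set X) n := by
  intro z _ hz
  obtain ⟨c, -, hc⟩ := h (push i n z) (mem_sub_univ _) (hz.push i)
  obtain ⟨d, hd⟩ := homotopy_push H n hz
  refine ⟨push r _ c - d, mem_sub_univ _, ?_⟩
  rw [map_sub, ← push_bd, hc, push_push, hd, push_id, sub_sub_cancel]

lemma acycOn_of_retract {i : C(X, Y)} {r : C(Y, X)} (H : r.comp i = .id X) {n : ℕ}
    (h : AcycOn k (Set.univ : Set Y) n) : AcycOn k (Set.univ : Set X) n :=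
  AcycOn.of_homotopic (i := i) (r := r) (H ▸ ContinuousMap.Homotopic.refl _) h

lemma acycOn_unique [Unique X] (n : ℕ) : AcycOn k (Set.univ : Set X) (n + 1) := by
  have hu : ∀ m (σ τ : C(Simp m, X)), σ = τ := fun m σ τ => by
    ext x; exact Subsingleton.elim _ _
  let p (m : ℕ) : C(Simp m, X) := ContinuousMap.const _ default
  have hc : ∀ m (c : Ch k X m), c = c (p m) • Finsupp.single (p m) 1 := by
    intro m c
    ext σ
    rw [hu m σ (p m)]
    simp
  have hbd : ∀ m, bd m (Finsupp.single (p (m + 1)) (1 : k)) =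
      (∑ i : Fin (m + 2), (-1 : k) ^ (i : ℕ)) • Finsupp.single (p m) 1 := by
    intro m
    rw [bd_single, Finset.sum_smul]
    rfl
  have hs : ∀ m, (∑ i : Fin m, (-1 : k) ^ (i : ℕ)) = if Even m then 0 else 1 := by
    intro m
    rw [Fin.sum_univ_eq_sum_range (fun i => (-1 : k) ^ i)]
    exact neg_one_geom_sum
  intro z _ hz
  -- There is one simplex in each degree and its boundary is alternately 0 and the next simplex. For
  -- even `n` a chain of degree `n + 1` is a boundary; for odd `n` only zero is a cycle.
  by_cases he : Even n
  · refine ⟨z (p (n + 1)) • Finsupp.single (p (n + 2)) 1, mem_sub_univ _, ?_⟩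
    rw [map_smul, hbd, hs, if_neg (by simp [parity_simps, he]), one_smul, ← hc]
  · have h : bd n z = 0 := hz
    rw [hc _ z, map_smul, hbd, hs, if_neg (by simpa [parity_simps] using he), one_smul] at h
    have h0 : z (p (n + 1)) = 0 := by
      have := DFunLike.congr_fun h (p n)
      simpa using this
    refine ⟨0, mem_sub_univ _, ?_⟩
    rw [hc _ z, h0]
    simp

lemma acycOn_of_contractible [ContractibleSpace X] (n : ℕ) :
    AcycOn k (Set.univ : Set X) (n + 1) := by
  obtain ⟨e⟩ := ContractibleSpace.hequiv_unit X
  exact AcycOn.of_homotopic e.left_inv (acycOn_unique n)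

lemma acycOn_of_starConvex {E : Type} [AddCommGroup E] [Module ℝ E] [TopologicalSpace E]
    [ContinuousAdd E] [ContinuousSMul ℝ E] {s : Set E} {a : E} (hs : StarConvex ℝ a s)
    (ha : s.Nonempty) (n : ℕ) : AcycOn k s (n + 1) := by
  have := hs.contractibleSpace ha
  exact acycOn_subtype.1 (acycOn_of_contractible n)

lemma acycOn_empty (n : ℕ) : AcycOn k (∅ : Set X) n := by
  intro z hz _
  have : z = 0 := by
    rw [sub, Finsupp.mem_supported] at hz
    rw [← Finsupp.support_eq_empty, Finset.eq_empty_iff_forall_notMem]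
    intro σ hσ
    exact hz hσ (Simp.vert n 0)
  exact ⟨0, by simp, by simp [this]⟩

/-! ### Excisive couples -/

lemma Excisive.split {A B : Set X} (h : Excisive k A B) {n : ℕ} {z : Ch k X (n + 1)}
    (hz : z ∈ sub k (A ∪ B) (n + 1)) (hb : bd n z ∈ sub k A n ⊔ sub k B n) :
    ∃ a ∈ sub k A (n + 1), ∃ b ∈ sub k B (n + 1), ∃ d ∈ sub k (A ∪ B) (n + 2),
      z = a + b + bd (n + 1) d := by
  obtain ⟨d, hd, h⟩ := h n z hz hb
  obtain ⟨a, ha, b, hb, e⟩ := Submodule.mem_sup.1 h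
  exact ⟨a, ha, b, hb, d, hd, by rw [e]; abel⟩

lemma Excisive.bd_split {A B : Set X} (h : Excisive k A B) {n : ℕ} {c : Ch k X (n + 1)}
    (hc : c ∈ sub k (A ∪ B) (n + 1)) (hb : bd n c ∈ sub k A n ⊔ sub k B n) :
    ∃ a ∈ sub k A (n + 1), ∃ b ∈ sub k B (n + 1), bd n c = bd n a + bd n b := by
  obtain ⟨a, ha, b, hb', d, -, rfl⟩ := h.split hc hb
  exact ⟨a, ha, b, hb', by rw [map_add, bd_bd, add_zero, map_add]⟩

/-- A cycle in `A ∪ B` is homologous to `a + b` where the boundary of `a` is in `A ∩ B`. -/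
lemma Excisive.split_cycle {A B : Set X} (h : Excisive k A B) {n : ℕ} {z : Ch k X (n + 1)}
    (hz : z ∈ sub k (A ∪ B) (n + 1)) (hb : bd n z = 0) :
    ∃ a ∈ sub k A (n + 1), ∃ b ∈ sub k B (n + 1), ∃ d ∈ sub k (A ∪ B) (n + 2),
      z = a + b + bd (n + 1) d ∧ bd n b = -bd n a ∧ bd n a ∈ sub k (A ∩ B) n := by
  obtain ⟨a, ha, b, hb', d, hd, e⟩ := h.split hz (by rw [hb]; exact Submodule.zero_mem _)
  have h1 : bd n b = -bd n a := by
    rw [e, map_add, map_add, bd_bd, add_zero, add_comm] at hb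
    exact eq_neg_of_add_eq_zero_left hb
  refine ⟨a, ha, b, hb', d, hd, e, h1, mem_sub_inter (bd_mem_sub ha) ?_⟩
  rw [← neg_neg (bd n a), ← h1]
  exact Submodule.neg_mem _ (bd_mem_sub hb')

/-- The part of the Mayer-Vietoris sequence at `Hₙ(A) ⊕ Hₙ(B)`. -/
lemma Excisive.exists_inter {A B : Set X} (h : Excisive k A B) {n : ℕ} {a b : Ch k X n}
    {c : Ch k X (n + 1)} (ha : a ∈ sub k A n) (hb : b ∈ sub k B n) (hc : c ∈ sub k (A ∪ B) (n + 1))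
    (e : bd n c = a - b) : ∃ y ∈ sub k (A ∩ B) n, ∃ u ∈ sub k A (n + 1), ∃ v ∈ sub k B (n + 1),
      a = y + bd n u ∧ b = y + bd n v := by
  obtain ⟨u, hu, v, hv, h'⟩ := h.bd_split hc (by
    rw [e, sub_eq_add_neg]
    exact Submodule.add_mem_sup ha (Submodule.neg_mem _ hb))
  have h2 : a - bd n u = b + bd n v := by
    rw [e] at h'
    rw [sub_eq_iff_eq_add, add_assoc, add_comm (bd n v), ← h']
    abel
  refine ⟨a - bd n u, mem_sub_inter (Submodule.sub_mem _ ha (bd_mem_sub hu)) ?_, u, hu, -v,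
    Submodule.neg_mem _ hv, by abel, by rw [h2, map_neg]; abel⟩
  rw [h2]
  exact Submodule.add_mem _ hb (bd_mem_sub hv)

/-- Mayer-Vietoris: the intersection cycle bounds some `y` in `A ∩ B`, and correcting the two halves
by `y` leaves a cycle in each piece. -/
lemma Excisive.acycOn_union {A B : Set X} (h : Excisive k A B) {n : ℕ} (hA : AcycOn k A (n + 1))
    (hB : AcycOn k B (n + 1)) (hAB : AcycOn k (A ∩ B) n) : AcycOn k (A ∪ B) (n + 1) := by
  intro z hz hc
  obtain ⟨a, ha, b, hb, d, hd, e, h1, h2⟩ := h.split_cycle hz hc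
  obtain ⟨y, hy, hy'⟩ := hAB _ h2 (isCyc_bd a)
  obtain ⟨u, hu, hu'⟩ := hA (a - y) (Submodule.sub_mem _ ha (sub_mono Set.inter_subset_left _ hy))
    (show bd n _ = 0 by rw [map_sub, hy', sub_self])
  obtain ⟨v, hv, hv'⟩ := hB (b + y) (Submodule.add_mem _ hb (sub_mono Set.inter_subset_right _ hy))
    (show bd n _ = 0 by rw [map_add, hy', h1, neg_add_cancel])
  refine ⟨u + v + d, Submodule.add_mem _ (Submodule.add_mem _
    (sub_mono Set.subset_union_left _ hu) (sub_mono Set.subset_union_right _ hv)) hd, ?_⟩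
  rw [map_add, map_add, hu', hv', e]
  abel

/-! ### Deformation retracts and collars -/

/-- The retraction fixes chains in `A`, so the difference of `u` and its image is a true cycle to
which homotopy invariance applies. That the homotopy also fix `A` is not needed. -/
lemma exists_of_deformation_type {A : Set X} {r : C(X, X)} (H : (ContinuousMap.id X).Homotopic r)
    (hr : ∀ x, r x ∈ A) (hA : ∀ x ∈ A, r x = x) {n : ℕ} {u : Ch k X n} (hu : RelCyc A u) :
    ∃ a ∈ sub k A n, ∃ d, u = a + bd n d := by
  have hfix : ∀ m (c : Ch k X m), c ∈ sub k A m → push r m c = c := by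
    intro m c hc
    rw [sub, Finsupp.supported_eq_span_single] at hc
    induction hc using Submodule.span_induction with
    | zero => simp
    | add x y _ _ hx hy => rw [map_add, hx, hy]
    | smul a x _ hx => rw [map_smul, hx]
    | mem x hx =>
      obtain ⟨σ, hσ, rfl⟩ := hx
      simp only [push_single]
      congr 1
      ext x
      exact hA _ (hσ x)
  have hmem : push r n u ∈ sub k A n := push_mem_sub (fun x _ => hr x) (mem_sub_univ u)
  have hcyc : IsCyc (u - push r n u) := by
    cases n with
    | zero => trivial
    | succ n =>
      change bd n _ = 0
      rw [map_sub, ← push_bd, hfix _ _ hu, sub_self]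
  obtain ⟨d, hd⟩ := homotopy_push H n hcyc
  refine ⟨push r n u, hmem, d, ?_⟩
  rw [hd, push_id, map_sub, hfix _ _ hmem]
  abel

/-- Relative cycles can be pushed into a strong deformation retract. -/
lemma exists_of_deformation {A U : Set X} {r : C(U, U)}
    (H : (ContinuousMap.id U).Homotopic r) (hr : ∀ x, (r x : X) ∈ A)
    (hA : ∀ x : U, (x : X) ∈ A → r x = x) {n : ℕ} {u : Ch k X n} (hU : u ∈ sub k U n)
    (hu : RelCyc A u) :
    ∃ a ∈ sub k A n, ∃ d ∈ sub k U (n + 1), u = a + bd n d := by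
  obtain ⟨u, rfl⟩ := exists_push_incl hU
  have hu' : RelCyc (incl U ⁻¹' A) u := by
    cases n with
    | zero => trivial
    | succ n =>
      refine mem_sub_of_push (incl_embedding U).injective ?_
      rw [push_bd]
      exact hu
  obtain ⟨a, ha, d, e⟩ := exists_of_deformation_type H (A := incl U ⁻¹' A) hr hA hu'
  refine ⟨push (incl U) n a, push_mem_sub (Set.mapsTo_preimage _ _) ha, push (incl U) _ d,
    push_incl_mem d, ?_⟩
  rw [← push_bd, ← map_add, ← e]

/-- A sum of chains in `A` and in `B` is supported on simplices lying in one of them, and for such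
simplices the extra containment in `U` can be used. -/
lemma mem_sup_of_mem_sup {A B U W : Set X} (h : U ∩ B ⊆ W) {n : ℕ} {c : Ch k X n}
    (hc : c ∈ sub k A n ⊔ sub k B n) (hU : c ∈ sub k U n) : c ∈ sub k A n ⊔ sub k W n := by
  rw [sub, sub, ← Finsupp.supported_union, Finsupp.mem_supported] at *
  intro σ hσ
  rcases hc hσ with h1 | h1
  · exact Or.inl h1
  · exact Or.inr fun x => h ⟨hU hσ x, h1 x⟩

/-- Closed sets `A`, `B` such that `A ∩ B` is a strong deformation retract of a neighbourhood in
`B` form an excisive couple. -/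
theorem excisive_of_collar {A B O W : Set X} (hW : W = O ∩ B) (hA : IsClosed A) (hB : IsClosed B) (hO : IsOpen O)
    (hABO : A ∩ B ⊆ O) (H : C(unitInterval × W, W))
    (H0 : ∀ x, H (0, x) = x) (H1 : ∀ x, (H (1, x) : X) ∈ A)
    (HA : ∀ t, ∀ x : W, (x : X) ∈ A → H (t, x) = x) : Excisive k A B := by
  intro n c hc hbc
  classical
  have hWB : W ⊆ B := hW ▸ Set.inter_subset_right
  -- Thickening `A` by the collar makes it open in the union, and `B \ A` is open there as well, so
  -- subdivision applies to this couple.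
  set U := A ∪ W with hU
  have hUV : U ∪ (B \ A) = A ∪ B := by
    ext x
    simp only [hU, hW, Set.mem_union, Set.mem_inter_iff, Set.mem_sdiff]
    tauto
  have hUo : RelOpen U (U ∪ (B \ A)) := by
    refine ⟨(B \ O)ᶜ, (hB.sdiff hO).isOpen_compl, ?_⟩
    ext x
    have := @hABO x
    simp only [hU, hW, Set.mem_union, Set.mem_inter_iff, Set.mem_sdiff, Set.mem_compl_iff] at *
    tauto
  have hVo : RelOpen (B \ A) (U ∪ (B \ A)) := by
    refine ⟨Aᶜ, hA.isOpen_compl, ?_⟩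
    ext x
    simp only [hU, hW, Set.mem_union, Set.mem_inter_iff, Set.mem_sdiff, Set.mem_compl_iff] at *
    tauto
  rw [← hUV] at hc
  rw [← hUV]
  obtain ⟨d, hd, e, he, h⟩ := exists_small hUo hVo hc hbc
  obtain ⟨u, hu, v, hv, huv⟩ := Submodule.mem_sup.1 h
  have hvB : v ∈ sub k B (n + 1) := sub_mono Set.sdiff_subset _ hv
  have hsup : ∀ {m : ℕ} {x : Ch k X (m + 1)}, x ∈ sub k A (m + 1) ⊔ sub k B (m + 1) →
      bd m x ∈ sub k A m ⊔ sub k B m := by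
    intro m x hx
    obtain ⟨a, ha, b, hb, rfl⟩ := Submodule.mem_sup.1 hx
    rw [map_add]
    exact Submodule.add_mem_sup (bd_mem_sub ha) (bd_mem_sub hb)
  have hbu : bd n u ∈ sub k A n ⊔ sub k B n := by
    have : u = c - bd (n + 1) d - e - v := by rw [← huv]; abel
    rw [this, map_sub, map_sub, map_sub, bd_bd, sub_zero]
    exact Submodule.sub_mem _ (Submodule.sub_mem _ hbc (hsup he))
      (Submodule.mem_sup_right (bd_mem_sub hvB))
  have hbu' : bd n u ∈ sub k A n ⊔ sub k W n := by
    refine mem_sup_of_mem_sup ?_ hbu (bd_mem_sub hu)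
    rintro x ⟨hx | hx, hxB⟩
    · exact hW ▸ ⟨hABO ⟨hx, hxB⟩, hxB⟩
    · exact hx
  obtain ⟨a, ha, w, hw, haw⟩ := Submodule.mem_sup.1 hbu'
  let rW : C(W, W) := H.comp ((ContinuousMap.const _ 1).prodMk (.id _))
  have hrW : (ContinuousMap.id W).Homotopic rW := ⟨⟨H, H0, fun x => rfl⟩⟩
  have hwc : RelCyc (A ∩ B) w := by
    cases n with
    | zero => trivial
    | succ n =>
      refine mem_sub_inter ?_ (bd_mem_sub (sub_mono hWB _ hw))
      have : bd n w = -bd n a := by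
        have h0 := bd_bd n u
        rw [← haw, map_add, add_comm] at h0
        exact eq_neg_of_add_eq_zero_left h0
      rw [this]
      exact Submodule.neg_mem _ (bd_mem_sub ha)
  -- The part of the boundary of `u` in the collar is a cycle relative to `A ∩ B`; retracting the
  -- collar makes it homologous to a chain in `A ∩ B`, at the cost of `w2`, which lies in `B`.
  obtain ⟨a2, ha2, w2, hw2, ew⟩ := exists_of_deformation (A := A ∩ B) (U := W)
    hrW (fun x => ⟨H1 x, hWB (H (1, x)).2⟩)
    (fun x hx => HA 1 x hx.1) hw hwc
  have hWU : W ⊆ U := Set.subset_union_right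
  -- The collar homotopy, extended by the identity on `A`. It is continuous because `A` and `B` are
  -- closed and both definitions agree on `A ∩ B`.
  let F : unitInterval × U → U := fun q =>
    if h : (q.2 : X) ∈ W then ⟨H (q.1, ⟨q.2, h⟩), hWU (H (q.1, ⟨q.2, h⟩)).2⟩ else q.2
  have hFA : ∀ t (x : U), (x : X) ∈ A → F (t, x) = x := by
    intro t x hx
    by_cases h : (x : X) ∈ W
    · simp only [F, h, dif_pos]
      apply Subtype.ext
      simp only
      rw [HA t ⟨x, h⟩ hx]
    · simp only [F, h, dif_neg, not_false_eq_true]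
  have hFc : Continuous F := by
    have h1 : IsClosed {q : unitInterval × U | (q.2 : X) ∈ A} :=
      hA.preimage (continuous_subtype_val.comp continuous_snd)
    have h2 : IsClosed {q : unitInterval × U | (q.2 : X) ∈ B} :=
      hB.preimage (continuous_subtype_val.comp continuous_snd)
    rw [← continuousOn_univ]
    have hun : (Set.univ : Set (unitInterval × U)) =
        {q | (q.2 : X) ∈ A} ∪ {q | (q.2 : X) ∈ B} := by
      ext q
      have := q.2.2
      simp only [hU, hW, Set.mem_union, Set.mem_inter_iff] at this
      simp only [Set.mem_univ, Set.mem_union, Set.mem_ofPred_eq, true_iff]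
      tauto
    rw [hun]
    refine ContinuousOn.union_of_isClosed ?_ ?_ h1 h2
    · exact continuous_snd.continuousOn.congr fun q hq => hFA q.1 q.2 hq
    · rw [continuousOn_iff_continuous_domRestrict]
      have hBW : ∀ q : {q : unitInterval × U | (q.2 : X) ∈ B}, ((q : unitInterval × U).2 : X) ∈ W := by
        rintro ⟨q, hq⟩
        rcases q.2.2 with h | h
        · exact hW ▸ ⟨hABO ⟨h, hq⟩, hq⟩
        · exact h
      have : Set.domRestrict {q : unitInterval × U | (q.2 : X) ∈ B} F = fun q =>
          ⟨H ((q : unitInterval × U).1, ⟨(q : unitInterval × U).2, hBW q⟩),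
            hWU (H ((q : unitInterval × U).1, ⟨(q : unitInterval × U).2, hBW q⟩)).2⟩ := by
        ext q
        exact congrArg Subtype.val (dif_pos (hBW q))
      rw [this]
      fun_prop
  let rU : C(U, U) := ⟨fun x => F (1, x), by fun_prop⟩
  have hrU : (ContinuousMap.id U).Homotopic rU := by
    refine ⟨⟨⟨F, hFc⟩, fun x => ?_, fun x => rfl⟩⟩
    change F (0, x) = x
    by_cases h : (x : X) ∈ W
    · simp only [F, h, dif_pos, H0]
    · simp only [F, h, dif_neg, not_false_eq_true]
  have huc : bd n (u - w2) = a + a2 := by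
    rw [map_sub, ← haw, ew]
    abel
  -- Now `u - w2` has boundary in `A`, so it can be pushed from the thickening into `A`.
  obtain ⟨a3, ha3, d3, hd3, e3⟩ := exists_of_deformation (A := A) (U := U) (u := u - w2)
    hrU (fun x => by
      change (F (1, x) : X) ∈ A
      by_cases h : (x : X) ∈ W
      · simp only [F, h, dif_pos]
        exact H1 _
      · simp only [F, h, dif_neg, not_false_eq_true]
        exact x.2.resolve_right h) (fun x hx => hFA 1 x hx)
    (Submodule.sub_mem _ hu (sub_mono hWU _ hw2)) (by
      change bd n _ ∈ _
      rw [huc]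
      exact Submodule.add_mem _ ha (sub_mono Set.inter_subset_left _ ha2))
  refine ⟨d + d3, Submodule.add_mem _ hd (sub_mono Set.subset_union_left _ hd3), ?_⟩
  have : c - bd (n + 1) (d + d3) = e + v + w2 + a3 := by
    have h5 : c = u + v + e + bd (n + 1) d := by rw [huv]; abel
    have h6 : u = a3 + bd (n + 1) d3 + w2 := by rw [← e3]; abel
    rw [h5, h6, map_add]
    abel
  rw [this]
  exact Submodule.add_mem _ (Submodule.add_mem _ (Submodule.add_mem _ he
    (Submodule.mem_sup_right hvB)) (Submodule.mem_sup_right (sub_mono hWB _ hw2)))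
    (Submodule.mem_sup_left ha3)

end SingChain

end

/-! ### Homotopies inside a subset -/

noncomputable section

namespace SingChain

variable {k : Type} [CommRing k] {X Y Z : Type} [TopologicalSpace X] [TopologicalSpace Y]
  [TopologicalSpace Z]

lemma homotopy_push_on {f g : C(X, Y)} (H : f.Homotopy g) {A : Set X} {B : Set Y}
    (hH : ∀ t, ∀ x ∈ A, H (t, x) ∈ B) {n : ℕ} {z : Ch k X n} (hz : z ∈ sub k A n) (hc : IsCyc z) :
    ∃ c ∈ sub k B (n + 1), bd n c = push f n z - push g n z := by
  obtain ⟨z, rfl⟩ := exists_push_incl hz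
  have hf : ∀ x ∈ A, f x ∈ B := fun x hx => by simpa using hH 0 x hx
  have hg : ∀ x ∈ A, g x ∈ B := fun x hx => by simpa using hH 1 x hx
  let f' : C(A, B) := ⟨fun x => ⟨f x, hf x x.2⟩, by fun_prop⟩
  let g' : C(A, B) := ⟨fun x => ⟨g x, hg x x.2⟩, by fun_prop⟩
  have H' : f'.Homotopic g' := by
    refine ⟨⟨⟨fun q => ⟨H (q.1, q.2), hH _ _ q.2.2⟩, by fun_prop⟩, fun x => ?_, fun x => ?_⟩⟩
    · apply Subtype.ext; simp [f']
    · apply Subtype.ext; simp [g']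
  obtain ⟨c, hc'⟩ := homotopy_push H' n (hc.of_push (incl_embedding A).injective)
  refine ⟨push (incl B) _ c, push_incl_mem c, ?_⟩
  rw [← push_bd, hc', map_sub, push_push, push_push, push_push, push_push]
  rfl

/-- `f` maps every `n`-cycle in `A` to a boundary in `B`. -/
def KillsOn (k : Type) [CommRing k] (f : C(X, Y)) (A : Set X) (B : Set Y) (n : ℕ) : Prop :=
  ∀ z ∈ sub k A n, IsCyc z → ∃ c ∈ sub k B (n + 1), bd n c = push f n z

end SingChain

/-! ### The power map of the punctured plane -/

namespace PowerMap

open SingChain Complex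

/-- The map `w ↦ wᵖ / |w|ᵖ⁻¹`, which preserves the absolute value. -/
def powFun (p : ℕ) (w : ℂ) : ℂ := w ^ p / (‖w‖ : ℂ) ^ (p - 1)

lemma norm_powFun {p : ℕ} (hp : p ≠ 0) (w : ℂ) : ‖powFun p w‖ = ‖w‖ := by
  rcases eq_or_ne w 0 with rfl | hw
  · simp [powFun, hp]
  · have : ‖w‖ ≠ 0 := norm_ne_zero_iff.2 hw
    rw [powFun, norm_div, norm_pow, norm_pow, norm_real, norm_norm]
    obtain ⟨q, rfl⟩ := Nat.exists_eq_succ_of_ne_zero hp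
    rw [Nat.succ_sub_one, pow_succ]
    field_simp

lemma powFun_eq_zero {p : ℕ} (hp : p ≠ 0) {w : ℂ} : powFun p w = 0 ↔ w = 0 := by
  rw [← norm_eq_zero, norm_powFun hp, norm_eq_zero]

lemma continuous_powFun {p : ℕ} (hp : p ≠ 0) : Continuous (powFun p) := by
  rw [continuous_iff_continuousAt]
  intro w
  rcases eq_or_ne w 0 with rfl | hw
  · have h0 : powFun p 0 = 0 := (powFun_eq_zero hp).2 rfl
    rw [ContinuousAt, h0, tendsto_zero_iff_norm_tendsto_zero]
    simp only [norm_powFun hp]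
    simpa using (continuous_norm (E := ℂ)).tendsto 0
  · unfold powFun
    refine ContinuousAt.div (by fun_prop) (by fun_prop) ?_
    simp [hw]

lemma powFun_smul {p : ℕ} (hp : p ≠ 0) {s : ℝ} (hs : 0 ≤ s) (w : ℂ) :
    powFun p (s * w) = s * powFun p w := by
  rcases eq_or_lt_of_le hs with rfl | hs
  · simp [powFun, hp]
  · have : (s : ℂ) ≠ 0 := by exact_mod_cast hs.ne'
    obtain ⟨q, rfl⟩ := Nat.exists_eq_succ_of_ne_zero hp
    simp only [powFun, norm_mul, norm_real, Real.norm_eq_abs, abs_of_pos hs, Nat.succ_sub_one,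
      mul_pow, ofReal_mul, pow_succ]
    rcases eq_or_ne w 0 with rfl | hw
    · simp
    · have : (‖w‖ : ℂ) ≠ 0 := by simpa using hw
      field_simp

/-- The fibers of the power map are the orbits of the group of `p`-th roots of unity. -/
lemma powFun_eq_iff {p : ℕ} (hp : p ≠ 0) {w v : ℂ} :
    powFun p w = powFun p v ↔ ∃ ζ : ℂ, ζ ^ p = 1 ∧ v = ζ * w := by
  constructor
  · intro h
    have hn : ‖w‖ = ‖v‖ := by rw [← norm_powFun hp, h, norm_powFun hp]
    rcases eq_or_ne w 0 with rfl | hw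
    · refine ⟨1, by simp, ?_⟩
      rw [norm_zero] at hn
      simpa using hn.symm
    · refine ⟨v / w, ?_, by field_simp⟩
      have : (‖v‖ : ℂ) ≠ 0 := by rw [← hn]; simpa using hw
      rw [powFun, powFun, hn, div_left_inj' (pow_ne_zero _ this)] at h
      rw [div_pow, h, div_self]
      rw [← h]
      exact pow_ne_zero _ hw
  · rintro ⟨ζ, hζ, rfl⟩
    have : ‖ζ‖ = 1 := norm_eq_one_of_pow_eq_one hζ hp
    simp [powFun, mul_pow, hζ, this]

variable (p : ℕ) [hp : Fact p.Prime]

/-- The power map as a continuous map. -/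
def powMap : C(ℂ, ℂ) := ⟨powFun p, continuous_powFun hp.out.ne_zero⟩

lemma union_slitPlane : slitPlane ∪ -slitPlane = {0}ᶜ := by
  ext w
  simp only [Set.mem_union, Set.mem_neg, mem_slitPlane_iff, neg_re, neg_im, Set.mem_compl_iff,
    Set.mem_singleton_iff]
  constructor
  · rintro h rfl
    simp at h
  · intro h
    by_contra! h'
    refine h (Complex.ext ?_ ?_)
    · simp; linarith [h'.1.1, h'.2.1]
    · simpa using h'.1.2

lemma inter_slitPlane : slitPlane ∩ -slitPlane = {w : ℂ | 0 < w.im} ∪ {w : ℂ | w.im < 0} := by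
  ext w
  simp only [Set.mem_inter_iff, Set.mem_neg, mem_slitPlane_iff, neg_re, neg_im, Set.mem_union,
    Set.mem_ofPred_eq]
  constructor
  · rintro ⟨h1, h2⟩
    rcases lt_trichotomy w.im 0 with h | h | h
    · exact Or.inr h
    · simp [h] at h1 h2
      linarith
    · exact Or.inl h
  · rintro (h | h)
    · exact ⟨Or.inr h.ne', Or.inr (by simpa using h.ne')⟩
    · exact ⟨Or.inr h.ne, Or.inr (by simpa using h.ne)⟩

lemma isOpen_neg_slitPlane : IsOpen (-slitPlane) := isOpen_slitPlane.neg

variable {k : Type} [CommRing k]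

lemma acycOn_slitPlane (n : ℕ) : AcycOn k slitPlane (n + 1) :=
  acycOn_of_starConvex starConvex_one_slitPlane ⟨1, by simp⟩ n

lemma acycOn_neg_slitPlane (n : ℕ) : AcycOn k (-slitPlane) (n + 1) :=
  acycOn_of_starConvex (a := -1) starConvex_one_slitPlane.neg ⟨-1, by simp⟩ n

lemma acycOn_inter_slitPlane (n : ℕ) : AcycOn k (slitPlane ∩ -slitPlane) (n + 1) := by
  rw [inter_slitPlane]
  refine (excisive_of_isOpen (isOpen_lt continuous_const continuous_im)
    (isOpen_lt continuous_im continuous_const)).acycOn_union ?_ ?_ ?_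
  · exact acycOn_of_starConvex ((convex_halfSpace_im_gt 0).starConvex (x := I) (by simp))
      ⟨I, by simp⟩ n
  · exact acycOn_of_starConvex ((convex_halfSpace_im_lt 0).starConvex (x := -I) (by simp))
      ⟨-I, by simp⟩ n
  · have : {w : ℂ | 0 < w.im} ∩ {w : ℂ | w.im < 0} = ∅ := by
      ext w
      simp only [Set.mem_inter_iff, Set.mem_ofPred_eq, Set.mem_empty_iff_false, iff_false]
      intro h
      linarith [h.1, h.2]
    rw [this]
    exact acycOn_empty n

lemma excisive_slitPlane : Excisive k slitPlane (-slitPlane) :=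
  excisive_of_isOpen isOpen_slitPlane isOpen_neg_slitPlane

/-- Two star-shaped slit planes cover the punctured plane and meet in two convex half-planes. The
half-planes contribute only in degree 0, hence the range of degrees. -/
lemma acycOn_punctured (n : ℕ) : AcycOn k ({0}ᶜ : Set ℂ) (n + 2) := by
  rw [← union_slitPlane]
  exact excisive_slitPlane.acycOn_union (acycOn_slitPlane _) (acycOn_neg_slitPlane _)
    (acycOn_inter_slitPlane n)

/-- The sum of the coefficients of the points of a `0`-chain that lie in `S`. -/
def augOn {X : Type} [TopologicalSpace X] (S : Set X) : Ch k X 0 →ₗ[k] k := by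
  classical
  exact Finsupp.linearCombination k fun σ => if σ default ∈ S then 1 else 0

open Classical in
lemma augOn_single {X : Type} [TopologicalSpace X] (S : Set X) (σ : C(Simp 0, X)) :
    augOn S (Finsupp.single σ (1 : k)) = if σ default ∈ S then 1 else 0 := by
  simp [augOn]

lemma bd_single_one {X : Type} [TopologicalSpace X] (σ : C(Simp 1, X)) :
    bd 0 (Finsupp.single σ (1 : k)) =
      Finsupp.single (σ.comp (Simp.face 0 0)) 1 - Finsupp.single (σ.comp (Simp.face 0 1)) 1 := by
  rw [SingChain.bd_single, Fin.sum_univ_two]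
  simp [sub_eq_add_neg]

lemma linearMap_eq_zero_of_sub {X M : Type} [TopologicalSpace X] [AddCommGroup M] [Module k M]
    {A : Set X} {n : ℕ} {f : Ch k X n →ₗ[k] M} (h : ∀ σ : C(Simp n, X), (∀ x, σ x ∈ A) →
      f (Finsupp.single σ 1) = 0) {c : Ch k X n} (hc : c ∈ sub k A n) : f c = 0 := by
  rw [sub, Finsupp.supported_eq_span_single] at hc
  induction hc using Submodule.span_induction with
  | zero => simp
  | add x y _ _ hx hy => rw [map_add, hx, hy, add_zero]
  | smul a x _ hx => rw [map_smul, hx, smul_zero]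
  | mem x hx => obtain ⟨σ, hσ, rfl⟩ := hx; exact h σ hσ

/-- The augmentation of a clopen part vanishes on boundaries. -/
lemma augOn_bd {X : Type} [TopologicalSpace X] {S A : Set X}
    (hS : ∀ σ : C(Simp 1, X), (∀ x, σ x ∈ A) → IsClopen (σ ⁻¹' S)) {c : Ch k X 1}
    (hc : c ∈ sub k A 1) : augOn S (bd 0 c) = 0 := by
  classical
  refine linearMap_eq_zero_of_sub (f := augOn S ∘ₗ bd 0) (fun σ hσ => ?_) hc
  rw [LinearMap.comp_apply, bd_single_one, map_sub, augOn_single, augOn_single]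
  have : σ (Simp.face 0 0 default) ∈ S ↔ σ (Simp.face 0 1 default) ∈ S := by
    rcases isClopen_iff.1 (hS σ hσ) with h | h
    · have h' : ∀ x, σ x ∉ S := fun x hx => by
        have : x ∈ σ ⁻¹' S := hx
        rw [h] at this
        exact this
      simp [h']
    · have h' : ∀ x, σ x ∈ S := fun x => by
        have : x ∈ σ ⁻¹' S := by rw [h]; trivial
        exact this
      simp [h']
  simp only [ContinuousMap.comp_apply, this, sub_self]

/-- The segment from `b` to `a` as a singular simplex. -/
def seg (a b : ℂ) : C(Simp 1, ℂ) where
  toFun x := (x 1 : ℝ) • a + (x 0 : ℝ) • b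
  continuous_toFun := by
    have h : ∀ i : Fin 2, Continuous fun x : Simp 1 => x i := fun i =>
      (continuous_apply i).comp continuous_subtype_val
    exact ((h 1).smul continuous_const).add ((h 0).smul continuous_const)

lemma seg_face_zero (a b : ℂ) : (seg a b).comp (Simp.face 0 0) = ContinuousMap.const _ a := by
  ext x
  obtain rfl : x = Simp.vert 0 0 := Subsingleton.elim _ _
  rw [Simp.face_eq]
  simp [seg, Simp.aff_apply_vert, Simp.vert_apply]

lemma seg_face_one (a b : ℂ) : (seg a b).comp (Simp.face 0 1) = ContinuousMap.const _ b := by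
  ext x
  obtain rfl : x = Simp.vert 0 0 := Subsingleton.elim _ _
  rw [Simp.face_eq]
  simp [seg, Simp.aff_apply_vert, Simp.vert_apply]

lemma seg_mem {C : Set ℂ} (hC : Convex ℝ C) {a b : ℂ} (ha : a ∈ C) (hb : b ∈ C) (x : Simp 1) :
    seg a b x ∈ C :=
  hC ha hb (x.2.1 1) (x.2.1 0) (by have := x.2.2; rw [Fin.sum_univ_two] at this; rw [add_comm]; exact this)

/-- Each point is joined by a segment to `I` or `-I` inside its half-plane; what remains is the two
augmentations times these base points. -/
lemma exists_bd_of_augOn {y : Ch k ℂ 0} (hy : y ∈ sub k (slitPlane ∩ -slitPlane) 0)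
    (h1 : augOn {w : ℂ | 0 < w.im} y = 0) (h2 : augOn {w : ℂ | w.im < 0} y = 0) :
    ∃ c ∈ sub k (slitPlane ∩ -slitPlane) 1, bd 0 c = y := by
  classical
  let r : ℂ → ℂ := fun w => if 0 < w.im then I else -I
  let h : Ch k ℂ 0 →ₗ[k] Ch k ℂ 1 :=
    Finsupp.linearCombination k fun σ => Finsupp.single (seg (σ default) (r (σ default))) 1
  have hh : ∀ σ, h (Finsupp.single σ 1) = Finsupp.single (seg (σ default) (r (σ default))) 1 :=
    fun σ => by simp [h]
  refine ⟨h y, map_mem_sub (fun σ hσ => ?_) hy, ?_⟩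
  · rw [hh]
    refine single_mem_sub (fun x => ?_) _
    have hd := hσ default
    rw [inter_slitPlane] at hd ⊢
    by_cases hpos : 0 < (σ default).im
    · refine Or.inl (seg_mem (convex_halfSpace_im_gt 0) hpos ?_ x)
      simp [r, hpos]
    · refine Or.inr (seg_mem (convex_halfSpace_im_lt 0) (hd.resolve_left hpos) ?_ x)
      simp [r, hpos]
  · have key : ∀ c ∈ sub k (slitPlane ∩ -slitPlane) 0, bd 0 (h c) = c -
        (augOn {w : ℂ | 0 < w.im} c • Finsupp.single (ContinuousMap.const _ I) (1 : k) +
          augOn {w : ℂ | w.im < 0} c • Finsupp.single (ContinuousMap.const _ (-I)) (1 : k)) := by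
      intro c hc
      rw [← sub_eq_zero]
      refine linearMap_eq_zero_of_sub (f := bd 0 ∘ₗ h - (LinearMap.id -
        ((augOn {w : ℂ | 0 < w.im}).smulRight (Finsupp.single (ContinuousMap.const _ I) (1 : k)) +
          (augOn {w : ℂ | w.im < 0}).smulRight
            (Finsupp.single (ContinuousMap.const _ (-I)) (1 : k))))) (fun σ hσ => ?_) hc
      have hd := hσ default
      rw [inter_slitPlane] at hd
      simp only [LinearMap.sub_apply, LinearMap.comp_apply, LinearMap.id_apply,
        LinearMap.add_apply, LinearMap.smulRight_apply, augOn_single]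
      rw [hh, bd_single_one, seg_face_zero, seg_face_one]
      have hσ' : ContinuousMap.const (Simp 0) (σ default) = σ := by
        ext x
        simp [Subsingleton.elim x default]
      rw [hσ']
      by_cases hpos : 0 < (σ default).im
      · simp [r, hpos, hpos.not_gt]
      · simp [r, hpos, show (σ default).im < 0 from hd.resolve_left hpos]
    rw [key y hy, h1, h2]
    simp

end PowerMap

end

/-! ### The power map is zero mod `p` on the top homology of its sphere -/

noncomputable section

namespace PowerMap

open SingChain Complex

variable (p : ℕ) [hp : Fact p.Prime]

/-- A primitive `p`-th root of unity. -/
def root : ℂ := exp (2 * Real.pi * I / p)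

lemma isPrimitiveRoot_root : IsPrimitiveRoot (root p) p := isPrimitiveRoot_exp p hp.out.ne_zero

/-- Rotation by a primitive `p`-th root of unity. -/
def rotMap : C(ℂ, ℂ) := ⟨fun w => root p * w, by fun_prop⟩

/-- The rotation is isotopic to the identity. -/
def rotHomotopy : (rotMap p).Homotopy (.id ℂ) where
  toFun q := exp (2 * Real.pi * I / p * ((1 - (q.1 : ℝ) : ℝ) : ℂ)) * q.2
  continuous_toFun := by fun_prop
  map_zero_left w := by simp [rotMap, root]
  map_one_left w := by simp

lemma powFun_root_mul (w : ℂ) : powFun p (root p * w) = powFun p w :=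
  ((powFun_eq_iff hp.out.ne_zero).2 ⟨root p, (isPrimitiveRoot_root p).pow_eq_one, rfl⟩).symm

/-- The quotient of a point by the principal root of its `p`-th power. -/
def branch (w : ℂ) : ℂ := w / (w ^ p) ^ ((p : ℂ)⁻¹)

lemma branch_pow {w : ℂ} (hw : w ≠ 0) : branch p w ^ p = 1 := by
  rw [branch, div_pow, cpow_nat_inv_pow _ hp.out.ne_zero, div_self (pow_ne_zero _ hw)]

lemma branch_root_mul (w : ℂ) : branch p (root p * w) = root p * branch p w := by
  rw [branch, branch, mul_pow, (isPrimitiveRoot_root p).pow_eq_one, one_mul, mul_div_assoc]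

lemma powFun_mem_slitPlane {w : ℂ} : powFun p w ∈ slitPlane ↔ w ^ p ∈ slitPlane := by
  rcases eq_or_ne w 0 with rfl | hw
  · simp [powFun, hp.out.ne_zero]
  · have h : 0 < ‖w‖ ^ (p - 1) := pow_pos (norm_pos_iff.2 hw) _
    rw [powFun, div_eq_mul_inv, mul_comm, ← ofReal_pow, ← ofReal_inv]
    simp only [mem_slitPlane_iff, re_ofReal_mul, im_ofReal_mul]
    have h' := inv_pos.2 h
    rw [mul_pos_iff_of_pos_left h', mul_ne_zero_iff]
    simp [h'.ne']

lemma continuousOn_branch : ContinuousOn (branch p) (powFun p ⁻¹' slitPlane) := by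
  intro w hw
  have hw' : w ^ p ∈ slitPlane := (powFun_mem_slitPlane p).1 hw
  refine ContinuousAt.continuousWithinAt ?_
  refine continuousAt_id.div ((continuousAt_id.pow p).cpow continuousAt_const hw') ?_
  rw [cpow_ne_zero_iff_of_exponent_ne_zero (by simp [hp.out.ne_zero])]
  exact slitPlane_ne_zero hw'

/-- The set where the power map takes values off the real line. -/
def offReal : Set ℂ := powFun p ⁻¹' slitPlane ∩ powFun p ⁻¹' (-slitPlane)

lemma ne_zero_of_mem {w : ℂ} (hw : w ∈ offReal p) : w ≠ 0 := by
  rintro rfl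
  have : powFun p 0 ∈ slitPlane := hw.1
  rw [(powFun_eq_zero hp.out.ne_zero).2 rfl] at this
  exact slitPlane_ne_zero this rfl

/-- The branch of a nonzero point is exactly one of the `p`-th roots of unity, so the indicators of
the `p` sectors add up to 1. -/
lemma sum_branch [DecidableEq ℂ] {k : Type} [CommRing k] {w : ℂ} (hw : w ≠ 0) :
    ∑ j ∈ Finset.range p, (if branch p w = root p ^ j then (1 : k) else 0) = 1 := by
  obtain ⟨i, hi, hi'⟩ := (isPrimitiveRoot_root p).eq_pow_of_pow_eq_one (branch_pow p hw)
  rw [Finset.sum_eq_single i]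
  · simp [hi']
  · intro j hj hji
    rw [if_neg]
    rw [← hi']
    intro h
    exact hji ((isPrimitiveRoot_root p).pow_inj (Finset.mem_range.1 hj) hi h.symm)
  · intro h
    exact absurd (Finset.mem_range.2 hi) h

/-- The power map is zero on the first homology mod `p` of the punctured plane. -/
theorem kills_punctured : KillsOn (ZMod p) (powMap p) ({0}ᶜ : Set ℂ) {0}ᶜ 1 := by
  classical
  intro z hz hzc
  have hp0 : p ≠ 0 := hp.out.ne_zero
  set k := ZMod p
  set U : Set ℂ := powFun p ⁻¹' slitPlane with hU
  set V : Set ℂ := powFun p ⁻¹' (-slitPlane) with hV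
  have hUo : IsOpen U := isOpen_slitPlane.preimage (continuous_powFun hp0)
  have hVo : IsOpen V := isOpen_neg_slitPlane.preimage (continuous_powFun hp0)
  have hUV : U ∪ V = {0}ᶜ := by
    rw [hU, hV, ← Set.preimage_union, union_slitPlane]
    ext w
    simp [powFun_eq_zero hp0]
  have hex : Excisive k U V := excisive_of_isOpen hUo hVo
  obtain ⟨a, ha, b, hb, d, hd, e, h1, h2⟩ := hex.split_cycle (hUV ▸ hz) hzc
  -- The rotated cycle is homologous to the original one, rotation being isotopic to the identity.
  obtain ⟨e', he', hee⟩ := homotopy_push_on (k := k) (rotHomotopy p) (A := {0}ᶜ) (B := {0}ᶜ)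
    (fun t x hx => mul_ne_zero (exp_ne_zero _) hx) hz hzc
  rw [push_id] at hee
  have hrot : ∀ {S : Set ℂ}, Set.MapsTo (rotMap p) (powFun p ⁻¹' S) (powFun p ⁻¹' S) := by
    intro S w hw
    change powFun p (root p * w) ∈ S
    rw [powFun_root_mul]
    exact hw
  have hTa : push (rotMap p) 1 a ∈ sub k U 1 := push_mem_sub hrot ha
  have hTb : push (rotMap p) 1 b ∈ sub k V 1 := push_mem_sub hrot hb
  have hTd : push (rotMap p) 2 d ∈ sub k (U ∪ V) 2 :=
    push_mem_sub (Set.MapsTo.union_union hrot hrot) hd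
  -- Comparing the splittings of the cycle and of its rotation shows that the intersection cycle of
  -- `a` changes under rotation only by the boundary of a chain in the overlap, that is, inside the
  -- sectors.
  obtain ⟨y', hy', u, hu, -, -, hyu, -⟩ := hex.exists_inter
    (a := push (rotMap p) 1 a - a) (b := b - push (rotMap p) 1 b)
    (c := e' - push (rotMap p) 2 d + d) (Submodule.sub_mem _ hTa ha) (Submodule.sub_mem _ hb hTb)
    (Submodule.add_mem _ (Submodule.sub_mem _ (hUV ▸ he') hTd) hd) (by
      rw [map_add, map_sub, hee, ← push_bd, e, map_add, map_add]
      abel)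
  have hy : push (rotMap p) 0 (bd 0 a) - bd 0 a = bd 0 y' := by
    rw [push_bd, ← map_sub, hyu, map_add, bd_bd, add_zero]
  -- A sector is given by the half-plane containing the power and by the branch. On the overlap the
  -- power avoids the real line and the branch is continuous with finitely many values, so a path
  -- cannot leave its sector.
  have hclopen : ∀ (P : Set ℂ), IsOpen P → IsClosed (P ∪ {w | w.im = 0}) → ∀ ζ : ℂ,
      ∀ σ : C(Simp 1, ℂ), (∀ x, σ x ∈ offReal p) →
      IsClopen (σ ⁻¹' {w | powFun p w ∈ P ∧ branch p w = ζ}) := by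
    intro P hPo hPc ζ σ hσ
    have hc1 : Continuous fun x => powFun p (σ x) := (continuous_powFun hp0).comp σ.continuous
    have hc2 : Continuous fun x => branch p (σ x) := by
      rw [← continuousOn_univ]
      exact (continuousOn_branch p).comp σ.continuous.continuousOn fun x _ => (hσ x).1
    have e1 : IsClopen ((fun x => powFun p (σ x)) ⁻¹' P) := by
      refine ⟨?_, hPo.preimage hc1⟩
      convert hPc.preimage hc1 using 1
      ext x
      have : powFun p (σ x) ∈ slitPlane ∩ -slitPlane := hσ x
      rw [inter_slitPlane] at this
      simp only [Set.mem_preimage, Set.mem_union, Set.mem_ofPred_eq] at this ⊢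
      refine ⟨Or.inl, fun h => h.resolve_right fun h0 => ?_⟩
      rw [h0] at this
      simp at this
    have e2 : IsClopen ((fun x => branch p (σ x)) ⁻¹' {ζ}) := by
      refine ⟨isClosed_singleton.preimage hc2, ?_⟩
      have hfin : {ξ : ℂ | ξ ^ p = 1}.Finite := by
        refine ((Polynomial.nthRoots p (1 : ℂ)).toFinset.finite_toSet).subset fun ξ hξ => ?_
        simpa [Polynomial.mem_nthRoots hp.out.pos] using hξ
      have hcl : IsClosed ({ξ : ℂ | ξ ^ p = 1} \ {ζ}) := (hfin.subset Set.sdiff_subset).isClosed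
      rw [← isClosed_compl_iff]
      convert hcl.preimage hc2 using 1
      ext x
      have := branch_pow p (ne_zero_of_mem p (hσ x))
      simp [this]
    exact e1.inter e2
  have hzero : ∀ (P : Set ℂ), IsOpen P → IsClosed (P ∪ {w | w.im = 0}) →
      augOn P (push (powMap p) 0 (bd 0 a)) = 0 := by
    intro P hPo hPc
    let ε : ℂ → Ch k ℂ 0 →ₗ[k] k := fun ζ => augOn {w | powFun p w ∈ P ∧ branch p w = ζ}
    -- Rotation permutes the sectors over `P` cyclically and preserves the count in each, by the
    -- previous comparison.
    have hinv : ∀ ζ, ε (root p * ζ) (bd 0 a) = ε ζ (bd 0 a) := by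
      intro ζ
      have h3 := augOn_bd (hclopen P hPo hPc (root p * ζ)) hy'
      rw [← hy, map_sub, sub_eq_zero] at h3
      change augOn _ _ = _
      rw [← h3]
      refine LinearMap.congr_fun (f := augOn _ ∘ₗ push (rotMap p) 0) (g := ε ζ)
        (TupleChain.hom_ext fun σ => ?_) _
      rw [LinearMap.comp_apply, push_single, augOn_single, augOn_single]
      congr 1
      simp only [ContinuousMap.comp_apply, Set.mem_ofPred_eq, rotMap, ContinuousMap.coe_mk,
        powFun_root_mul, branch_root_mul, eq_iff_iff]
      rw [mul_right_inj' ((isPrimitiveRoot_root p).ne_zero hp0)]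
    have hpow : ∀ j : ℕ, ε (root p ^ j) (bd 0 a) = ε 1 (bd 0 a) := by
      intro j
      induction j with
      | zero => simp
      | succ j ih => rw [pow_succ', hinv, ih]
    -- Points of the image in `P` are counted sector by sector. The `p` equal counts then add up to
    -- zero mod `p`.
    have hsum : augOn P (push (powMap p) 0 (bd 0 a)) =
        ∑ j ∈ Finset.range p, ε (root p ^ j) (bd 0 a) := by
      rw [← sub_eq_zero]
      refine (?_ : _ = (augOn P ∘ₗ push (powMap p) 0 - ∑ j ∈ Finset.range p, ε (root p ^ j) :
        Ch k ℂ 0 →ₗ[k] k) (bd 0 a)).trans (linearMap_eq_zero_of_sub (fun σ hσ => ?_) h2)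
      · simp
      · have hne := ne_zero_of_mem p (hσ default)
        simp only [LinearMap.sub_apply, LinearMap.comp_apply, LinearMap.sum_apply, push_single,
          ε, augOn_single]
        rw [sub_eq_zero]
        simp only [ContinuousMap.comp_apply, powMap, ContinuousMap.coe_mk, Set.mem_ofPred_eq]
        by_cases hP : powFun p (σ default) ∈ P
        · simp only [hP, if_true, true_and]
          exact (sum_branch p hne).symm
        · simp [hP]
    rw [hsum, Finset.sum_congr rfl fun j _ => hpow j, Finset.sum_const, Finset.card_range,
      nsmul_eq_mul]
    rw [show ((p : ℕ) : k) = 0 from CharP.cast_eq_zero (ZMod p) p, zero_mul]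
  have hy0 : push (powMap p) 0 (bd 0 a) ∈ sub k (slitPlane ∩ -slitPlane) 0 :=
    push_mem_sub (fun w hw => hw) h2
  have hcl1 : IsClosed ({w : ℂ | 0 < w.im} ∪ {w | w.im = 0}) := by
    convert isClosed_le continuous_const continuous_im (f := fun _ : ℂ => (0 : ℝ)) using 1
    ext w
    simp [le_iff_lt_or_eq, eq_comm]
  have hcl2 : IsClosed ({w : ℂ | w.im < 0} ∪ {w | w.im = 0}) := by
    convert isClosed_le continuous_im continuous_const (g := fun _ : ℂ => (0 : ℝ)) using 1
    ext w
    simp [le_iff_lt_or_eq]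
  -- The image of the intersection cycle bounds in the overlap of the slit planes, and `f` closes up
  -- the images of the two halves to cycles in slit planes.
  obtain ⟨f, hf, hf'⟩ := exists_bd_of_augOn hy0
    (hzero _ (isOpen_lt continuous_const continuous_im) hcl1)
    (hzero _ (isOpen_lt continuous_im continuous_const) hcl2)
  have ha' : push (powMap p) 1 a ∈ sub k slitPlane 1 := push_mem_sub (fun w hw => hw) ha
  have hb' : push (powMap p) 1 b ∈ sub k (-slitPlane) 1 := push_mem_sub (fun w hw => hw) hb
  have hd' : push (powMap p) 2 d ∈ sub k {0}ᶜ 2 := by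
    rw [hUV] at hd
    refine push_mem_sub (fun w hw => ?_) hd
    change powFun p w ≠ 0
    rw [Ne, powFun_eq_zero hp0]
    exact hw
  obtain ⟨u1, hu1, hu1'⟩ := acycOn_slitPlane 0 _
    (Submodule.sub_mem _ ha' (sub_mono Set.inter_subset_left _ hf))
    (show bd 0 _ = 0 by rw [map_sub, hf', push_bd, sub_self])
  obtain ⟨u2, hu2, hu2'⟩ := acycOn_neg_slitPlane 0 _
    (Submodule.add_mem _ hb' (sub_mono Set.inter_subset_right _ hf))
    (show bd 0 _ = 0 by rw [map_add, hf', ← push_bd, h1, map_neg, neg_add_cancel])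
  refine ⟨u1 + u2 + push (powMap p) 2 d, Submodule.add_mem _ (Submodule.add_mem _
    (sub_mono ?_ _ hu1) (sub_mono ?_ _ hu2)) hd', ?_⟩
  · rw [← union_slitPlane]; exact Set.subset_union_left
  · rw [← union_slitPlane]; exact Set.subset_union_right
  · rw [map_add, map_add, hu1', hu2', e, map_add, map_add, ← push_bd]
    abel

/-! ### The suspended power map -/

/-- The model space `ℝ × ℂ`, with the sup norm. -/
abbrev Model : Type := ℝ × ℂ

variable {k : Type} [CommRing k]

/-- The complement of the axis. -/
def offAxis : Set Model := {x | x.2 ≠ 0}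

/-- The complement of a closed half of the axis. -/
def offHalf (s : ℝ) : Set Model := {x | x.2 ≠ 0 ∨ 0 < s * x.1}

lemma isOpen_offHalf (s : ℝ) : IsOpen (offHalf s) :=
  (isOpen_ne_fun continuous_snd continuous_const).union
    (isOpen_lt continuous_const (continuous_const.mul continuous_fst))

lemma union_offHalf : offHalf 1 ∪ offHalf (-1) = {0}ᶜ := by
  ext ⟨t, w⟩
  simp only [offHalf, Set.mem_union, Set.mem_ofPred_eq, Set.mem_compl_iff, Set.mem_singleton_iff,
    Prod.mk_eq_zero]
  rcases lt_trichotomy t 0 with h | h | h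
  · simp [h, h.ne]
  · simp [h]
  · simp [h, h.ne']

lemma inter_offHalf : offHalf 1 ∩ offHalf (-1) = offAxis := by
  ext ⟨t, w⟩
  simp only [offHalf, offAxis, Set.mem_inter_iff, Set.mem_ofPred_eq]
  constructor
  · rintro ⟨h1 | h1, h2 | h2⟩ <;> try assumption
    linarith
  · exact fun h => ⟨Or.inl h, Or.inl h⟩

lemma excisive_offHalf : Excisive k (offHalf 1) (offHalf (-1)) :=
  excisive_of_isOpen (isOpen_offHalf 1) (isOpen_offHalf (-1))

/-- The set is star-shaped about `(s, 0)`, a point of the half-axis that is kept. -/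
lemma acycOn_offHalf {s : ℝ} (hs : s ≠ 0) (n : ℕ) : AcycOn k (offHalf s) (n + 1) := by
  have hs' : 0 < s * s := mul_self_pos.2 hs
  refine acycOn_of_starConvex (a := (s, 0)) ?_ ⟨(s, 0), Or.inr hs'⟩ n
  rintro ⟨t, w⟩ h a b ha hb hab
  simp only [offHalf, Set.mem_ofPred_eq] at h ⊢
  simp only [Prod.smul_mk, smul_zero, Prod.mk_add_mk, zero_add, smul_eq_mul]
  rcases eq_or_lt_of_le hb with rfl | hb
  · right
    obtain rfl : a = 1 := by linarith
    linarith
  · rcases h with h | h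
    · exact Or.inl (smul_ne_zero hb.ne' h)
    · right
      have h1 : 0 < b * (s * t) := mul_pos hb h
      have h2 : 0 ≤ a * (s * s) := mul_nonneg ha hs'.le
      nlinarith

/-- The homotopy that contracts the first coordinate. -/
def axisHomotopy : ContinuousMap.Homotopy (.id Model)
    ((⟨fun w => (0, w), by fun_prop⟩ : C(ℂ, Model)).comp ⟨Prod.snd, continuous_snd⟩) where
  toFun q := ((1 - (q.1 : ℝ)) * q.2.1, q.2.2)
  continuous_toFun := by fun_prop
  map_zero_left x := by simp
  map_one_left x := by simp

lemma exists_axis {n : ℕ} {z : Ch k Model n} (hz : z ∈ sub k offAxis n) (hc : IsCyc z) :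
    ∃ y ∈ sub k ({0}ᶜ : Set ℂ) n, IsCyc y ∧ ∃ c ∈ sub k offAxis (n + 1),
      z = push ⟨fun w => (0, w), by fun_prop⟩ n y + bd n c := by
  obtain ⟨c, hc1, hc2⟩ := homotopy_push_on axisHomotopy (A := offAxis) (B := offAxis)
    (fun t x hx => hx) hz hc
  refine ⟨push ⟨Prod.snd, continuous_snd⟩ n z, push_mem_sub (fun x hx => hx) hz, hc.push _, c, hc1, ?_⟩
  rw [push_push, hc2, push_id]
  abel

lemma acycOn_offAxis (n : ℕ) : AcycOn k offAxis (n + 2) := by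
  intro z hz hc
  obtain ⟨y, hy, hyc, c, hc', rfl⟩ := exists_axis hz hc
  obtain ⟨d, hd, rfl⟩ := acycOn_punctured n y hy hyc
  refine ⟨push ⟨fun w => (0, w), by fun_prop⟩ _ d + c,
    Submodule.add_mem _ (push_mem_sub (fun w hw => hw) hd) hc', ?_⟩
  rw [map_add, push_bd]

/-- The punctured model space has no homology in degrees at least `3`. -/
theorem acycOn_compl_zero (n : ℕ) : AcycOn k ({0}ᶜ : Set Model) (n + 3) := by
  rw [← union_offHalf]
  refine excisive_offHalf.acycOn_union (acycOn_offHalf (by simp) _) (acycOn_offHalf (by simp) _) ?_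
  rw [inter_offHalf]
  exact acycOn_offAxis n

/-- The suspension of the power map. -/
def suspMap : C(Model, Model) := ⟨fun x => (x.1, powMap p x.2), by fun_prop⟩

lemma suspMap_mapsTo_offHalf (s : ℝ) : Set.MapsTo (suspMap p) (offHalf s) (offHalf s) := by
  rintro ⟨t, w⟩ (h | h)
  · exact Or.inl fun h' => h ((powFun_eq_zero hp.out.ne_zero).1 h')
  · exact Or.inr h

/-- Cycles off the axis can be moved into the slice over 0, where the suspended map is the power map
of the punctured plane. -/
lemma kills_offAxis : KillsOn (ZMod p) (suspMap p) offAxis offAxis 1 := by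
  intro z hz hc
  obtain ⟨y, hy, hyc, c, hc', rfl⟩ := exists_axis hz hc
  obtain ⟨d, hd, hd'⟩ := kills_punctured p y hy hyc
  refine ⟨push ⟨fun w => (0, w), by fun_prop⟩ _ d + push (suspMap p) _ c,
    Submodule.add_mem _ (push_mem_sub (fun w hw => hw) hd) (push_mem_sub ?_ hc'), ?_⟩
  · exact fun x hx h' => hx ((powFun_eq_zero hp.out.ne_zero).1 h')
  · rw [map_add, map_add, ← push_bd, ← push_bd, hd', push_push, push_push]
    rfl

/-- The suspended power map is zero on the second homology mod `p`. -/
theorem kills_compl_zero : KillsOn (ZMod p) (suspMap p) ({0}ᶜ : Set Model) {0}ᶜ 2 := by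
  intro z hz hzc
  rw [← union_offHalf] at *
  obtain ⟨a, ha, b, hb, d, hd, e, h1, h2⟩ := excisive_offHalf.split_cycle hz hzc
  rw [inter_offHalf] at h2
  -- The image of the intersection cycle bounds off the axis; the two corrected halves are cycles in
  -- star-shaped sets and bound there.
  obtain ⟨f, hf, hf'⟩ := kills_offAxis p _ h2 (isCyc_bd a)
  rw [← inter_offHalf] at hf
  obtain ⟨u1, hu1, hu1'⟩ := acycOn_offHalf one_ne_zero 1 _
    (Submodule.sub_mem _ (push_mem_sub (suspMap_mapsTo_offHalf p 1) ha)
      (sub_mono Set.inter_subset_left _ hf))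
    (show bd 1 _ = 0 by rw [map_sub, hf', push_bd, sub_self])
  obtain ⟨u2, hu2, hu2'⟩ := acycOn_offHalf (neg_ne_zero.2 one_ne_zero) 1 _
    (Submodule.add_mem _ (push_mem_sub (suspMap_mapsTo_offHalf p (-1)) hb)
      (sub_mono Set.inter_subset_right _ hf))
    (show bd 1 _ = 0 by rw [map_add, hf', ← push_bd, h1, map_neg, neg_add_cancel])
  refine ⟨u1 + u2 + push (suspMap p) 3 d, Submodule.add_mem _ (Submodule.add_mem _
    (sub_mono Set.subset_union_left _ hu1) (sub_mono Set.subset_union_right _ hu2))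
    (push_mem_sub (Set.MapsTo.union_union (suspMap_mapsTo_offHalf p 1)
      (suspMap_mapsTo_offHalf p (-1))) hd), ?_⟩
  rw [map_add, map_add, hu1', hu2', e, map_add, map_add, ← push_bd]
  abel

lemma norm_suspMap (x : Model) : ‖suspMap p x‖ = ‖x‖ := by
  simp [suspMap, powMap, Prod.norm_def, norm_powFun hp.out.ne_zero]

lemma suspMap_smul {s : ℝ} (hs : 0 ≤ s) (x : Model) : suspMap p (s • x) = s • suspMap p x := by
  refine Prod.ext rfl ?_
  simp [suspMap, powMap, powFun_smul hp.out.ne_zero hs]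

end PowerMap

end

/-! ### Surgery: removing a ball and collapsing fibres of the power map in its boundary -/

noncomputable section

namespace PowerMap

open SingChain

variable (p : ℕ) [hp : Fact p.Prime] {k : Type} [CommRing k]

lemma powFun_surjective : Function.Surjective (powFun p) := by
  intro v
  have hp0 := hp.out.ne_zero
  obtain ⟨w, hw⟩ := IsAlgClosed.exists_pow_nat_eq v hp.out.pos
  rcases eq_or_ne w 0 with rfl | hw0
  · refine ⟨0, ?_⟩
    rw [(powFun_eq_zero hp0).2 rfl, ← hw, zero_pow hp0]
  -- The power map commutes with positive scaling, so this factor cancels its denominator.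
  · refine ⟨((‖w‖ ^ (p - 1) : ℝ) : ℂ) * w, ?_⟩
    rw [powFun_smul hp0 (by positivity), powFun, hw]
    have : ((‖w‖ : ℝ) : ℂ) ^ (p - 1) ≠ 0 := pow_ne_zero _ (by simpa using hw0)
    push_cast
    field_simp

lemma suspMap_surjective : Function.Surjective (suspMap p) := by
  rintro ⟨t, v⟩
  obtain ⟨w, rfl⟩ := powFun_surjective p v
  exact ⟨(t, w), rfl⟩

/-- The unit sphere of the model space. -/
abbrev MSphere : Type := Metric.sphere (0 : Model) 1

/-- The suspended power map on the unit sphere. -/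
def sphereMap : C(MSphere, MSphere) :=
  ⟨fun x => ⟨suspMap p x, by simp [norm_suspMap]⟩, by fun_prop⟩

/-- A continuous surjection from a compact space to a Hausdorff space is closed. Thus collapsing the
fibres of the power map in the sphere gives a sphere again. -/
lemma isQuotientMap_sphereMap : Topology.IsQuotientMap (sphereMap p) := by
  refine IsClosedMap.isQuotientMap (sphereMap p).continuous.isClosedMap (sphereMap p).continuous ?_
  rintro ⟨y, hy⟩
  obtain ⟨x, rfl⟩ := suspMap_surjective p y
  refine ⟨⟨x, ?_⟩, rfl⟩
  simpa [norm_suspMap] using hy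

end PowerMap

open SingChain PowerMap

/-- A quotient `Z` of the complement of a ball in `D`: the fibers of the power map in the boundary of
the ball are collapsed. -/
structure Surgery (p : ℕ) [Fact p.Prime] (D Z : Type) [TopologicalSpace D] [TopologicalSpace Z] where
  /-- The coordinates around the ball. -/
  χ : C(Model, D)
  emb : Topology.IsOpenEmbedding χ
  closed : IsClosed (χ '' Metric.closedBall 0 1)
  /-- The quotient map. -/
  q : C(↥((χ '' Metric.ball 0 1)ᶜ), Z)
  quot : Topology.IsQuotientMap q
  rel : ∀ x y, q x = q y ↔ x = y ∨ ∃ u v : Model, ‖u‖ = 1 ∧ ‖v‖ = 1 ∧ χ u = x ∧ χ v = y ∧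
    suspMap p u = suspMap p v

namespace Surgery

variable {p : ℕ} [hp : Fact p.Prime] {D Z : Type} [TopologicalSpace D] [TopologicalSpace Z]
  (S : Surgery p D Z) {k : Type} [CommRing k]

lemma notMem_ball {u : Model} (hu : 1 ≤ ‖u‖) : S.χ u ∈ (S.χ '' Metric.ball 0 1)ᶜ := by
  rintro ⟨v, hv, e⟩
  rw [S.emb.injective e, mem_ball_zero_iff] at hv
  linarith

/-- The complement of the closed ball. -/
def outer : Set D := (S.χ '' Metric.closedBall 0 1)ᶜ

/-- The coordinate neighbourhood. -/
def chart : Set D := Set.range S.χ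

lemma notMem_of_outer {x : D} (hx : x ∈ S.outer) : x ∈ (S.χ '' Metric.ball 0 1)ᶜ :=
  fun h => hx (Set.image_mono Metric.ball_subset_closedBall h)

lemma isOpen_outer : IsOpen S.outer := S.closed.isOpen_compl

lemma isOpen_chart : IsOpen S.chart := S.emb.isOpen_range

lemma outer_union_chart : S.outer ∪ S.chart = Set.univ := by
  rw [Set.eq_univ_iff_forall]
  intro x
  by_cases h : x ∈ S.χ '' Metric.closedBall 0 1
  · exact Or.inr (Set.image_subset_range _ _ h)
  · exact Or.inl h

lemma χ_mem_outer {u : Model} : S.χ u ∈ S.outer ↔ 1 < ‖u‖ := by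
  rw [outer, Set.mem_compl_iff, S.emb.injective.mem_set_image, mem_closedBall_zero_iff, not_le]

lemma acycOn_chart (n : ℕ) : AcycOn k S.chart (n + 1) := by
  rw [chart, ← Set.image_univ]
  exact (acycOn_of_contractible n).image S.emb.isEmbedding

lemma excisive_outer : Excisive k S.outer S.chart :=
  excisive_of_isOpen S.isOpen_outer S.isOpen_chart

/-- The quotient map on the complement of the closed ball. -/
def qOuter : C(S.outer, Z) := ⟨fun x => S.q ⟨x, S.notMem_of_outer x.2⟩, by fun_prop⟩

lemma q_eq_of_outer {x y : ↥((S.χ '' Metric.ball 0 1)ᶜ)} (hx : (x : D) ∈ S.outer)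
    (h : S.q x = S.q y) : x = y := by
  rcases (S.rel x y).1 h with h | ⟨u, v, hu, -, hux, -⟩
  · exact h
  · rw [← hux, S.χ_mem_outer] at hx
    linarith

/-- Nothing is identified off the closed ball, so open sets there are saturated. -/
lemma qOuter_embedding : Topology.IsOpenEmbedding S.qOuter := by
  refine Topology.IsOpenEmbedding.of_continuous_injective_isOpenMap S.qOuter.continuous ?_ ?_
  · intro x y h
    have := S.q_eq_of_outer x.2 h
    exact Subtype.ext (congrArg (fun a : ↥((S.χ '' Metric.ball 0 1)ᶜ) => (a : D)) this)
  · intro G hG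
    rw [← S.quot.isOpen_preimage]
    obtain ⟨G', hG', rfl⟩ := isOpen_induced_iff.1 hG
    convert (hG'.inter S.isOpen_outer).preimage continuous_subtype_val using 1
    ext x
    constructor
    · rintro ⟨y, hy, e⟩
      have := S.q_eq_of_outer y.2 e
      rw [← this]
      exact ⟨hy, y.2⟩
    · rintro ⟨h1, h2⟩
      exact ⟨⟨x, h2⟩, h1, rfl⟩

/-- The image of the complement of the closed ball. -/
def zOuter : Set Z := Set.range S.qOuter

/-- The points of the model space outside the open ball. -/
abbrev Out : Type := {x : Model // 1 ≤ ‖x‖}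

/-- The parametrization of a neighbourhood of the image of the sphere. -/
def qOut : C(Out, Z) := ⟨fun x => S.q ⟨S.χ x, S.notMem_ball x.2⟩, by fun_prop⟩

/-- A neighbourhood of the image of the sphere. -/
def zChart : Set Z := Set.range S.qOut

lemma isOpen_zOuter : IsOpen S.zOuter := S.qOuter_embedding.isOpen_range

lemma q_mem_zChart {x : ↥((S.χ '' Metric.ball 0 1)ᶜ)} : S.q x ∈ S.zChart ↔ (x : D) ∈ S.chart := by
  constructor
  · rintro ⟨u, hu⟩
    rcases (S.rel _ _).1 hu with h | ⟨u, v, -, -, -, h, -⟩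
    · exact ⟨u, congrArg Subtype.val h⟩
    · exact ⟨v, h⟩
  · rintro ⟨u, hu⟩
    have hu1 : 1 ≤ ‖u‖ := by
      by_contra h
      exact x.2 ⟨u, by simpa using h, hu⟩
    exact ⟨⟨u, hu1⟩, congrArg S.q (Subtype.ext hu)⟩

lemma isOpen_zChart : IsOpen S.zChart := by
  rw [← S.quot.isOpen_preimage]
  convert S.isOpen_chart.preimage continuous_subtype_val using 1
  ext x
  exact S.q_mem_zChart

lemma zOuter_union_zChart : S.zOuter ∪ S.zChart = Set.univ := by
  rw [Set.eq_univ_iff_forall]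
  intro z
  obtain ⟨x, rfl⟩ := S.quot.surjective z
  have h : (x : D) ∈ S.outer ∪ S.chart := by rw [S.outer_union_chart]; trivial
  rcases h with h | h
  · exact Or.inl ⟨⟨x, h⟩, rfl⟩
  · exact Or.inr (S.q_mem_zChart.2 h)

lemma excisive_zOuter : Excisive k S.zOuter S.zChart :=
  excisive_of_isOpen S.isOpen_zOuter S.isOpen_zChart

lemma qOuter_mem_zChart {x : S.outer} : S.qOuter x ∈ S.zChart ↔ (x : D) ∈ S.chart :=
  S.q_mem_zChart (x := ⟨x, S.notMem_of_outer x.2⟩)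

lemma image_qOuter_chart : S.qOuter '' (incl S.outer ⁻¹' S.chart) = S.zOuter ∩ S.zChart := by
  ext z
  constructor
  · rintro ⟨x, hx, rfl⟩
    exact ⟨⟨x, rfl⟩, S.qOuter_mem_zChart.2 hx⟩
  · rintro ⟨⟨x, rfl⟩, hx⟩
    exact ⟨x, S.qOuter_mem_zChart.1 hx, rfl⟩

lemma image_incl_chart : incl S.outer '' (incl S.outer ⁻¹' S.chart) = S.outer ∩ S.chart := by
  ext z
  constructor
  · rintro ⟨x, hx, rfl⟩
    exact ⟨x.2, hx⟩
  · rintro ⟨h1, h2⟩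
    exact ⟨⟨z, h1⟩, h2, rfl⟩

/-- The cycle bounds in `D`, which is acyclic in positive degrees; splitting the bounding chain
between the outside of the ball and the chart moves the cycle into the shell. Off the closed ball,
`Z` and `D` agree. -/
lemma exists_homologous_inter
    (hD : ∀ n, AcycOn k (Set.univ : Set D) (n + 1)) {n : ℕ} {z : Ch k Z (n + 1)} (hz : z ∈ sub k S.zOuter (n + 1))
    (hc : bd n z = 0) : ∃ y ∈ sub k (S.zOuter ∩ S.zChart) (n + 1), ∃ u ∈ sub k S.zOuter (n + 2),
      z = y + bd (n + 1) u := by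
  rw [zOuter, ← Set.image_univ] at hz
  obtain ⟨z, -, rfl⟩ := exists_push_eq S.qOuter_embedding.isEmbedding hz
  have hc' : IsCyc z := IsCyc.of_push S.qOuter_embedding.injective hc
  obtain ⟨c, -, hc2⟩ := hD n (push (incl S.outer) _ z) (mem_sub_univ _) (hc'.push _)
  obtain ⟨y, hy, u, hu, -, -, e, -⟩ := S.excisive_outer.exists_inter (push_incl_mem z)
    (Submodule.zero_mem _) (by rw [S.outer_union_chart]; exact mem_sub_univ c)
    (by rw [hc2, sub_zero])
  rw [← S.image_incl_chart] at hy
  obtain ⟨y, hyA, rfl⟩ := exists_push_eq (incl_embedding _) hy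
  obtain ⟨u, rfl⟩ := exists_push_incl hu
  rw [← push_bd, ← map_add] at e
  have e' := push_injective (incl_embedding S.outer).injective _ e
  refine ⟨push S.qOuter _ y, ?_, push S.qOuter _ u, ?_, ?_⟩
  · rw [← S.image_qOuter_chart]
    exact push_mem_sub (Set.mapsTo_image _ _) hyA
  · exact push_mem_sub (fun x _ => Set.mem_range_self x) (mem_sub_univ u)
  · rw [e', map_add, push_bd]

/-- Two fillings in `D`, one outside the ball and one in the contractible chart, differ by a cycle
that bounds. Splitting its bounding chain shows that the outer filling can be replaced by one in the
shell. -/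
lemma exists_bd_inter (hD : ∀ n, AcycOn k (Set.univ : Set D) (n + 1)) {n : ℕ} {y : Ch k Z (n + 1)}
    (hy : y ∈ sub k (S.zOuter ∩ S.zChart) (n + 1)) {u : Ch k Z (n + 2)}
    (hu : u ∈ sub k S.zOuter (n + 2)) (e : bd (n + 1) u = y) :
    ∃ v ∈ sub k (S.zOuter ∩ S.zChart) (n + 2), bd (n + 1) v = y := by
  rw [← S.image_qOuter_chart] at hy
  obtain ⟨y, hyA, rfl⟩ := exists_push_eq S.qOuter_embedding.isEmbedding hy
  rw [zOuter, ← Set.image_univ] at hu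
  obtain ⟨u, -, rfl⟩ := exists_push_eq S.qOuter_embedding.isEmbedding hu
  rw [← push_bd] at e
  have e' := push_injective S.qOuter_embedding.injective _ e
  subst e'
  have hP : push (incl S.outer) _ (bd (n + 1) u) ∈ sub k S.chart (n + 1) :=
    push_mem_sub (fun x hx => hx) hyA
  obtain ⟨v, hv, hv'⟩ := S.acycOn_chart n _ hP ((isCyc_bd u).push _)
  obtain ⟨c, -, hc⟩ := hD (n + 1) (push (incl S.outer) _ u - v) (mem_sub_univ _)
    (show bd (n + 1) _ = 0 by rw [map_sub, hv', push_bd, sub_self])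
  obtain ⟨y', hy', u', -, -, -, e1, -⟩ := S.excisive_outer.exists_inter (push_incl_mem u) hv
    (by rw [S.outer_union_chart]; exact mem_sub_univ c) hc
  rw [← S.image_incl_chart] at hy'
  obtain ⟨y', hyB, rfl⟩ := exists_push_eq (incl_embedding _) hy'
  refine ⟨push S.qOuter _ y', ?_, ?_⟩
  · rw [← S.image_qOuter_chart]
    exact push_mem_sub (Set.mapsTo_image _ _) hyB
  · rw [← push_bd]
    congr 1
    apply push_injective (incl_embedding S.outer).injective
    rw [push_bd, push_bd, e1, map_add, bd_bd, add_zero]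

/-! #### The neighbourhood of the image of the sphere -/

/-- The parametrization, as a map onto its image. -/
def qChart : C(Out, S.zChart) := ⟨fun x => ⟨S.qOut x, x, rfl⟩, by fun_prop⟩

/-- The chart is an open saturated set, so the quotient map restricts to a quotient map over it. -/
lemma isQuotientMap_qChart : Topology.IsQuotientMap S.qChart := by
  rw [Topology.isQuotientMap_iff]
  refine ⟨.of_isOpen_preimage_iff_isOpen fun s => ⟨fun h => ?_, fun h => h.preimage
    S.qChart.continuous⟩, fun ⟨z, x, hx⟩ => ⟨x, Subtype.ext hx⟩⟩
  obtain ⟨G, hG, hG'⟩ := isOpen_induced_iff.1 h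
  have hop : IsOpen (Subtype.val '' s : Set Z) := by
    rw [← S.quot.isOpen_preimage]
    convert (S.emb.isOpenMap _ hG).preimage continuous_subtype_val using 1
    ext x
    constructor
    · rintro ⟨⟨z, hz⟩, hzs, rfl⟩
      obtain ⟨u, hu⟩ := S.q_mem_zChart.1 hz
      have hu1 : 1 ≤ ‖u‖ := by
        by_contra h
        exact x.2 ⟨u, by simpa using h, hu⟩
      refine ⟨u, ?_, hu⟩
      have : (⟨u, hu1⟩ : Out) ∈ Subtype.val ⁻¹' G := by
        rw [hG']
        change S.qChart ⟨u, hu1⟩ ∈ s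
        convert hzs
        exact congrArg S.q (Subtype.ext hu)
      exact this
    · rintro ⟨u, hu, hux⟩
      have hu1 : 1 ≤ ‖u‖ := by
        by_contra h
        exact x.2 ⟨u, by simpa using h, hux⟩
      have : (⟨u, hu1⟩ : Out) ∈ S.qChart ⁻¹' s := by rw [← hG']; exact hu
      refine ⟨_, this, congrArg S.q (Subtype.ext hux)⟩
  convert hop.preimage continuous_subtype_val using 1
  exact (Set.preimage_image_eq s Subtype.val_injective).symm

lemma qOut_eq {x y : Out} : S.qOut x = S.qOut y ↔ x = y ∨ (‖(x : Model)‖ = 1 ∧ ‖(y : Model)‖ = 1 ∧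
    suspMap p x = suspMap p y) := by
  refine (S.rel _ _).trans ?_
  constructor
  · rintro (h | ⟨u, v, hu, hv, hux, hvy, e⟩)
    · exact Or.inl (Subtype.ext (S.emb.injective (congrArg Subtype.val h)))
    · obtain rfl := S.emb.injective hux
      obtain rfl := S.emb.injective hvy
      exact Or.inr ⟨hu, hv, e⟩
  · rintro (rfl | ⟨hx, hy, e⟩)
    · exact Or.inl rfl
    · exact Or.inr ⟨x, y, hx, hy, rfl, rfl, e⟩

/-- The punctured model space. -/
abbrev Punct : Type := ↥({0}ᶜ : Set Model)

variable (p) in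
/-- The suspended power map outside the open ball. -/
def outPunct : C(Out, Punct) :=
  ⟨fun x => ⟨suspMap p x, by
    have := x.2
    rw [← norm_suspMap p] at this
    exact norm_pos_iff.1 (lt_of_lt_of_le one_pos this)⟩, by fun_prop⟩

lemma factors_outPunct : Function.FactorsThrough (outPunct p) S.qChart := by
  intro x y h
  rcases S.qOut_eq.1 (congrArg Subtype.val h) with rfl | ⟨-, -, h⟩
  · rfl
  · exact Subtype.ext h

/-- The map to the punctured model space induced by the suspended power map. -/
def toPunct : C(S.zChart, Punct) :=
  S.isQuotientMap_qChart.lift (outPunct p) (S.factors_outPunct)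

lemma toPunct_qChart (x : Out) : (S.toPunct (S.qChart x) : Model) = suspMap p x :=
  congrArg Subtype.val (DFunLike.congr_fun
    (S.isQuotientMap_qChart.lift_comp (outPunct p) S.factors_outPunct) x)

/-- The sphere as a subspace of the complement of the open ball. -/
def sphereOut : C(MSphere, Out) := 
  ⟨fun x => ⟨x, (mem_sphere_zero_iff_norm.1 x.2).ge⟩, by fun_prop⟩

lemma factors_sphereOut : Function.FactorsThrough (S.qChart.comp sphereOut) (sphereMap p) := by
  intro x y h
  apply Subtype.ext
  refine S.qOut_eq.2 (Or.inr ⟨?_, ?_, congrArg Subtype.val h⟩)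
  · exact mem_sphere_zero_iff_norm.1 x.2
  · exact mem_sphere_zero_iff_norm.1 y.2

/-- The section over the unit sphere. -/
def ofSphere : C(MSphere, S.zChart) :=
  (isQuotientMap_sphereMap p).lift (S.qChart.comp sphereOut) S.factors_sphereOut

lemma ofSphere_sphereMap (x : MSphere) : S.ofSphere (sphereMap p x) = S.qChart (sphereOut x) :=
  DFunLike.congr_fun ((isQuotientMap_sphereMap p).lift_comp _ S.factors_sphereOut) x

/-- The radial projection. -/
def radial : C(Punct, MSphere) where
  toFun x := ⟨‖(x : Model)‖⁻¹ • (x : Model), by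
    have : (x : Model) ≠ 0 := x.2
    simp [norm_smul, this]⟩
  continuous_toFun := by
    refine Continuous.subtype_mk ?_ _
    exact Continuous.smul (Continuous.inv₀ (continuous_norm.comp continuous_subtype_val)
      fun x => norm_ne_zero_iff.2 x.2) continuous_subtype_val

/-- The map from the punctured model space. -/
def ofPunct : C(Punct, S.zChart) := S.ofSphere.comp radial

/-- The suspended power map preserves norms and commutes with positive scaling, so the round trip
through the punctured model is radial projection to the unit sphere. -/
lemma exists_radial (x : Out) : ∃ y : MSphere, (y : Model) = ‖(x : Model)‖⁻¹ • (x : Model) ∧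
    S.ofPunct (S.toPunct (S.qChart x)) = S.qChart (sphereOut y) := by
  have hx0 : 0 < ‖(x : Model)‖ := lt_of_lt_of_le one_pos x.2
  refine ⟨⟨‖(x : Model)‖⁻¹ • (x : Model), by simp [norm_smul, hx0.ne']⟩, rfl, ?_⟩
  rw [← ofSphere_sphereMap]
  change S.ofSphere (radial _) = _
  congr 1
  apply Subtype.ext
  change ‖(S.toPunct (S.qChart x) : Model)‖⁻¹ • (S.toPunct (S.qChart x) : Model) = suspMap p _
  rw [toPunct_qChart, norm_suspMap, suspMap_smul p (inv_nonneg.2 hx0.le)]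

/-- The radial deformation. -/
def radialDef : C(Out × unitInterval, Out) where
  toFun q := ⟨((1 - (q.2 : ℝ)) + q.2 * ‖(q.1 : Model)‖⁻¹) • (q.1 : Model), by
    have h1 := q.1.2
    have h2 := q.2.2.1
    have h3 := q.2.2.2
    have h0 : 0 < ‖(q.1 : Model)‖ := lt_of_lt_of_le one_pos h1
    rw [norm_smul, Real.norm_of_nonneg (add_nonneg (sub_nonneg.2 h3)
      (mul_nonneg h2 (inv_nonneg.2 h0.le))), add_mul, mul_assoc,
      inv_mul_cancel₀ h0.ne']
    nlinarith⟩
  continuous_toFun := by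
    refine Continuous.subtype_mk ?_ _
    have hn : Continuous fun q : Out × unitInterval => ‖(q.1 : Model)‖ := by fun_prop
    have ht : Continuous fun q : Out × unitInterval => (q.2 : ℝ) := by fun_prop
    have hx : Continuous fun q : Out × unitInterval => (q.1 : Model) := by fun_prop
    exact ((continuous_const.sub ht).add (ht.mul
      (hn.inv₀ fun x => (lt_of_lt_of_le one_pos x.1.2).ne'))).smul hx

lemma radialDef_of_norm {x : Out} (hx : ‖(x : Model)‖ = 1) (t : unitInterval) :
    radialDef (x, t) = x := by
  apply Subtype.ext
  simp [radialDef, hx]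

/-- The radial deformation fixes the unit sphere, the only place where points are identified, so it
descends. It is descended in curried form, as a map into paths, so that the product of the quotient
map with the interval need not be known to be a quotient map. -/
lemma ofPunct_toPunct : (S.ofPunct.comp S.toPunct).Homotopic (.id _) := by
  have hF : Function.FactorsThrough (S.qChart.comp radialDef).curry S.qChart := by
    intro x y h
    ext t
    simp only [ContinuousMap.curry_apply, ContinuousMap.comp_apply]
    rcases S.qOut_eq.1 (congrArg Subtype.val h) with rfl | ⟨hx, hy, -⟩
    · rfl
    · rw [radialDef_of_norm hx, radialDef_of_norm hy]
      exact congrArg Subtype.val h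
  obtain ⟨G, hG'⟩ : ∃ G : C(S.zChart, C(unitInterval, S.zChart)),
      G.comp S.qChart = (S.qChart.comp radialDef).curry :=
    ⟨_, S.isQuotientMap_qChart.lift_comp _ hF⟩
  have hG : ∀ x t, G (S.qChart x) t = S.qChart (radialDef (x, t)) := by
    intro x t
    change (G.comp S.qChart) x t = _
    rw [hG']
    rfl
  refine ContinuousMap.Homotopic.symm ⟨⟨⟨fun q => G q.2 q.1, ?_⟩, ?_, ?_⟩⟩
  · exact (ContinuousMap.continuous_uncurry_of_continuous G).comp continuous_swap
  · intro z
    obtain ⟨x, rfl⟩ := S.isQuotientMap_qChart.surjective z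
    change G _ 0 = S.qChart x
    rw [hG]
    congr 1
    apply Subtype.ext
    simp [radialDef]
  · intro z
    obtain ⟨x, rfl⟩ := S.isQuotientMap_qChart.surjective z
    change G _ 1 = _
    obtain ⟨y, hy, e⟩ := S.exists_radial x
    rw [hG, ContinuousMap.comp_apply, e]
    congr 1
    apply Subtype.ext
    rw [show (sphereOut y : Model) = y from rfl, hy]
    simp [radialDef]

lemma acycOn_zChart (n : ℕ) : AcycOn k S.zChart (n + 3) := by
  rw [← acycOn_subtype]
  refine AcycOn.of_homotopic S.ofPunct_toPunct ?_
  rw [acycOn_subtype]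
  exact acycOn_compl_zero n

/-- The points of the model space outside the closed ball. -/
abbrev StrictOut : Type := {x : Model // 1 < ‖x‖}

/-- The parametrization of the part of the neighbourhood outside the image of the sphere. -/
def qStrict : C(StrictOut, Z) := S.qOuter.comp
  ⟨fun x => ⟨S.χ x, S.χ_mem_outer.2 x.2⟩, by fun_prop⟩

lemma qStrict_embedding : Topology.IsEmbedding S.qStrict := by
  refine S.qOuter_embedding.isEmbedding.comp ?_
  refine Topology.IsEmbedding.of_comp (g := Subtype.val) (by fun_prop) continuous_subtype_val ?_
  exact S.emb.isEmbedding.comp Topology.IsEmbedding.subtypeVal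

lemma range_qStrict : Set.range S.qStrict = S.zOuter ∩ S.zChart := by
  rw [← image_qOuter_chart]
  ext z
  constructor
  · rintro ⟨x, rfl⟩
    exact ⟨⟨S.χ x, S.χ_mem_outer.2 x.2⟩, ⟨x, rfl⟩, rfl⟩
  · rintro ⟨⟨_, hx⟩, ⟨u, rfl⟩, rfl⟩
    exact ⟨⟨u, S.χ_mem_outer.1 hx⟩, rfl⟩

/-- Up to homotopy the neighbourhood of the collapsed sphere maps to the punctured model and back,
and on the shell the first of these maps is the suspended power map, which kills 2-cycles mod `p`.
-/
lemma exists_bd_zChart {y : Ch (ZMod p) Z 2} (hy : y ∈ sub (ZMod p) (S.zOuter ∩ S.zChart) 2)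
    (hc : IsCyc y) : ∃ c ∈ sub (ZMod p) S.zChart 3, bd 2 c = y := by
  rw [← range_qStrict, ← Set.image_univ] at hy
  obtain ⟨x, -, rfl⟩ := exists_push_eq S.qStrict_embedding hy
  have hx : IsCyc x := hc.of_push S.qStrict_embedding.injective
  let ι : C(StrictOut, Model) := ⟨Subtype.val, continuous_subtype_val⟩
  let j : C(StrictOut, Out) := ⟨fun x => ⟨x, x.2.le⟩, by fun_prop⟩
  obtain ⟨d, hd, hd'⟩ := kills_compl_zero p (push ι 2 x) (push_mem_sub (A := Set.univ) (fun x _ => by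
    exact norm_pos_iff.1 (one_pos.trans x.2)) (mem_sub_univ x)) (hx.push ι)
  obtain ⟨d, rfl⟩ := exists_push_incl hd
  have e1 : bd 2 d = push S.toPunct 2 (push S.qChart 2 (push j 2 x)) := by
    apply push_injective (incl_embedding ({0}ᶜ : Set Model)).injective
    rw [push_bd, hd', push_push, push_push, push_push, push_push]
    congr 1
    congr 1
    ext x : 1
    exact (S.toPunct_qChart (j x)).symm
  obtain ⟨c, hc⟩ := homotopy_push S.ofPunct_toPunct 2 ((hx.push j).push S.qChart)
  refine ⟨push (incl S.zChart) 3 (push S.ofPunct 3 d - c), push_incl_mem _, ?_⟩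
  rw [← push_bd, map_sub, ← push_bd, e1, hc, push_push S.ofPunct, sub_sub_cancel, push_id, push_push,
    push_push]
  rfl

/-- The quotient has no homology in degrees at least `3`. -/
theorem acycOn_univ (S : Surgery p D Z)
    (hD : ∀ n, AcycOn k (Set.univ : Set D) (n + 1))
    (n : ℕ) : AcycOn k (Set.univ : Set Z) (n + 3) := by
  rw [← S.zOuter_union_zChart]
  intro z hz hc
  obtain ⟨a, ha, b, hb, d, hd, e, h1, h2⟩ := S.excisive_zOuter.split_cycle hz hc
  -- The intersection cycle is filled outside by `a`, hence by some `v` in the shell. Then `a - v`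
  -- is a cycle, homologous to some `y` in the shell, and everything left lies in the neighbourhood
  -- of the sphere.
  obtain ⟨v, hv, hv'⟩ := S.exists_bd_inter hD h2 ha rfl
  obtain ⟨y, hy, u, hu, e2⟩ := S.exists_homologous_inter hD (z := a - v)
    (Submodule.sub_mem _ ha (sub_mono Set.inter_subset_left _ hv))
    (by rw [map_sub, hv', sub_self])
  have hyc : bd (n + 2) y = 0 := by
    have : y = a - v - bd _ u := by rw [e2]; abel
    rw [this, map_sub, map_sub, hv', sub_self, bd_bd, sub_zero]
  obtain ⟨w, hw, hw'⟩ := S.acycOn_zChart (k := k) n (b + v + y) (Submodule.add_mem _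
    (Submodule.add_mem _ hb (sub_mono Set.inter_subset_right _ hv))
    (sub_mono Set.inter_subset_right _ hy))
    (show bd (n + 2) _ = 0 by rw [map_add, map_add, h1, hv', hyc]; abel)
  refine ⟨u + w + d, Submodule.add_mem _ (Submodule.add_mem _
    (sub_mono Set.subset_union_left _ hu) (sub_mono Set.subset_union_right _ hw)) hd, ?_⟩
  rw [map_add, map_add, hw', e]
  have : a = v + y + bd (n + 3) u := (sub_eq_iff_eq_add.1 e2).trans (by abel)
  exact congrArg (fun t => t + b + bd (n + 3) d) this |>.trans (by abel) |>.symm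

/-- Mod `p`, all `2`-cycles outside the image of the sphere are boundaries. -/
theorem exists_bd_of_zOuter (hD : ∀ n, AcycOn (ZMod p) (Set.univ : Set D) (n + 1))
    {z : Ch (ZMod p) Z 2} (hz : z ∈ sub (ZMod p) S.zOuter 2) (hc : bd 1 z = 0) :
    ∃ c, bd 2 c = z := by
  obtain ⟨y, hy, u, -, e⟩ := S.exists_homologous_inter hD hz hc
  have hyc : bd 1 y = 0 := by
    have : y = z - bd _ u := by rw [e]; abel
    rw [this, map_sub, hc, bd_bd, sub_zero]
  obtain ⟨c, -, hc'⟩ := S.exists_bd_zChart hy hyc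
  exact ⟨c + u, by rw [map_add, hc', e]⟩

end Surgery

end

noncomputable section

open SingChain PowerMap Complex

/-! ### Charts of the sphere around arcs of the fixed circle -/

/-- A continuous injection with a continuous inverse on its open range is an open embedding. -/
lemma isOpenEmbedding_of_leftInverse {X Y : Type*} [TopologicalSpace X] [TopologicalSpace Y]
    {f : X → Y} {g : Y → X} {U : Set Y} (hf : Continuous f) (hU : IsOpen U) (hg : ContinuousOn g U)
    (hfU : ∀ x, f x ∈ U) (hgf : ∀ x, g (f x) = x) (hfg : ∀ y ∈ U, f (g y) = y) :
    Topology.IsOpenEmbedding f := by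
  let e : X ≃ₜ U :=
    { toFun := fun x => ⟨f x, hfU x⟩
      invFun := fun y => g y
      left_inv := hgf
      right_inv := fun y => Subtype.ext (hfg y y.2)
      continuous_toFun := hf.subtype_mk _
      continuous_invFun := continuousOn_iff_continuous_domRestrict.1 hg }
  exact hU.isOpenEmbedding_subtypeVal.comp e.isOpenEmbedding

namespace SphereChart

/-- Retraction of the complex plane onto the closed unit disc. -/
def clamp (w : ℂ) : ℂ := (max 1 ‖w‖)⁻¹ • w

lemma norm_clamp (w : ℂ) : ‖clamp w‖ ≤ 1 := by
  rw [clamp, norm_smul, norm_inv, Real.norm_of_nonneg (by positivity), inv_mul_le_iff₀ (by positivity),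
    mul_one]
  exact le_max_right _ _

lemma clamp_of_norm_le {w : ℂ} (hw : ‖w‖ ≤ 1) : clamp w = w := by
  rw [clamp, max_eq_left hw, inv_one, one_smul]

lemma continuous_clamp : Continuous clamp := by
  have h : Continuous fun w : ℂ => max 1 ‖w‖ := by fun_prop
  exact (h.inv₀ fun w => by positivity).smul continuous_id

lemma norm_sqrt_mul_exp (s x : ℝ) : ‖((√s : ℝ) : ℂ) * exp ((x : ℂ) * I)‖ = √s := by
  rw [norm_mul, norm_exp_ofReal_mul_I, mul_one, norm_real, Real.norm_of_nonneg (Real.sqrt_nonneg _)]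

/-- Coordinates near an arc of the fixed circle. -/
def tube (m l r : ℝ) : C(Model, Sphere3) where
  toFun v := ⟨(((√(1 - ‖clamp (r * v.2)‖ ^ 2) : ℝ) : ℂ) * exp (((m + l * v.1 : ℝ) : ℂ) * I),
    clamp (r * v.2)), by
      rw [norm_sqrt_mul_exp, Real.sq_sqrt]
      · ring
      · nlinarith [norm_clamp (r * v.2), norm_nonneg (clamp (r * v.2))]⟩
  continuous_toFun := by
    have hc := continuous_clamp
    refine Continuous.subtype_mk ?_ _
    fun_prop

/-- The inverse coordinates. -/
def tubeInv (m l r : ℝ) (q : Sphere3) : Model :=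
  (l⁻¹ * arg (q.1.1 * exp (((-m : ℝ) : ℂ) * I)), ((r⁻¹ : ℝ) : ℂ) * q.1.2)

lemma norm_snd_le (q : Sphere3) : ‖q.1.2‖ ≤ 1 := by
  nlinarith [q.2, norm_nonneg q.1.2, sq_nonneg ‖q.1.1‖]

lemma sqrt_one_sub (q : Sphere3) : √(1 - ‖q.1.2‖ ^ 2) = ‖q.1.1‖ := by
  rw [← eq_sub_of_add_eq q.2, Real.sqrt_sq (norm_nonneg _)]

variable {m l r : ℝ}

lemma tube_snd {v : Model} (hr : 0 ≤ r) (hv : r * ‖v.2‖ ≤ 1) : (tube m l r v).1.2 = r * v.2 :=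
  clamp_of_norm_le (by rwa [norm_mul, norm_real, Real.norm_of_nonneg hr])

/-- The bounds keep the angle in the range of the principal argument and keep the clamp inactive and
the first coordinate nonzero. -/
lemma tubeInv_tube {v : Model} (hl : 0 < l) (hr : 0 < r) (h1 : l * |v.1| < Real.pi)
    (h2 : r * ‖v.2‖ < 1) : tubeInv m l r (tube m l r v) = v := by
  have hs := tube_snd (m := m) (l := l) hr.le h2.le
  have hs' : clamp (r * v.2) = r * v.2 := hs
  apply Prod.ext
  · change l⁻¹ * arg (((√(1 - ‖clamp (r * v.2)‖ ^ 2) : ℝ) : ℂ) * exp (((m + l * v.1 : ℝ) : ℂ) * I)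
      * exp (((-m : ℝ) : ℂ) * I)) = v.1
    have hpos : 0 < √(1 - ‖clamp (r * v.2)‖ ^ 2) := by
      rw [hs', norm_mul, norm_real, Real.norm_of_nonneg hr.le]
      apply Real.sqrt_pos.2
      have : 0 ≤ r * ‖v.2‖ := by positivity
      nlinarith
    rw [mul_assoc, ← exp_add, arg_real_mul _ hpos, ← add_mul, ← ofReal_add,
      show m + l * v.1 + -m = l * v.1 by ring, arg_exp_mul_I]
    have h3 : |l * v.1| < Real.pi := by rwa [abs_mul, abs_of_pos hl]
    rw [(toIocMod_eq_self Real.two_pi_pos).2]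
    · field_simp
    · constructor <;> linarith [(abs_lt.1 h3).1, (abs_lt.1 h3).2]
  · change ((r⁻¹ : ℝ) : ℂ) * (tube m l r v).1.2 = v.2
    rw [hs, ofReal_inv, inv_mul_cancel_left₀ (by exact_mod_cast hr.ne')]

/-- Norm and principal argument recover every complex number, including 0, so no restriction on `q`
is needed. -/
lemma tube_tubeInv (hl : l ≠ 0) (hr : r ≠ 0) (q : Sphere3) : tube m l r (tubeInv m l r q) = q := by
  have h2 : (r : ℂ) * (tubeInv m l r q).2 = q.1.2 := by
    change (r : ℂ) * (((r⁻¹ : ℝ) : ℂ) * q.1.2) = _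
    rw [ofReal_inv, mul_inv_cancel_left₀ (by exact_mod_cast hr)]
  have h1 : l * (tubeInv m l r q).1 = arg (q.1.1 * exp (((-m : ℝ) : ℂ) * I)) :=
    mul_inv_cancel_left₀ hl _
  apply Subtype.ext
  apply Prod.ext
  · change ((√(1 - ‖clamp (r * (tubeInv m l r q).2)‖ ^ 2) : ℝ) : ℂ)
      * exp (((m + l * (tubeInv m l r q).1 : ℝ) : ℂ) * I) = q.1.1
    rw [h1, h2, clamp_of_norm_le (norm_snd_le q), sqrt_one_sub, ofReal_add, add_mul, exp_add]
    have h3 := norm_mul_exp_arg_mul_I (q.1.1 * exp (((-m : ℝ) : ℂ) * I))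
    rw [norm_mul, norm_exp_ofReal_mul_I, mul_one] at h3
    rw [mul_left_comm, h3, mul_left_comm, ← exp_add, ofReal_neg, neg_mul, add_neg_cancel, exp_zero,
      mul_one]
  · change clamp (r * (tubeInv m l r q).2) = _
    rw [h2, clamp_of_norm_le (norm_snd_le q)]

lemma mem_ball_iff {v : Model} {s : ℝ} : v ∈ Metric.ball (0 : Model) s ↔ |v.1| < s ∧ ‖v.2‖ < s := by
  rw [mem_ball_zero_iff, Prod.norm_def, max_lt_iff, Real.norm_eq_abs]

/-- Points with coordinates in this ball have nonzero first entry and shifted argument of absolute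
value less than `π`, so they avoid the cut where the argument jumps. -/
lemma isOpen_tubeInv {s : ℝ} (hl : 0 < l) (hr : 0 < r) (hls : l * s < Real.pi) (hrs : r * s < 1) :
    IsOpen (tubeInv m l r ⁻¹' Metric.ball 0 s) ∧
      ContinuousOn (tubeInv m l r) (tubeInv m l r ⁻¹' Metric.ball 0 s) := by
  let U : Set Sphere3 := {q | q.1.1 * exp (((-m : ℝ) : ℂ) * I) ∈ slitPlane}
  have hU : IsOpen U := isOpen_slitPlane.preimage (by fun_prop)
  have hc : ContinuousOn (tubeInv m l r) U := by
    intro q hq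
    apply ContinuousAt.continuousWithinAt
    refine ContinuousAt.prodMk (continuousAt_const.mul ?_) (by fun_prop)
    exact ContinuousAt.comp (f := fun q : Sphere3 => q.1.1 * exp (((-m : ℝ) : ℂ) * I))
      (continuousAt_arg hq) (by fun_prop)
  have hsub : tubeInv m l r ⁻¹' Metric.ball 0 s ⊆ U := by
    intro q hq
    obtain ⟨h1, h2⟩ := mem_ball_iff.1 hq
    have h1' : |arg (q.1.1 * exp (((-m : ℝ) : ℂ) * I))| < Real.pi := by
      refine lt_of_lt_of_le ?_ hls.le
      have : |l⁻¹ * arg (q.1.1 * exp (((-m : ℝ) : ℂ) * I))| < s := h1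
      rwa [abs_mul, abs_of_pos (inv_pos.2 hl), inv_mul_lt_iff₀ hl] at this
    have h2' : ‖q.1.2‖ < 1 := by
      refine lt_of_lt_of_le ?_ hrs.le
      have : ‖((r⁻¹ : ℝ) : ℂ) * q.1.2‖ < s := h2
      rwa [norm_mul, norm_real, Real.norm_of_nonneg (inv_pos.2 hr).le, inv_mul_lt_iff₀ hr] at this
    refine mem_slitPlane_iff_arg.2 ⟨fun h => ?_, mul_ne_zero (fun h => ?_) (exp_ne_zero _)⟩
    · rw [h, abs_of_pos Real.pi_pos] at h1'
      exact lt_irrefl _ h1'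
    · have := q.2
      rw [h, norm_zero] at this
      nlinarith [norm_nonneg q.1.2]
  refine ⟨?_, hc.mono hsub⟩
  rw [← Set.inter_eq_right.2 hsub]
  exact hc.isOpen_inter_preimage hU Metric.isOpen_ball

/-- The radial contraction of the model space onto the ball of radius `s`. -/
def shrink (s : ℝ) (hs : 1 < s) : C(Model, Model) where
  toFun v := (s / (s - 1 + ‖v‖)) • v
  continuous_toFun := by
    have h : Continuous fun v : Model => s - 1 + ‖v‖ := by fun_prop
    exact (continuous_const.div h fun v => by have := norm_nonneg v; linarith).smul continuous_id

/-- The inverse of the radial contraction. -/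
def expand (s : ℝ) (v : Model) : Model := ((s - 1) / (s - ‖v‖)) • v

variable {s : ℝ} (hs : 1 < s)

lemma shrink_apply (v : Model) : shrink s hs v = (s / (s - 1 + ‖v‖)) • v := rfl

lemma norm_shrink (v : Model) : ‖shrink s hs v‖ = s * ‖v‖ / (s - 1 + ‖v‖) := by
  have : 0 ≤ s - 1 + ‖v‖ := by have := norm_nonneg v; linarith
  rw [shrink_apply, norm_smul, Real.norm_of_nonneg (by positivity)]
  ring

lemma shrink_mem_ball (v : Model) : shrink s hs v ∈ Metric.ball (0 : Model) s := by
  have := norm_nonneg v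
  rw [mem_ball_zero_iff, norm_shrink, div_lt_iff₀ (by linarith)]
  nlinarith

/-- The scaling factor is chosen to equal 1 on the unit sphere, so the unit ball stays the unit ball
while the whole space is squeezed into radius `s`. -/
lemma norm_shrink_le_one {v : Model} : ‖shrink s hs v‖ ≤ 1 ↔ ‖v‖ ≤ 1 := by
  have := norm_nonneg v
  rw [norm_shrink, div_le_iff₀ (by linarith)]
  constructor <;> intro h <;> nlinarith

lemma expand_shrink (v : Model) : expand s (shrink s hs v) = v := by
  have := norm_nonneg v
  have h1 : s - 1 + ‖v‖ ≠ 0 := by linarith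
  have h2 : s - 1 ≠ 0 := by linarith
  have h3 : s ≠ 0 := by linarith
  have h4 : s - s * ‖v‖ / (s - 1 + ‖v‖) = s * (s - 1) / (s - 1 + ‖v‖) := by field_simp; ring
  rw [expand, norm_shrink, shrink_apply, smul_smul, h4]
  convert one_smul ℝ v
  field_simp

lemma shrink_expand {v : Model} (hv : v ∈ Metric.ball (0 : Model) s) :
    shrink s hs (expand s v) = v := by
  rw [mem_ball_zero_iff] at hv
  have hn := norm_nonneg v
  have h2 : s - 1 ≠ 0 := by linarith
  have h3 : s ≠ 0 := by linarith
  have h1 : s - ‖v‖ ≠ 0 := by linarith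
  have h5 : 0 ≤ (s - 1) / (s - ‖v‖) := div_nonneg (by linarith) (by linarith)
  have h4 : s - 1 + ‖expand s v‖ = s * (s - 1) / (s - ‖v‖) := by
    rw [expand, norm_smul, Real.norm_of_nonneg h5]
    field_simp
    ring
  rw [shrink_apply, h4, expand, smul_smul]
  convert one_smul ℝ v
  field_simp

lemma continuousOn_expand : ContinuousOn (expand s) (Metric.ball 0 s) := by
  intro v hv
  rw [mem_ball_zero_iff] at hv
  apply ContinuousAt.continuousWithinAt
  have h : ContinuousAt (fun v : Model => s - ‖v‖) v := by fun_prop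
  exact (continuousAt_const.div h (by linarith)).smul continuousAt_id

lemma shrink_suspMap (p : ℕ) [Fact p.Prime] (v : Model) :
    shrink s hs (suspMap p v) = suspMap p (shrink s hs v) := by
  have := norm_nonneg v
  rw [shrink_apply, shrink_apply, norm_suspMap, suspMap_smul p (div_nonneg (by linarith) (by linarith))]

/-- Coordinates near an arc of the fixed circle, on the whole model space. -/
def chart (m l r : ℝ) {s : ℝ} (hs : 1 < s) : C(Model, Sphere3) := (tube m l r).comp (shrink s hs)

lemma chart_isOpenEmbedding (hl : 0 < l) (hr : 0 < r) (hls : l * s < Real.pi) (hrs : r * s < 1) :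
    Topology.IsOpenEmbedding (chart m l r hs) := by
  obtain ⟨hU, hc⟩ := isOpen_tubeInv (m := m) hl hr hls hrs
  have key : ∀ v, tubeInv m l r (chart m l r hs v) = shrink s hs v := by
    intro v
    obtain ⟨h1, h2⟩ := mem_ball_iff.1 (shrink_mem_ball hs v)
    refine tubeInv_tube hl hr (lt_trans ((mul_lt_mul_iff_right₀ hl).2 h1) hls)
      (lt_trans ((mul_lt_mul_iff_right₀ hr).2 h2) hrs)
  refine isOpenEmbedding_of_leftInverse (g := expand s ∘ tubeInv m l r) (chart m l r hs).continuous hU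
    (continuousOn_expand.comp hc fun q hq => hq) (fun v => ?_) (fun v => ?_) (fun q hq => ?_)
  · rw [Set.mem_preimage, key]
    exact shrink_mem_ball hs v
  · rw [Function.comp_apply, key, expand_shrink]
  · change tube m l r (shrink s hs (expand s (tubeInv m l r q))) = q
    rw [shrink_expand hs hq, tube_tubeInv hl.ne' hr.ne']

/-- In the sup norm the unit ball is the product of an interval and a disc; midpoint and half-length
of the arc turn the interval into `[a, b]`. -/
lemma image_tube {a b r : ℝ} (hab : a < b) (hr : 0 < r) (hr1 : r < 1) :
    tube ((a + b) / 2) ((b - a) / 2) r '' Metric.closedBall 0 1 = tubeBall a b r := by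
  ext q
  constructor
  · rintro ⟨v, hv, rfl⟩
    rw [mem_closedBall_zero_iff, Prod.norm_def, max_le_iff, Real.norm_eq_abs] at hv
    obtain ⟨h1, h2⟩ := hv
    have h3 : r * ‖v.2‖ ≤ r := by nlinarith
    refine ⟨?_, (a + b) / 2 + (b - a) / 2 * v.1, ?_, ?_⟩
    · rw [tube_snd hr.le (h3.trans hr1.le), norm_mul, norm_real, Real.norm_of_nonneg hr.le]
      exact h3
    · obtain ⟨h4, h5⟩ := abs_le.1 h1
      constructor <;> nlinarith
    · change ((√(1 - ‖clamp (r * v.2)‖ ^ 2) : ℝ) : ℂ) * exp _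
        = ((‖((√(1 - ‖clamp (r * v.2)‖ ^ 2) : ℝ) : ℂ) * exp _‖ : ℝ) : ℂ) * _
      rw [norm_sqrt_mul_exp]
  · rintro ⟨h1, θ, ⟨h2, h3⟩, h4⟩
    have hl : 0 < (b - a) / 2 := by linarith
    refine ⟨(((b - a) / 2)⁻¹ * (θ - (a + b) / 2), ((r⁻¹ : ℝ) : ℂ) * q.1.2), ?_, ?_⟩
    · rw [mem_closedBall_zero_iff, Prod.norm_def, max_le_iff, Real.norm_eq_abs, abs_mul,
        abs_of_pos (inv_pos.2 hl), inv_mul_le_iff₀ hl, abs_le, norm_mul, norm_real,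
        Real.norm_of_nonneg (inv_pos.2 hr).le, inv_mul_le_iff₀ hr]
      exact ⟨⟨by linarith, by linarith⟩, by linarith⟩
    · have e2 : (r : ℂ) * (((r⁻¹ : ℝ) : ℂ) * q.1.2) = q.1.2 := by
        rw [ofReal_inv, mul_inv_cancel_left₀ (by exact_mod_cast hr.ne')]
      apply Subtype.ext
      apply Prod.ext
      · change ((√(1 - ‖clamp (r * (((r⁻¹ : ℝ) : ℂ) * q.1.2))‖ ^ 2) : ℝ) : ℂ)
          * exp ((((a + b) / 2 + (b - a) / 2 * (((b - a) / 2)⁻¹ * (θ - (a + b) / 2)) : ℝ) : ℂ) * I)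
            = q.1.1
        rw [e2, clamp_of_norm_le (norm_snd_le q), sqrt_one_sub, mul_inv_cancel_left₀ hl.ne',
          add_sub_cancel, ← h4]
      · change clamp (r * (((r⁻¹ : ℝ) : ℂ) * q.1.2)) = _
        rw [e2, clamp_of_norm_le (norm_snd_le q)]

end SphereChart

end

/-! ### The winding map as orbit map, and coordinates around the five balls -/

noncomputable section

open SingChain PowerMap

section Rotation

variable (p : ℕ) [hp : Fact p.Prime]

/-- The map of the sphere which winds the second coordinate `p` times. -/
def rotPow : C(Sphere3, Sphere3) where
  toFun q := ⟨(q.1.1, powMap p q.1.2), by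
    change ‖q.1.1‖ ^ 2 + ‖powFun p q.1.2‖ ^ 2 = 1
    rw [norm_powFun hp.out.ne_zero]
    exact q.2⟩
  continuous_toFun := by fun_prop

lemma rotPow_eq_iff {x y : Sphere3} : rotPow p x = rotPow p y ↔
    x.1.1 = y.1.1 ∧ ∃ ζ : ℂ, ζ ^ p = 1 ∧ y.1.2 = ζ * x.1.2 := by
  rw [Subtype.ext_iff, Prod.ext_iff]
  exact and_congr_right fun _ => powFun_eq_iff hp.out.ne_zero

lemma toCircle_pow (k : ZMod p) : ((AddCircle.toCircle (ZMod.toAddCircle k) : Circle) : ℂ) ^ p = 1 := by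
  rw [← Circle.coe_pow, ← AddCircle.toCircle_nsmul, ← map_nsmul]
  simp

lemma exists_toCircle_eq {ζ : ℂ} (hζ : ζ ^ p = 1) :
    ∃ k : ZMod p, (AddCircle.toCircle (ZMod.toAddCircle k) : ℂ) = ζ := by
  have h0 : ζ ≠ 0 := by
    rintro rfl
    rw [zero_pow hp.out.ne_zero] at hζ
    exact zero_ne_one hζ
  obtain ⟨i, -, hi⟩ := (Complex.mem_rootsOfUnity p (Units.mk0 ζ h0)).1
    (by rw [_root_.mem_rootsOfUnity]; ext; simpa using hζ)
  refine ⟨(i : ZMod p), ?_⟩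
  rw [ZMod.toAddCircle_natCast, AddCircle.toCircle_apply_mk, Circle.coe_exp]
  rw [Units.val_mk0] at hi
  rw [← hi]
  congr 1
  push_cast
  ring

/-- Two points have the same power exactly when they differ by a `p`-th root of unity, and these
roots are the elements of `ℤ_p` on the circle. So the winding map is a model of the orbit map. -/
lemma sameOrbit_iff {x y : Sphere3} : SameOrbit p x y ↔ rotPow p x = rotPow p y := by
  rw [rotPow_eq_iff]
  constructor
  · rintro ⟨k, rfl⟩
    exact ⟨rfl, _, toCircle_pow p k, rfl⟩
  · rintro ⟨h1, ζ, hζ, h2⟩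
    obtain ⟨k, hk⟩ := exists_toCircle_eq p hζ
    refine ⟨k, Subtype.ext (Prod.ext h1 ?_)⟩
    rw [h2, ← hk]
    rfl

lemma rotPow_surjective : Function.Surjective (rotPow p) := by
  intro y
  obtain ⟨w, hw⟩ := powFun_surjective p y.1.2
  refine ⟨⟨(y.1.1, w), ?_⟩, Subtype.ext (Prod.ext rfl hw)⟩
  have := y.2
  rwa [← hw, norm_powFun hp.out.ne_zero] at this

lemma rotPow_mem_tubeBall {a b r : ℝ} {q : Sphere3} :
    rotPow p q ∈ tubeBall a b r ↔ q ∈ tubeBall a b r := by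
  refine and_congr ?_ Iff.rfl
  change ‖powFun p q.1.2‖ ≤ r ↔ _
  rw [norm_powFun hp.out.ne_zero]

open SphereChart

lemma clamp_powFun (w : ℂ) : clamp (powFun p w) = powFun p (clamp w) := by
  rw [clamp, clamp, norm_powFun hp.out.ne_zero, Complex.real_smul, Complex.real_smul,
    powFun_smul hp.out.ne_zero (by positivity)]

lemma tube_suspMap {m l r : ℝ} (hr : 0 ≤ r) (v : Model) :
    tube m l r (suspMap p v) = rotPow p (tube m l r v) := by
  have h : clamp (r * powFun p v.2) = powFun p (clamp (r * v.2)) := by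
    rw [← powFun_smul hp.out.ne_zero hr, clamp_powFun]
  apply Subtype.ext
  apply Prod.ext
  · change ((√(1 - ‖clamp (r * powFun p v.2)‖ ^ 2) : ℝ) : ℂ) * _ = _
    rw [h, norm_powFun hp.out.ne_zero]
    rfl
  · exact h

lemma chart_suspMap {m l r s : ℝ} (hr : 0 ≤ r) (hs : 1 < s) (v : Model) :
    chart m l r hs (suspMap p v) = rotPow p (chart m l r hs v) := by
  change tube m l r (shrink s hs _) = _
  rw [shrink_suspMap, tube_suspMap p hr]
  rfl

end Rotation

namespace BallSystem

variable (S : BallSystem)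

/-- The part of the sphere in the interior of a `3`-face. -/
def region (i : Fin 5) : Set Sphere3 := {q | (S.h q : Simplex4) ∈ openFace3 i}

/-- On `∂Δ` some coordinate vanishes, so positivity of all the others already forces the `i`-th to
be zero; the closed condition is redundant. -/
lemma isOpen_region (i : Fin 5) : IsOpen (S.region i) := by
  have : S.region i = ⋂ j : {j : Fin 5 // j ≠ i}, {q : Sphere3 | 0 < (S.h q : Simplex4) j} := by
    ext q
    simp only [Set.mem_iInter, Set.mem_ofPred_eq]
    refine ⟨fun h j => h.2 j j.2, fun h => ⟨?_, fun j hj => h ⟨j, hj⟩⟩⟩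
    obtain ⟨j, hj⟩ := (S.h q).2
    by_cases hji : j = i
    · rw [← hji, hj]
    · exact absurd hj (h ⟨j, hji⟩).ne'
  rw [this]
  refine isOpen_iInter_of_finite fun j => isOpen_lt continuous_const ?_
  have h1 : Continuous fun q => (S.h q : Simplex4) := continuous_subtype_val.comp S.h.continuous
  have h2 : Continuous fun x : Simplex4 => (x : Fin 5 → ℝ) j :=
    (continuous_apply _).comp continuous_subtype_val
  exact h2.comp h1

lemma region_disjoint {i j : Fin 5} {q : Sphere3} (hi : q ∈ S.region i) (hj : q ∈ S.region j) :
    i = j := by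
  by_contra h
  exact (hj.2 i h).ne' hi.1

/-- The ball is compact in an open region, and the bounds on arc length and radius are strict, so
slightly larger coordinates are still available. -/
lemma exists_radius (i : Fin 5) : ∃ s : ℝ, 1 < s ∧ (S.b i - S.a i) / 2 * s < Real.pi ∧ S.r * s < 1 ∧
    SphereChart.tube ((S.a i + S.b i) / 2) ((S.b i - S.a i) / 2) S.r '' Metric.ball 0 s ⊆
      S.region i := by
  have hl : 0 < (S.b i - S.a i) / 2 := by linarith [S.a_lt_b i]
  have hl' : (S.b i - S.a i) / 2 < Real.pi := by linarith [S.b_lt i]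
  let f := SphereChart.tube ((S.a i + S.b i) / 2) ((S.b i - S.a i) / 2) S.r
  have h1 : Metric.closedBall (0 : Model) 1 ⊆ f ⁻¹' S.region i := by
    intro v hv
    refine S.ball_subset i _ ?_
    rw [← SphereChart.image_tube (S.a_lt_b i) S.r_pos S.r_lt_one]
    exact Set.mem_image_of_mem _ hv
  obtain ⟨ε, hε, h2⟩ := (isCompact_closedBall (0 : Model) 1).exists_thickening_subset_open
    ((S.isOpen_region i).preimage f.continuous) h1
  rw [thickening_closedBall hε zero_le_one] at h2
  have h3 : 1 < Real.pi / ((S.b i - S.a i) / 2) := (one_lt_div hl).2 hl'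
  have h4 : 1 < 1 / S.r := (one_lt_div S.r_pos).2 S.r_lt_one
  obtain ⟨s, hs1, hs2⟩ := exists_between (lt_min (lt_min h3 h4) (by linarith : 1 < ε + 1))
  obtain ⟨hs2, hs5⟩ := lt_min_iff.1 hs2
  obtain ⟨hs3, hs4⟩ := lt_min_iff.1 hs2
  refine ⟨s, hs1, ?_, ?_, ?_⟩
  · rwa [lt_div_iff₀ hl, mul_comm] at hs3
  · rwa [lt_div_iff₀ S.r_pos, mul_comm] at hs4
  · exact Set.image_subset_iff.2 ((Metric.ball_subset_ball hs5.le).trans h2)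

/-- The coordinates around the `i`-th ball. -/
def chart (i : Fin 5) : C(Model, Sphere3) :=
  SphereChart.chart ((S.a i + S.b i) / 2) ((S.b i - S.a i) / 2) S.r (S.exists_radius i).choose_spec.1

lemma chart_isOpenEmbedding (i : Fin 5) : Topology.IsOpenEmbedding (S.chart i) :=
  SphereChart.chart_isOpenEmbedding _ (by linarith [S.a_lt_b i]) S.r_pos
    (S.exists_radius i).choose_spec.2.1 (S.exists_radius i).choose_spec.2.2.1

lemma chart_mem_region (i : Fin 5) (v : Model) : S.chart i v ∈ S.region i :=
  (S.exists_radius i).choose_spec.2.2.2 ⟨_, SphereChart.shrink_mem_ball _ v, rfl⟩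

lemma image_chart (i : Fin 5) :
    S.chart i '' Metric.closedBall 0 1 = tubeBall (S.a i) (S.b i) S.r := by
  have hs := (S.exists_radius i).choose_spec.1
  rw [← SphereChart.image_tube (S.a_lt_b i) S.r_pos S.r_lt_one, chart, SphereChart.chart,
    ContinuousMap.coe_comp, Set.image_comp]
  congr 1
  ext v
  constructor
  · rintro ⟨u, hu, rfl⟩
    rw [mem_closedBall_zero_iff] at hu ⊢
    exact (SphereChart.norm_shrink_le_one hs).2 hu
  · intro hv
    rw [mem_closedBall_zero_iff] at hv
    have h := SphereChart.shrink_expand hs (v := v) (by rw [mem_ball_zero_iff]; linarith)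
    refine ⟨_, ?_, h⟩
    rw [mem_closedBall_zero_iff, ← SphereChart.norm_shrink_le_one hs, h]
    exact hv

lemma chart_suspMap (i : Fin 5) (p : ℕ) [Fact p.Prime] (v : Model) :
    S.chart i (suspMap p v) = rotPow p (S.chart i v) :=
  _root_.chart_suspMap p S.r_pos.le _ v

/-- All coordinates together. -/
def charts : C(Fin 5 × Model, Sphere3) where
  toFun x := S.chart x.1 x.2
  continuous_toFun := continuous_prod_of_discrete_left.2 fun i => (S.chart i).continuous

/-- The charts lie in the interiors of different 3-faces, which are disjoint. -/
lemma charts_isOpenEmbedding : Topology.IsOpenEmbedding S.charts := by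
  refine Topology.IsOpenEmbedding.of_continuous_injective_isOpenMap S.charts.continuous ?_ ?_
  · rintro ⟨i, u⟩ ⟨j, v⟩ h
    have h' : S.chart i u = S.chart j v := h
    obtain rfl : i = j := S.region_disjoint (S.chart_mem_region i u) (h' ▸ S.chart_mem_region j v)
    rw [(S.chart_isOpenEmbedding i).injective h']
  · intro U hU
    have : S.charts '' U = ⋃ i, S.chart i '' {v | (i, v) ∈ U} := by
      ext q
      simp only [Set.mem_image, Set.mem_iUnion, Prod.exists]
      rfl
    rw [this]
    exact isOpen_iUnion fun i => (S.chart_isOpenEmbedding i).isOpenMap _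
      (hU.preimage (Continuous.prodMk_right i))

/-- The union of the balls. -/
def balls : Set Sphere3 := ⋃ i, tubeBall (S.a i) (S.b i) S.r

lemma balls_eq : S.balls = S.charts '' {x | ‖x.2‖ ≤ 1} := by
  ext q
  simp only [balls, ← image_chart, Set.mem_iUnion, Set.mem_image, Prod.exists,
    mem_closedBall_zero_iff]
  rfl

lemma isClosed_balls : IsClosed S.balls := by
  refine isClosed_iUnion_of_finite fun i => ?_
  rw [← image_chart]
  exact ((isCompact_closedBall _ _).image (S.chart i).continuous).isClosed

lemma interior_unit : interior {x : Fin 5 × Model | ‖x.2‖ ≤ 1} = {x | ‖x.2‖ < 1} := by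
  have h1 : {x : Fin 5 × Model | ‖x.2‖ ≤ 1} = Set.univ ×ˢ Metric.closedBall 0 1 := by ext; simp
  have h2 : {x : Fin 5 × Model | ‖x.2‖ < 1} = Set.univ ×ˢ Metric.ball 0 1 := by ext; simp
  rw [h1, h2, interior_prod_eq, interior_univ, interior_closedBall _ one_ne_zero]

lemma charts_mem_interior {x : Fin 5 × Model} : S.charts x ∈ interior S.balls ↔ ‖x.2‖ < 1 := by
  rw [← Set.mem_preimage, S.charts_isOpenEmbedding.isOpenMap.preimage_interior_eq_interior_preimage
    S.charts.continuous, balls_eq, Set.preimage_image_eq _ S.charts_isOpenEmbedding.injective,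
    interior_unit]
  rfl

lemma charts_mem_compl {x : Fin 5 × Model} : S.charts x ∈ S.compl ↔ 1 ≤ ‖x.2‖ := by
  rw [← not_lt]
  exact S.charts_mem_interior.not

lemma mem_compl_iff {q : Sphere3} : q ∈ S.compl ↔ q ∉ S.charts '' {x | ‖x.2‖ < 1} := by
  constructor
  · rintro h ⟨x, hx, rfl⟩
    exact (not_lt.2 (S.charts_mem_compl.1 h)) hx
  · intro h h'
    have : q ∈ S.balls := interior_subset h'
    rw [balls_eq] at this
    obtain ⟨x, hx, rfl⟩ := this
    exact h ⟨x, S.charts_mem_interior.1 h', rfl⟩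

lemma isClosed_compl : IsClosed S.compl := isOpen_interior.isClosed_compl

lemma charts_mem_frontier {x : Fin 5 × Model} : S.charts x ∈ frontier S.compl ↔ ‖x.2‖ = 1 := by
  rw [S.isClosed_compl.frontier_eq, Set.mem_sdiff, charts_mem_compl]
  have h : S.charts x ∈ interior S.compl ↔ 1 < ‖x.2‖ := by
    have h1 : {x : Fin 5 × Model | 1 ≤ ‖x.2‖} = Set.univ ×ˢ (Metric.ball 0 1)ᶜ := by ext; simp
    have h2 : {x : Fin 5 × Model | 1 < ‖x.2‖} = Set.univ ×ˢ (Metric.closedBall 0 1)ᶜ := by ext; simp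
    rw [← Set.mem_preimage, S.charts_isOpenEmbedding.isOpenMap.preimage_interior_eq_interior_preimage
      S.charts.continuous]
    have : S.charts ⁻¹' S.compl = {x : Fin 5 × Model | 1 ≤ ‖x.2‖} := by
      ext x
      exact S.charts_mem_compl
    rw [this, h1, interior_prod_eq, interior_univ, interior_compl, closure_ball _ one_ne_zero, ← h2]
    rfl
  rw [h, not_lt]
  exact ⟨fun h => le_antisymm h.2 h.1, fun h => ⟨h.ge, h.le⟩⟩

lemma mem_frontier_iff {q : Sphere3} : q ∈ frontier S.compl ↔
    ∃ x : Fin 5 × Model, ‖x.2‖ = 1 ∧ S.charts x = q := by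
  constructor
  · intro h
    have h1 : q ∈ S.balls := by
      have h2 : frontier S.compl = frontier (interior S.balls) := frontier_compl _
      rw [h2] at h
      exact closure_minimal interior_subset S.isClosed_balls (frontier_subset_closure h)
    rw [balls_eq] at h1
    obtain ⟨x, -, rfl⟩ := h1
    exact ⟨x, S.charts_mem_frontier.1 h, rfl⟩
  · rintro ⟨x, hx, rfl⟩
    exact S.charts_mem_frontier.2 hx

end BallSystem

end

/-! ### Homology of `M` and of its orbit space -/

noncomputable section

open SingChain PowerMap

variable {k : Type} [CommRing k]

/-- The sphere as a sphere in a Euclidean space. -/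
def sphereHomeo : Sphere3 ≃ₜ Metric.sphere (0 : WithLp 2 (ℂ × ℂ)) 1 where
  toFun q := ⟨WithLp.toLp 2 q.1, by
    rw [mem_sphere_zero_iff_norm, ← sq_eq_sq₀ (norm_nonneg _) zero_le_one,
      WithLp.prod_norm_sq_eq_of_L2, one_pow]
    exact q.2⟩
  invFun x := ⟨WithLp.ofLp x.1, by
    have h := mem_sphere_zero_iff_norm.1 x.2
    rw [← sq_eq_sq₀ (norm_nonneg _) zero_le_one, WithLp.prod_norm_sq_eq_of_L2, one_pow] at h
    exact h⟩
  left_inv _ := rfl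
  right_inv _ := rfl
  continuous_toFun := by
    refine Continuous.subtype_mk ?_ _
    exact (WithLp.prod_continuous_toLp 2 ℂ ℂ).comp continuous_subtype_val
  continuous_invFun := by
    refine Continuous.subtype_mk ?_ _
    exact (WithLp.prod_continuous_ofLp 2 ℂ ℂ).comp continuous_subtype_val

/-- Stereographic projection from `c`. -/
lemma acycOn_compl_singleton (c : Sphere3) (n : ℕ) : AcycOn k ({c}ᶜ : Set Sphere3) (n + 1) := by
  have hv : ‖(sphereHomeo c : WithLp 2 (ℂ × ℂ))‖ = 1 := mem_sphere_zero_iff_norm.1 (sphereHomeo c).2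
  let e := stereographic hv
  let f : (↑({c}ᶜ : Set Sphere3)) ≃ₜ e.source :=
    sphereHomeo.subtype fun x => by
      rw [stereographic_source]
      change x ≠ c ↔ sphereHomeo x ≠ _
      rw [not_iff_not]
      exact sphereHomeo.injective.eq_iff.symm
  let g := f.trans e.toHomeomorphSourceTarget
  have ht : e.target = Set.univ := stereographic_target hv
  have : ContractibleSpace (↑({c}ᶜ : Set Sphere3)) :=
    (g.trans ((Homeomorph.setCongr ht).trans (Homeomorph.Set.univ _))).contractibleSpace
  rw [← acycOn_subtype]
  exact acycOn_of_contractible n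

namespace BallSystem

variable (S : BallSystem)

/-- The centers of some of the balls. -/
def centers (F : Finset (Fin 5)) : Set Sphere3 := {q | ∃ i ∈ F, S.chart i 0 = q}

lemma chart_notMem_centers {F : Finset (Fin 5)} {i : Fin 5} (hi : i ∉ F) (v : Model) :
    S.chart i v ∉ S.centers F := by
  rintro ⟨j, hj, h⟩
  exact hi (S.region_disjoint (S.chart_mem_region i v) (h ▸ S.chart_mem_region j 0) ▸ hj)

lemma isClosed_centers (F : Finset (Fin 5)) : IsClosed (S.centers F) := by
  have : S.centers F = (fun i => S.chart i 0) '' F := by ext q; simp [centers]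
  rw [this]
  exact (F.finite_toSet.image _).isClosed

/-- Points are removed one at a time. A cycle off the new point bounds with the point restored;
splitting the bounding chain moves the cycle into a punctured chart, which has no homology in these
degrees. -/
lemma acycOn_compl_centers (F : Finset (Fin 5)) (hF : F.Nonempty) (n : ℕ) :
    AcycOn k (S.centers F)ᶜ (n + 3) := by
  classical
  induction F using Finset.induction_on with
  | empty => exact absurd hF Finset.not_nonempty_empty
  | insert i F hi ih =>
    rcases F.eq_empty_or_nonempty with rfl | hF'
    · have : S.centers (insert i ∅) = {S.chart i 0} := by
        ext q
        simp [centers, eq_comm]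
      rw [this]
      exact acycOn_compl_singleton _ _
    have ih := ih hF'
    have hU : IsOpen (S.centers (insert i F))ᶜ := (S.isClosed_centers _).isOpen_compl
    have hW : IsOpen (Set.range (S.chart i)) := (S.chart_isOpenEmbedding i).isOpen_range
    have hUW : (S.centers (insert i F))ᶜ ∪ Set.range (S.chart i) = (S.centers F)ᶜ := by
      ext q
      constructor
      · rintro (h | ⟨v, rfl⟩)
        · rintro ⟨j, hj, h'⟩
          exact h ⟨j, Finset.mem_insert_of_mem hj, h'⟩
        · exact S.chart_notMem_centers hi v
      · intro h
        by_cases hq : q ∈ Set.range (S.chart i)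
        · exact Or.inr hq
        · refine Or.inl ?_
          rintro ⟨j, hj, h'⟩
          rcases Finset.mem_insert.1 hj with rfl | hj
          · exact hq ⟨0, h'⟩
          · exact h ⟨j, hj, h'⟩
    have hI : (S.centers (insert i F))ᶜ ∩ Set.range (S.chart i) = S.chart i '' {0}ᶜ := by
      ext q
      constructor
      · rintro ⟨h, v, rfl⟩
        refine ⟨v, ?_, rfl⟩
        rintro rfl
        exact h ⟨i, Finset.mem_insert_self _ _, rfl⟩
      · rintro ⟨v, hv, rfl⟩
        refine ⟨?_, v, rfl⟩
        rintro ⟨j, hj, h'⟩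
        rcases Finset.mem_insert.1 hj with rfl | hj
        · exact hv ((S.chart_isOpenEmbedding j).injective h').symm
        · exact S.chart_notMem_centers hi v ⟨j, hj, h'⟩
    intro z hz hc
    have hz' : z ∈ sub k (S.centers F)ᶜ (n + 3) := sub_mono (hUW ▸ Set.subset_union_left) _ hz
    obtain ⟨c, hcm, hcz⟩ := ih z hz' hc
    rw [← hUW] at hcm
    obtain ⟨y, hy, u, hu, -, -, e1, -⟩ := (excisive_of_isOpen hU hW).exists_inter hz
      (Submodule.zero_mem _) hcm (by rw [hcz, sub_zero])
    rw [hI] at hy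
    have hyc : IsCyc y := by
      have : y = z - bd _ u := by rw [e1]; abel
      rw [this]
      change bd (n + 2) _ = 0
      rw [map_sub, bd_bd, sub_zero]
      exact hc
    obtain ⟨w, hw, hw'⟩ := (acycOn_compl_zero (k := k) n).image
      (S.chart_isOpenEmbedding i).isEmbedding y hy hyc
    rw [← hI] at hw
    exact ⟨w + u, Submodule.add_mem _ (sub_mono Set.inter_subset_left _ hw) hu, by
      rw [map_add, hw', ← e1]⟩

/-- Pushing the balls without their centers to the boundary. -/
def pushOut (q : Sphere3) : Sphere3 :=
  open Classical in
  if h : ∃ x : Fin 5 × Model, S.charts x = q then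
    S.charts (h.choose.1, (min 1 ‖h.choose.2‖)⁻¹ • h.choose.2) else q

lemma pushOut_charts (x : Fin 5 × Model) :
    S.pushOut (S.charts x) = S.charts (x.1, (min 1 ‖x.2‖)⁻¹ • x.2) := by
  have h : ∃ y : Fin 5 × Model, S.charts y = S.charts x := ⟨x, rfl⟩
  rw [pushOut, dif_pos h, S.charts_isOpenEmbedding.injective h.choose_spec]

lemma pushOut_of_mem {q : Sphere3} (hq : q ∈ S.compl) : S.pushOut q = q := by
  by_cases h : ∃ x : Fin 5 × Model, S.charts x = q
  · obtain ⟨x, rfl⟩ := h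
    rw [pushOut_charts, min_eq_left (S.charts_mem_compl.1 hq), inv_one, one_smul]
  · rw [pushOut, dif_neg h]

lemma ne_zero_of_charts {x : Fin 5 × Model} (hx : S.charts x ∉ S.centers Finset.univ) : x.2 ≠ 0 := by
  intro h
  exact hx ⟨x.1, Finset.mem_univ _, by rw [← h]; rfl⟩

lemma pushOut_mem {q : Sphere3} (hq : q ∉ S.centers Finset.univ) : S.pushOut q ∈ S.compl := by
  by_cases h : q ∈ S.compl
  · rwa [S.pushOut_of_mem h]
  · rw [mem_compl_iff, not_not] at h
    obtain ⟨x, hx, rfl⟩ := h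
    have h0 := S.ne_zero_of_charts hq
    have hx' : ‖x.2‖ < 1 := hx
    rw [pushOut_charts, charts_mem_compl, norm_smul, min_eq_right hx'.le, norm_inv, norm_norm,
      inv_mul_cancel₀ (norm_ne_zero_iff.2 h0)]

lemma continuousAt_pushOut {q : Sphere3} (hq : q ∉ S.centers Finset.univ) :
    ContinuousAt S.pushOut q := by
  by_cases h : q ∈ S.balls
  · rw [balls_eq] at h
    obtain ⟨x, -, rfl⟩ := h
    rw [← S.charts_isOpenEmbedding.continuousAt_iff]
    have : S.pushOut ∘ S.charts = fun x => S.charts (x.1, (min 1 ‖x.2‖)⁻¹ • x.2) := by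
      ext1 x
      exact S.pushOut_charts x
    rw [this]
    have h0 := S.ne_zero_of_charts hq
    have h1 : ContinuousAt (fun x : Fin 5 × Model => min 1 ‖x.2‖) x := by fun_prop
    have h2 : min 1 ‖x.2‖ ≠ 0 := (lt_min one_pos (norm_pos_iff.2 h0)).ne'
    exact S.charts.continuous.continuousAt.comp
      (continuousAt_fst.prodMk ((h1.inv₀ h2).smul continuousAt_snd))
  · have : S.pushOut =ᶠ[nhds q] id := by
      filter_upwards [S.isClosed_balls.isOpen_compl.mem_nhds h] with y hy
      exact S.pushOut_of_mem fun h' => hy (interior_subset h')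
    exact continuousAt_id.congr this.symm

/-- Pushing the punctured balls radially to their boundaries makes `M` a retract of the sphere
without the five centers. -/
lemma acycOn_M (n : ℕ) : AcycOn k (Set.univ : Set S.M) (n + 3) := by
  have h1 : ∀ q : S.M, (q : Sphere3) ∉ S.centers Finset.univ := by
    rintro q ⟨i, -, h⟩
    refine (S.mem_compl_iff.1 q.2) ⟨(i, 0), ?_, h⟩
    simp
  let i : C(S.M, ↑(S.centers Finset.univ)ᶜ) := ⟨fun q => ⟨q, h1 q⟩, by fun_prop⟩
  let r : C(↑(S.centers Finset.univ)ᶜ, S.M) := ⟨fun q => ⟨S.pushOut q, S.pushOut_mem q.2⟩,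
    (continuous_iff_continuousAt.2 fun q => (S.continuousAt_pushOut q.2).comp
      continuous_subtype_val.continuousAt).subtype_mk _⟩
  refine acycOn_of_retract (i := i) (r := r) ?_ ?_
  · ext1 q
    exact Subtype.ext (S.pushOut_of_mem q.2)
  · rw [acycOn_subtype]
    exact S.acycOn_compl_centers _ Finset.univ_nonempty n

variable (p : ℕ) [hp : Fact p.Prime]

lemma rotPow_mem_balls {q : Sphere3} : rotPow p q ∈ S.balls ↔ q ∈ S.balls := by
  simp only [balls, Set.mem_iUnion, rotPow_mem_tubeBall]

lemma rotPow_mem_compl {q : Sphere3} : rotPow p q ∈ S.compl ↔ q ∈ S.compl := by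
  have h : rotPow p q ∈ interior S.balls ↔ q ∈ interior S.balls := by
    constructor
    · intro h
      refine (isOpen_interior.preimage (rotPow p).continuous).subset_interior_iff.2 ?_ h
      intro x hx
      exact (S.rotPow_mem_balls p).1 (interior_subset hx)
    · intro h
      have h' := interior_subset h
      rw [balls_eq] at h'
      obtain ⟨x, hx, rfl⟩ := h'
      rw [charts_mem_interior] at h
      -- The winding map is not known here to be open, so the interior is tracked in coordinates,
      -- where the map preserves the norm.
      change rotPow p (S.chart x.1 x.2) ∈ _
      rw [← chart_suspMap]
      refine S.charts_mem_interior (x := (x.1, suspMap p x.2)).2 ?_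
      rwa [norm_suspMap]
  exact h.not

/-- The winding map on `M`. -/
def rotPowM : C(S.M, S.M) := ⟨fun q => ⟨rotPow p q, (S.rotPow_mem_compl p).2 q.2⟩, by fun_prop⟩

instance : CompactSpace Sphere3 := sphereHomeo.symm.compactSpace

instance : CompactSpace S.M := isCompact_iff_compactSpace.1 S.isClosed_compl.isCompact

/-- The orbit space `M / ℤ_p` is homeomorphic to `M`. -/
def gammaTopHomeo : S.GammaTop p ≃ₜ S.M :=
  Continuous.homeoOfEquivCompactToT2 (f := Equiv.ofBijective
    (Quot.lift (S.rotPowM p) fun x y h => Subtype.ext ((sameOrbit_iff p).1 h)) (by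
      constructor
      · rintro ⟨x⟩ ⟨y⟩ h
        exact Quot.sound ((sameOrbit_iff p).2 (congrArg Subtype.val h))
      · intro y
        obtain ⟨x, hx⟩ := rotPow_surjective p y
        refine ⟨Quot.mk _ ⟨x, (S.rotPow_mem_compl p).1 (hx ▸ y.2)⟩, Subtype.ext hx⟩))
    (continuous_quot_lift _ (S.rotPowM p).continuous)

lemma acycOn_gammaTop (n : ℕ) : AcycOn k (Set.univ : Set (S.GammaTop p)) (n + 3) :=
  acycOn_of_retract (i := ⟨S.gammaTopHomeo p, (S.gammaTopHomeo p).continuous⟩)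
    (r := ⟨(S.gammaTopHomeo p).symm, (S.gammaTopHomeo p).symm.continuous⟩)
    (by ext1 x; exact (S.gammaTopHomeo p).symm_apply_apply x) (S.acycOn_M n)

end BallSystem

end

noncomputable section

open SingChain

/-! ### Collars -/

/-- The subset `C` of `B` is a deformation retract of a relative neighbourhood in `B`. -/
def HasCollar {X : Type} [TopologicalSpace X] (B C : Set X) : Prop :=
  ∃ O : Set X, IsOpen O ∧ C ⊆ O ∧ ∃ H : C(unitInterval × ↥(O ∩ B), ↥(O ∩ B)),
    (∀ x, H (0, x) = x) ∧ (∀ x, (H (1, x) : X) ∈ C) ∧ ∀ t (x : ↥(O ∩ B)), (x : X) ∈ C → H (t, x) = x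

lemma HasCollar.excisive {X : Type} [TopologicalSpace X] {A B C : Set X} (h : HasCollar B C)
    {k : Type} [CommRing k] (hA : IsClosed A) (hB : IsClosed B) (hC : A ∩ B = C) :
    Excisive k A B := by
  obtain ⟨O, hO, hCO, H, H0, H1, HC⟩ := h
  refine excisive_of_collar (O := O) rfl hA hB hO (hC ▸ hCO) H H0 (fun x => ?_) (fun t x hx => ?_)
  · have := H1 x
    rw [← hC] at this
    exact this.1
  · exact HC t x (hC ▸ ⟨hx, x.2.2⟩)

lemma HasCollar.of_embedding {X P : Type} [TopologicalSpace X] [TopologicalSpace P] {B C O : Set X}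
    (hO : IsOpen O) (hCO : C ⊆ O) {e : P → X} (he : Topology.IsEmbedding e)
    (hr : Set.range e = O ∩ B) (H : C(unitInterval × P, P)) (H0 : ∀ x, H (0, x) = x)
    (H1 : ∀ x, e (H (1, x)) ∈ C) (HC : ∀ t x, e x ∈ C → H (t, x) = x) : HasCollar B C := by
  let f : P ≃ₜ ↥(O ∩ B) := he.toHomeomorph.trans (Homeomorph.setCongr hr)
  have hf : ∀ x, (f x : X) = e x := fun x => rfl
  refine ⟨O, hO, hCO, ⟨fun q => f (H (q.1, f.symm q.2)), by fun_prop⟩, fun x => ?_, fun x => ?_,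
    fun t x hx => ?_⟩
  · simp [H0]
  · exact H1 _
  · have : e (f.symm x) ∈ C := by rw [← hf, f.apply_symm_apply]; exact hx
    simp [HC t _ this]

/-! ### The radial collar of the boundary of a simplex -/

section Radial

variable {V : Type} [Fintype V]

lemma continuous_coord {V : Type} [Fintype V] (v : V) : Continuous fun x : stdSimplex ℝ V => x v :=
  (continuous_apply v).comp continuous_subtype_val

/-- The smallest of the coordinates in `s`. -/
def minCoord (s : Finset V) (hs : s.Nonempty) (x : stdSimplex ℝ V) : ℝ := s.inf' hs fun v => x v

lemma continuous_minCoord (s : Finset V) (hs : s.Nonempty) : Continuous (minCoord s hs) :=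
  Continuous.finset_inf'_apply hs fun v _ => continuous_coord v

variable {s : Finset V} {hs : s.Nonempty}

lemma minCoord_le {v : V} (hv : v ∈ s) (x : stdSimplex ℝ V) : minCoord s hs x ≤ x v :=
  Finset.inf'_le _ hv

lemma minCoord_nonneg (x : stdSimplex ℝ V) : 0 ≤ minCoord s hs x :=
  Finset.le_inf' _ _ fun v _ => x.2.1 v

lemma exists_minCoord (x : stdSimplex ℝ V) : ∃ v ∈ s, minCoord s hs x = x v :=
  Finset.exists_mem_eq_inf' hs _

lemma minCoord_eq_zero_iff {x : stdSimplex ℝ V} : minCoord s hs x = 0 ↔ ∃ v ∈ s, x v = 0 := by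
  constructor
  · intro h
    obtain ⟨v, hv, e⟩ := exists_minCoord (hs := hs) x
    exact ⟨v, hv, e ▸ h⟩
  · rintro ⟨v, hv, h⟩
    exact le_antisymm (h ▸ minCoord_le hv x) (minCoord_nonneg x)

/-- A neighbourhood of the boundary in the simplex spanned by `s`. -/
abbrev Rim (s : Finset V) (hs : s.Nonempty) (ε : ℝ) : Type :=
  {x : stdSimplex ℝ V // (∀ v, v ∉ s → x v = 0) ∧ s.card * minCoord s hs x < ε}

open Classical in
/-- The formula for the push from the barycenter. -/
def rimFun (s : Finset V) (hs : s.Nonempty) (t : ℝ) (x : stdSimplex ℝ V) (v : V) : ℝ :=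
  if v ∈ s then (x v - t * minCoord s hs x) / (1 - t * (s.card * minCoord s hs x)) else 0

variable {ε : ℝ}

/-- The number of vertices times the least coordinate is at most 1, with equality only at the
barycenter, which the rim avoids. -/
lemma rim_pos (hε : ε ≤ 1) (t : unitInterval) (x : Rim s hs ε) :
    0 < 1 - (t : ℝ) * (s.card * minCoord s hs x.1) := by
  have h1 := t.2.1
  have h2 := t.2.2
  have h3 := x.2.2
  have h4 : 0 ≤ s.card * minCoord s hs x.1 := mul_nonneg (by positivity) (minCoord_nonneg _)
  nlinarith

lemma sum_of_support {x : stdSimplex ℝ V} (hx : ∀ v, v ∉ s → x v = 0) : ∑ v ∈ s, x v = 1 := by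
  rw [← x.2.2]
  exact Finset.sum_subset (Finset.subset_univ s) fun v _ hv => hx v hv

lemma rimFun_mem (hε : ε ≤ 1) (t : unitInterval) (x : Rim s hs ε) : rimFun s hs t x.1 ∈ stdSimplex ℝ V := by
  have hp := rim_pos hε t x
  constructor
  · intro v
    rw [rimFun]
    split_ifs with hv
    · refine div_nonneg ?_ hp.le
      have h1 := minCoord_le (hs := hs) hv x.1
      have h2 := minCoord_nonneg (hs := hs) x.1
      nlinarith [t.2.1, t.2.2]
    · exact le_rfl
  · classical
    simp only [rimFun]
    rw [Finset.sum_ite_mem, Finset.univ_inter, ← Finset.sum_div, Finset.sum_sub_distrib,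
      sum_of_support x.2.1, Finset.sum_const, nsmul_eq_mul, div_eq_one_iff_eq hp.ne']
    ring

lemma minCoord_rimFun (hε : ε ≤ 1) (t : unitInterval) (x : Rim s hs ε) :
    minCoord s hs ⟨rimFun s hs t x.1, rimFun_mem hε t x⟩ =
      (1 - t) * minCoord s hs x.1 / (1 - t * (s.card * minCoord s hs x.1)) := by
  have hp := rim_pos hε t x
  have hval : ∀ v ∈ s, rimFun s hs t x.1 v =
    (x.1 v - t * minCoord s hs x.1) / (1 - t * (s.card * minCoord s hs x.1)) :=
    fun v hv => if_pos hv
  apply le_antisymm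
  · obtain ⟨v, hv, e⟩ := exists_minCoord (hs := hs) x.1
    refine (minCoord_le hv _).trans_eq ((hval v hv).trans ?_)
    rw [← e]
    ring
  · refine Finset.le_inf' _ _ fun v hv => ?_
    change _ ≤ rimFun s hs t x.1 v
    rw [hval v hv, div_le_div_iff_of_pos_right hp]
    have := minCoord_le (hs := hs) hv x.1
    linarith

lemma minCoord_rimFun_le (hε : ε ≤ 1) (t : unitInterval) (x : Rim s hs ε) :
    minCoord s hs ⟨rimFun s hs t x.1, rimFun_mem hε t x⟩ ≤ minCoord s hs x.1 := by
  have hp := rim_pos hε t x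
  rw [minCoord_rimFun hε, div_le_iff₀ hp]
  have h0 := minCoord_nonneg (hs := hs) x.1
  have h1 : s.card * minCoord s hs x.1 ≤ 1 := x.2.2.le.trans hε
  have h2 : (t : ℝ) * (s.card * minCoord s hs x.1) ≤ t := mul_le_of_le_one_right t.2.1 h1
  rw [mul_comm (1 - (t : ℝ))]
  exact mul_le_mul_of_nonneg_left (by linarith) h0

/-- The push from the barycenter. -/
def rimPush (hε : ε ≤ 1) : C(unitInterval × Rim s hs ε, Rim s hs ε) where
  toFun q := ⟨⟨rimFun s hs q.1 q.2.1, rimFun_mem hε q.1 q.2⟩, fun _ hv => if_neg hv,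
    lt_of_le_of_lt (mul_le_mul_of_nonneg_left (minCoord_rimFun_le hε q.1 q.2) (by positivity)) q.2.2.2⟩
  continuous_toFun := by
    refine Continuous.subtype_mk (Continuous.subtype_mk (continuous_pi fun v => ?_) _) _
    by_cases hv : v ∈ s
    · simp only [rimFun, if_pos hv]
      have h1 : Continuous fun q : unitInterval × Rim s hs ε => minCoord s hs q.2.1 :=
        (continuous_minCoord s hs).comp (continuous_subtype_val.comp continuous_snd)
      have h2 : Continuous fun q : unitInterval × Rim s hs ε => q.2.1 v :=
        (continuous_coord v).comp (continuous_subtype_val.comp continuous_snd)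
      have h3 : Continuous fun q : unitInterval × Rim s hs ε => (q.1 : ℝ) :=
        continuous_subtype_val.comp continuous_fst
      exact (h2.sub (h3.mul h1)).div (continuous_const.sub (h3.mul (continuous_const.mul h1)))
        fun q => (rim_pos hε q.1 q.2).ne'
    · simp only [rimFun, if_neg hv]
      exact continuous_const

lemma rimPush_of_mul_eq_zero (hε : ε ≤ 1) {t : unitInterval} {x : Rim s hs ε} (h : t * minCoord s hs x.1 = 0) :
    rimPush hε (t, x) = x := by
  apply Subtype.ext
  apply Subtype.ext
  ext v
  change rimFun s hs t x.1 v = x.1 v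
  have h' : (t : ℝ) * (s.card * minCoord s hs x.1) = 0 := by rw [mul_left_comm, h, mul_zero]
  rw [rimFun, h', h, sub_zero, sub_zero, div_one]
  split_ifs with hv
  · rfl
  · exact (x.2.1 v hv).symm

lemma rimPush_zero (hε : ε ≤ 1) (x : Rim s hs ε) : rimPush hε (0, x) = x :=
  rimPush_of_mul_eq_zero hε (by simp)

lemma rimPush_of_exists (hε : ε ≤ 1) (t : unitInterval) {x : Rim s hs ε} (h : ∃ v ∈ s, x.1 v = 0) :
    rimPush hε (t, x) = x :=
  rimPush_of_mul_eq_zero hε (by rw [minCoord_eq_zero_iff.2 h, mul_zero])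

lemma rimPush_one (hε : ε ≤ 1) (x : Rim s hs ε) : ∃ v ∈ s, (rimPush hε (1, x)).1 v = 0 := by
  refine minCoord_eq_zero_iff.1 ((minCoord_rimFun hε 1 x).trans ?_)
  simp

end Radial

/-! ### Mapping cylinders -/

namespace MapCyl

variable {X Y : Type} [TopologicalSpace X] [TopologicalSpace Y] (f : C(X, Y))

/-- The projection of the mapping cylinder. -/
def proj : C(MapCyl f, Y) where
  toFun := Quot.lift (Sum.elim (fun q => f q.1) id) (by rintro _ _ ⟨x⟩; rfl)
  continuous_toFun := continuous_quot_lift _ (by fun_prop)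

/-- The inclusion of the top. -/
def topMap : C(MapCyl f, MapCyl f) where
  toFun z := top f (proj f z)
  continuous_toFun := continuous_quot_mk.comp (continuous_inr.comp (proj f).continuous)

/-- The height function. -/
def height : C(MapCyl f, unitInterval) where
  toFun := Quot.lift (Sum.elim (fun q => q.2) fun _ => 1) (by rintro _ _ ⟨x⟩; rfl)
  continuous_toFun := continuous_quot_lift _ (by fun_prop)

lemma continuous_pt : Continuous fun q : X × unitInterval => pt f q.1 q.2 :=
  continuous_quot_mk.comp continuous_inl

lemma pt_one (x : X) : pt f x 1 = top f (f x) := Quot.sound (MapCylRel.glue x)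

lemma exists_rep (z : MapCyl f) : (∃ x t, t < 1 ∧ pt f x t = z) ∨ ∃ y, top f y = z := by
  obtain ⟨(⟨x, t⟩ | y), rfl⟩ := Quot.exists_rep z
  · rcases lt_or_eq_of_le (unitInterval.le_one' (t := t)) with h | rfl
    · exact Or.inl ⟨x, t, h, rfl⟩
    · exact Or.inr ⟨f x, (pt_one f x).symm⟩
  · exact Or.inr ⟨y, rfl⟩

lemma pt_injective {x x' : X} {t t' : unitInterval} (ht : t < 1) (h : pt f x t = pt f x' t') :
    x = x' ∧ t = t' := by
  classical
  -- This function forgets exactly the glued part, so it is well defined on the quotient and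
  -- separates the points below the top.
  let g : MapCyl f → Option (X × unitInterval) :=
    Quot.lift (Sum.elim (fun q => if q.2 < 1 then some q else none) fun _ => none)
      (by rintro _ _ ⟨x⟩; simp)
  have h' : g (pt f x t) = g (pt f x' t') := congrArg g h
  change (if t < 1 then some (x, t) else none) = if t' < 1 then some (x', t') else none at h'
  rw [if_pos ht] at h'
  split_ifs at h' with h1
  simpa using h'

/-- The part of the mapping cylinder below the top. -/
def ptLow : C(X × {t : unitInterval // t < 1}, MapCyl f) where
  toFun q := pt f q.1 q.2
  continuous_toFun := (continuous_pt f).comp (by fun_prop : Continuous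
    fun q : X × {t : unitInterval // t < 1} => (q.1, (q.2 : unitInterval)))

lemma range_ptLow : Set.range (ptLow f) = {z | height f z < 1} := by
  ext z
  constructor
  · rintro ⟨⟨x, t⟩, rfl⟩
    exact t.2
  · intro h
    rcases exists_rep f z with ⟨x, t, ht, rfl⟩ | ⟨y, rfl⟩
    · exact ⟨(x, ⟨t, ht⟩), rfl⟩
    · exact absurd (show (1 : unitInterval) < 1 from h) (lt_irrefl _)

lemma ptLow_isOpenEmbedding : Topology.IsOpenEmbedding (ptLow f) := by
  refine Topology.IsOpenEmbedding.of_continuous_injective_isOpenMap (ptLow f).continuous ?_ ?_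
  · rintro ⟨x, t⟩ ⟨x', t'⟩ h
    obtain ⟨rfl, h⟩ := pt_injective f t.2 h
    rw [Subtype.ext h]
  · intro U hU
    have hj : IsOpenMap fun q : X × {t : unitInterval // t < 1} => (q.1, (q.2 : unitInterval)) :=
      IsOpenMap.id.prodMap (isOpen_Iio (a := (1 : unitInterval))).isOpenEmbedding_subtypeVal.isOpenMap
    have : IsOpen (Quot.mk (MapCylRel f) ⁻¹' (ptLow f '' U)) := by
      convert (isOpenMap_inl (Y := Y)).comp hj _ hU using 1
      ext z
      constructor
      · rintro ⟨⟨x, t⟩, hxt, h⟩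
        rcases z with ⟨x', t'⟩ | y
        · obtain ⟨rfl, rfl⟩ := pt_injective f t.2 h
          exact ⟨(x, t), hxt, rfl⟩
        · have h1 : height f (ptLow f (x, t)) = 1 := congrArg (height f) h
          exact absurd (t.2.trans_eq h1.symm) (lt_irrefl _)
      · rintro ⟨q, hq, rfl⟩
        exact ⟨q, hq, rfl⟩
    exact this

/-- Points are raised by taking the maximum of height and time. As with the surgery, the homotopy is
descended to the quotient as a map into paths. -/
lemma topMap_homotopic : (topMap f).Homotopic (.id _) := by
  let F : C(X × unitInterval, C(unitInterval, MapCyl f)) :=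
    ContinuousMap.curry ⟨fun q => pt f q.1.1 (max q.1.2 q.2),
      (continuous_pt f).comp (by fun_prop : Continuous
        fun q : (X × unitInterval) × unitInterval => (q.1.1, max q.1.2 q.2))⟩
  let G : C(Y, C(unitInterval, MapCyl f)) :=
    ContinuousMap.curry ⟨fun q => top f q.1, continuous_quot_mk.comp (by fun_prop)⟩
  let H : C(MapCyl f, C(unitInterval, MapCyl f)) :=
    ⟨Quot.lift (Sum.elim F G) (by
      rintro _ _ ⟨x⟩
      ext t
      change pt f x (max 1 t) = top f (f x)
      rw [max_eq_left unitInterval.le_one', pt_one]),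
      continuous_quot_lift _ (F.continuous.sumElim G.continuous)⟩
  refine ContinuousMap.Homotopic.symm ⟨⟨⟨fun q => H q.2 q.1, ?_⟩, ?_, ?_⟩⟩
  · exact (ContinuousMap.continuous_uncurry_of_continuous H).comp continuous_swap
  · intro z
    obtain ⟨(⟨x, t⟩ | y), rfl⟩ := Quot.exists_rep z
    · change pt f x (max t 0) = pt f x t
      rw [max_eq_left unitInterval.nonneg']
    · rfl
  · intro z
    obtain ⟨(⟨x, t⟩ | y), rfl⟩ := Quot.exists_rep z
    · change pt f x (max t 1) = top f (f x)
      rw [max_eq_right unitInterval.le_one', pt_one]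
    · rfl

lemma acycOn_univ {k : Type} [CommRing k] {n : ℕ} (h : AcycOn k (Set.univ : Set Y) n) :
    AcycOn k (Set.univ : Set (MapCyl f)) n :=
  AcycOn.of_homotopic (i := proj f)
    (r := ⟨top f, continuous_quot_mk.comp continuous_inr⟩) (topMap_homotopic f) h

/-- Below the top the cylinder is a product, and at time `s` the height is multiplied by `1 - s`. -/
lemma hasCollar_bot : HasCollar (Set.univ : Set (MapCyl f)) {z | height f z = 0} := by
  let m : C(unitInterval × {t : unitInterval // t < 1}, {t : unitInterval // t < 1}) :=
    ⟨fun q => ⟨unitInterval.symm q.1 * q.2, lt_of_le_of_lt unitInterval.mul_le_right q.2.2⟩,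
      by fun_prop⟩
  refine HasCollar.of_embedding (O := {z | height f z < 1}) (e := ptLow f)
    (isOpen_lt (height f).continuous continuous_const) (fun z hz => ?_)
    (ptLow_isOpenEmbedding f).isEmbedding (by rw [range_ptLow, Set.inter_univ])
    ⟨fun q => (q.2.1, m (q.1, q.2.2)), by fun_prop⟩ ?_ ?_ ?_
  · change height f z < 1
    rw [show height f z = 0 from hz]
    exact zero_lt_one
  · rintro ⟨x, t⟩
    simp [m]
  · rintro ⟨x, t⟩
    change unitInterval.symm 1 * (t : unitInterval) = 0
    simp
  · rintro t ⟨x, u⟩ h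
    have h' : (u : unitInterval) = 0 := h
    simp only [ContinuousMap.coe_mk, m, Prod.mk.injEq, true_and]
    apply Subtype.ext
    simp [h']

end MapCyl

end

/-! ### Inverse images of faces under `δ` -/

noncomputable section

open SingChain PowerMap

/-- The properties of `δ : G → Δ` which control the homology of pull-backs along `δ`. -/
structure FiberData (k : Type) [CommRing k] {G : Type} [TopologicalSpace G] (δ : C(G, Simplex4)) :
    Prop where
  exists_section : ∃ t : C(skel2, G), (∀ y, δ (t y) = y) ∧ ∀ g (hg : δ g ∈ skel2), t ⟨δ g, hg⟩ = g
  collar_face : ∀ i, HasCollar (δ ⁻¹' face3 i) (δ ⁻¹' bdryFace3 i)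
  collar_univ : HasCollar Set.univ (δ ⁻¹' bdrySimplex4)
  acycOn_face : ∀ i n, AcycOn k (δ ⁻¹' face3 i) (n + 3)
  kills_face : ∀ i, ∀ z ∈ sub k (δ ⁻¹' bdryFace3 i) 2, bd 1 z = 0 →
    ∃ c ∈ sub k (δ ⁻¹' face3 i) 3, bd 2 c = z
  acycOn_univ : ∀ n, AcycOn k (Set.univ : Set G) (n + 3)

lemma bdryFace3_subset_skel2 (i : Fin 5) : bdryFace3 i ⊆ skel2 := by
  rintro x ⟨hi, j, hj, h⟩
  exact ⟨i, j, hj.symm, hi, h⟩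

lemma skel2_subset_bdry : skel2 ⊆ bdrySimplex4 := by
  rintro x ⟨i, j, -, hi, -⟩
  exact ⟨i, hi⟩

lemma barycenter_apply (i : Fin 5) : (stdSimplex.barycenter : Simplex4) i = 1 / 5 := by
  change (Fintype.card (Fin 5) : ℝ)⁻¹ = 1 / 5
  simp

lemma isClosed_face3 (i : Fin 5) : IsClosed (face3 i) :=
  isClosed_eq (continuous_coord i) continuous_const

namespace BallSystem

variable (S : BallSystem)

lemma mem_frontier_iff_balls {q : Sphere3} : q ∈ frontier S.compl ↔ q ∈ S.balls ∧ q ∈ S.compl := by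
  constructor
  · rw [mem_frontier_iff]
    rintro ⟨x, hx, rfl⟩
    exact ⟨S.balls_eq ▸ ⟨x, hx.le, rfl⟩, S.charts_mem_compl.2 hx.ge⟩
  · rintro ⟨h1, h2⟩
    rw [balls_eq] at h1
    obtain ⟨x, hx, rfl⟩ := h1
    exact S.charts_mem_frontier.2 (le_antisymm hx (S.charts_mem_compl.1 h2))

lemma notMem_balls_of_skel2 {q : Sphere3} (hq : (S.h q : Simplex4) ∈ skel2) : q ∉ S.balls := by
  intro h
  obtain ⟨i, hi⟩ := Set.mem_iUnion.1 h
  have h' := S.ball_subset i q hi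
  obtain ⟨j, l, hjl, hj, hl⟩ := hq
  by_cases hji : j = i
  · exact (h'.2 l (fun e => hjl (hji.trans e.symm))).ne' hl
  · exact (h'.2 j hji).ne' hj

lemma mem_compl_of_notMem_balls {q : Sphere3} (hq : q ∉ S.balls) : q ∈ S.compl :=
  fun h => hq (interior_subset h)

lemma continuous_h : Continuous fun q => (S.h q : Simplex4) :=
  continuous_subtype_val.comp S.h.continuous

variable (p : ℕ) [hp : Fact p.Prime]

lemma rotPow_mem_frontier {q : Sphere3} : rotPow p q ∈ frontier S.compl ↔ q ∈ frontier S.compl := by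
  rw [mem_frontier_iff_balls, mem_frontier_iff_balls, rotPow_mem_balls, rotPow_mem_compl]

/-- Together with equality the collapsing relation is already an equivalence relation, because the
winding map preserves the frontier and its complement. -/
lemma mu_eq_iff {x y : S.M} : S.mu p x = S.mu p y ↔
    x = y ∨ (x : Sphere3) ∈ frontier S.compl ∧ rotPow p x = rotPow p y := by
  have hE : Equivalence fun x y : S.M => x = y ∨ (x : Sphere3) ∈ frontier S.compl ∧
      rotPow p x = rotPow p y := by
    refine ⟨fun x => Or.inl rfl, ?_, ?_⟩
    · rintro x y (h | ⟨h1, h2⟩)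
      · exact Or.inl h.symm
      · refine Or.inr ⟨?_, h2.symm⟩
        rwa [← S.rotPow_mem_frontier p, ← h2, S.rotPow_mem_frontier p]
    · rintro x y z (rfl | ⟨h1, h2⟩) (rfl | ⟨h3, h4⟩)
      · exact Or.inl rfl
      · exact Or.inr ⟨h3, h4⟩
      · exact Or.inr ⟨h1, h2⟩
      · exact Or.inr ⟨h1, h2.trans h4⟩
  constructor
  · intro h
    rw [← hE.eqvGen_iff]
    refine Relation.EqvGen.mono (fun a b hab => ?_) _ _ (Quot.eqvGen_exact h)
    exact Or.inr ⟨hab.1, (sameOrbit_iff p).1 hab.2⟩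
  · rintro (rfl | ⟨h1, h2⟩)
    · rfl
    · exact Quot.sound ⟨h1, (sameOrbit_iff p).2 h2⟩

/-- The map `M → Γ` onto the bottom of the mapping cylinder. -/
def bmu : C(S.M, S.Gamma p) where
  toFun x := MapCyl.pt (S.alpha p) (S.mu p x) 0
  continuous_toFun := continuous_quot_mk.comp (continuous_inl.comp
    (continuous_quot_mk.prodMk continuous_const))

/-- The natural map as a continuous map. -/
def alphaMap : C(S.GammaBot p, S.GammaTop p) where
  toFun := S.alpha p
  continuous_toFun := continuous_quot_lift _ continuous_quot_mk

lemma bmu_eq_iff {x y : S.M} : S.bmu p x = S.bmu p y ↔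
    x = y ∨ (x : Sphere3) ∈ frontier S.compl ∧ rotPow p x = rotPow p y := by
  rw [← mu_eq_iff]
  refine ⟨fun h => (MapCyl.pt_injective (S.alphaMap p) zero_lt_one h).1, fun h => ?_⟩
  exact congrArg (fun z => MapCyl.pt (S.alpha p) z 0) h

lemma bmu_inj {x y : S.M} (hx : (x : Sphere3) ∉ S.balls) (h : S.bmu p x = S.bmu p y) : x = y := by
  rcases (S.bmu_eq_iff p).1 h with h | ⟨h, -⟩
  · exact h
  · exact absurd (S.mem_frontier_iff_balls.1 h).1 hx

/-- The saturation of `C` is `C` together with the inverse image, under the winding map, of the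
compact image of its frontier part. -/
lemma isClosedMap_mu : IsClosedMap (S.mu p) := by
  intro C hC
  let fr : Set S.M := {x | (x : Sphere3) ∈ frontier S.compl}
  have hfr : IsClosed fr := isClosed_frontier.preimage continuous_subtype_val
  have h1 : IsClosed (S.rotPowM p ⁻¹' (S.rotPowM p '' (C ∩ fr))) :=
    (((hC.inter hfr).isCompact.image (S.rotPowM p).continuous).isClosed).preimage
      (S.rotPowM p).continuous
  have : IsClosed (S.mu p ⁻¹' (S.mu p '' C)) := by
    convert hC.union h1 using 1
    ext y
    constructor
    · rintro ⟨x, hx, h⟩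
      rcases (S.mu_eq_iff p).1 h with rfl | ⟨h2, h3⟩
      · exact Or.inl hx
      · exact Or.inr ⟨x, ⟨hx, h2⟩, Subtype.ext h3⟩
    · rintro (h | ⟨x, ⟨hx, hxf⟩, h⟩)
      · exact ⟨y, h, rfl⟩
      · exact ⟨x, hx, (S.mu_eq_iff p).2 (Or.inr ⟨hxf, congrArg Subtype.val h⟩)⟩
  exact isQuotientMap_quot_mk.isClosed_preimage.1 this

lemma isClosedMap_bmu : IsClosedMap (S.bmu p) := by
  intro C hC
  have h1 : IsClosed ((S.mu p '' C) ×ˢ ({0} : Set unitInterval)) :=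
    (S.isClosedMap_mu p C hC).prod isClosed_singleton
  refine isQuotientMap_quot_mk.isClosed_preimage.1 (isClosed_sum_iff.2 ⟨?_, ?_⟩)
  · convert h1 using 1
    ext ⟨x, t⟩
    constructor
    · rintro ⟨m, hm, h⟩
      obtain ⟨h2, h3⟩ := MapCyl.pt_injective (S.alphaMap p) zero_lt_one h
      exact ⟨⟨m, hm, h2⟩, h3.symm⟩
    · rintro ⟨⟨m, hm, h2⟩, h3⟩
      refine ⟨m, hm, ?_⟩
      change MapCyl.pt (S.alpha p) (S.mu p m) 0 = MapCyl.pt (S.alpha p) x t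
      rw [show S.mu p m = x from h2, show t = 0 from h3]
  · convert isClosed_empty
    rw [Set.eq_empty_iff_forall_notMem]
    rintro y ⟨m, -, h⟩
    have : (0 : unitInterval) = 1 := congrArg (MapCyl.height (S.alphaMap p)) h
    exact zero_ne_one this

end BallSystem

namespace BallSystem.IsDelta

variable {S : BallSystem} {p : ℕ} [hp : Fact p.Prime] {δ : S.Gamma p → Simplex4}

lemma bmu_of_skel2 (hδ : S.IsDelta p δ) (x : S.M) (hx : (S.h x : Simplex4) ∈ skel2) :
    δ (S.bmu p x) = S.h x :=
  hδ.skel2_eq x hx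

lemma eq_bmu_of_mem_bdry (hδ : S.IsDelta p δ) {g : S.Gamma p} (hg : δ g ∈ bdrySimplex4) :
    ∃ x, S.bmu p x = g := by
  obtain ⟨i, hi⟩ := hg
  rcases MapCyl.exists_rep (S.alphaMap p) g with ⟨x, t, ht, rfl⟩ | ⟨y, rfl⟩
  · have h1 : δ (MapCyl.pt (S.alpha p) x t) i = 0 := hi
    rw [hδ.linear] at h1
    have h2 : 0 ≤ (1 - (t : ℝ)) * δ (MapCyl.pt (S.alpha p) x 0) i :=
      mul_nonneg (sub_nonneg.2 t.2.2) ((δ (MapCyl.pt (S.alpha p) x 0)).2.1 i)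
    rw [barycenter_apply] at h1
    -- All barycentric coordinates of the barycenter are positive, so on an interval of the cylinder
    -- a coordinate can vanish only at the lower end.
    have h3 : (t : ℝ) ≤ 0 := by linarith
    have h4 : t = 0 := Subtype.ext (le_antisymm h3 t.2.1)
    obtain ⟨m, rfl⟩ := Quot.exists_rep x
    exact ⟨m, by rw [h4]; rfl⟩
  · have h1 : δ (MapCyl.top (S.alpha p) y) i = 0 := hi
    rw [hδ.top_eq, barycenter_apply] at h1
    norm_num at h1

lemma preimage_bdry (hδ : S.IsDelta p δ) :
    δ ⁻¹' bdrySimplex4 = {g | MapCyl.height (S.alphaMap p) g = 0} := by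
  ext g
  constructor
  · intro hg
    obtain ⟨x, rfl⟩ := hδ.eq_bmu_of_mem_bdry hg
    rfl
  · intro hg
    rcases MapCyl.exists_rep (S.alphaMap p) g with ⟨x, t, ht, rfl⟩ | ⟨y, rfl⟩
    · have : t = 0 := hg
      rw [this]
      exact hδ.bot_mem x
    · exact absurd (show (1 : unitInterval) = 0 from hg) one_ne_zero

/-- The points of `M` over the `2`-skeleton. -/
def ofSkel (S : BallSystem) : C(skel2, S.M) where
  toFun y := ⟨S.h.symm ⟨y, skel2_subset_bdry y.2⟩, S.mem_compl_of_notMem_balls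
    (S.notMem_balls_of_skel2 (by rw [S.h.apply_symm_apply]; exact y.2))⟩
  continuous_toFun := by
    refine Continuous.subtype_mk (S.h.symm.continuous.comp ?_) _
    exact continuous_subtype_val.subtype_mk _

lemma h_ofSkel (S : BallSystem) (y : skel2) : (S.h (ofSkel S y) : Simplex4) = y :=
  congrArg Subtype.val (S.h.apply_symm_apply ⟨y, skel2_subset_bdry y.2⟩)

/-- Both points lie over the same point of the 2-skeleton, where `δ` is one-to-one. -/
lemma bmu_ofSkel (hδ : S.IsDelta p δ) {g : S.Gamma p} (hg : δ g ∈ skel2) :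
    S.bmu p (ofSkel S ⟨δ g, hg⟩) = g := by
  have h1 := h_ofSkel S ⟨δ g, hg⟩
  have h2 := hδ.bmu_of_skel2 (ofSkel S ⟨δ g, hg⟩) (h1 ▸ hg)
  exact hδ.injOn_skel2 (show δ _ ∈ skel2 by rw [h2, h1]; exact hg) hg (h2.trans h1)

lemma exists_of_face (hδ : S.IsDelta p δ) {i : Fin 5} {g : S.Gamma p} (hg : δ g ∈ face3 i) :
    ∃ x : S.M, (S.h x : Simplex4) ∈ face3 i ∧ S.bmu p x = g := by
  obtain ⟨x, rfl⟩ := hδ.eq_bmu_of_mem_bdry ⟨i, hg⟩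
  obtain ⟨j, hj⟩ := (S.h x).2
  by_cases hji : j = i
  · exact ⟨x, hji ▸ hj, rfl⟩
  -- A representative in another face `j` has its value in both faces, hence over the 2-skeleton,
  -- and so comes from a point of the skeleton lying in face `i`.
  · have hs : δ (S.bmu p x) ∈ skel2 := ⟨j, i, hji, hδ.face3_mem j x hj, hg⟩
    refine ⟨ofSkel S ⟨_, hs⟩, ?_, hδ.bmu_ofSkel hs⟩
    rw [h_ofSkel]
    exact hg

lemma exists_of_bdryFace (hδ : S.IsDelta p δ) {i : Fin 5} {g : S.Gamma p}
    (hg : δ g ∈ bdryFace3 i) :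
    ∃ x : S.M, (S.h x : Simplex4) ∈ bdryFace3 i ∧ S.bmu p x = g := by
  have hs := bdryFace3_subset_skel2 i hg
  refine ⟨ofSkel S ⟨_, hs⟩, ?_, hδ.bmu_ofSkel hs⟩
  rw [h_ofSkel]
  exact hg

end BallSystem.IsDelta

namespace BallSystem

variable (S : BallSystem)

/-- A `3`-face, as a subset of the sphere. -/
def face (i : Fin 5) : Set Sphere3 := {q | (S.h q : Simplex4) ∈ face3 i}

lemma isClosed_face (i : Fin 5) : IsClosed (S.face i) := (isClosed_face3 i).preimage S.continuous_h

lemma acycOn_face {k : Type} [CommRing k] (i : Fin 5) (n : ℕ) :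
    AcycOn k (Set.univ : Set (S.face i)) (n + 1) := by
  let f : C(S.face i, Fin 5 → ℝ) := ⟨fun q => ((S.h q : Simplex4) : Fin 5 → ℝ),
    continuous_subtype_val.comp (S.continuous_h.comp continuous_subtype_val)⟩
  have hf : Topology.IsEmbedding f :=
    Topology.IsEmbedding.subtypeVal.comp (Topology.IsEmbedding.subtypeVal.comp
      (S.h.isEmbedding.comp Topology.IsEmbedding.subtypeVal))
  refine AcycOn.of_image hf ?_
  have hr : f '' Set.univ = {x | x ∈ stdSimplex ℝ (Fin 5) ∧ x i = 0} := by
    ext x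
    constructor
    · rintro ⟨q, -, rfl⟩
      exact ⟨(S.h q : Simplex4).2, q.2⟩
    · rintro ⟨h1, h2⟩
      have h3 : (⟨x, h1⟩ : Simplex4) ∈ bdrySimplex4 := ⟨i, h2⟩
      have h4 : S.h (S.h.symm ⟨_, h3⟩) = ⟨_, h3⟩ := S.h.apply_symm_apply _
      refine ⟨⟨S.h.symm ⟨_, h3⟩, ?_⟩, trivial, ?_⟩
      · change (S.h (S.h.symm ⟨_, h3⟩) : Simplex4) ∈ face3 i
        rw [h4]
        exact h2
      · change ((S.h (S.h.symm ⟨_, h3⟩) : Simplex4) : Fin 5 → ℝ) = x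
        rw [h4]
        rfl
  rw [hr]
  have hc : Convex ℝ {x : Fin 5 → ℝ | x ∈ stdSimplex ℝ (Fin 5) ∧ x i = 0} := by
    refine (convex_stdSimplex ℝ (Fin 5)).inter ?_
    intro x hx y hy a b _ _ _
    have hx' : x i = 0 := hx
    have hy' : y i = 0 := hy
    change a * x i + b * y i = 0
    rw [hx', hy', mul_zero, mul_zero, add_zero]
  obtain ⟨x, hx⟩ : {x : Fin 5 → ℝ | x ∈ stdSimplex ℝ (Fin 5) ∧ x i = 0}.Nonempty := by
    rw [← hr]
    have h0 := S.chart_mem_region i 0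
    exact ⟨_, ⟨S.chart i 0, h0.1⟩, trivial, rfl⟩
  exact acycOn_of_starConvex (hc.starConvex hx) ⟨x, hx⟩ n

lemma region_subset_face (i : Fin 5) : S.region i ⊆ S.face i := fun _ hq => hq.1

lemma eq_of_face_region {i j : Fin 5} {q : Sphere3} (hi : q ∈ S.face i) (hj : q ∈ S.region j) :
    i = j := by
  by_contra h
  exact (hj.2 i h).ne' hi

/-- The coordinates around the ball in a face. -/
def faceChart (i : Fin 5) : C(Model, S.face i) :=
  ⟨fun v => ⟨S.chart i v, S.region_subset_face i (S.chart_mem_region i v)⟩, by fun_prop⟩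

lemma faceChart_isOpenEmbedding (i : Fin 5) : Topology.IsOpenEmbedding (S.faceChart i) := by
  refine ⟨Topology.IsEmbedding.of_comp (g := Subtype.val) (S.faceChart i).continuous
    continuous_subtype_val (S.chart_isOpenEmbedding i).isEmbedding, ?_⟩
  convert (S.chart_isOpenEmbedding i).isOpen_range.preimage
    (continuous_subtype_val (p := fun q => q ∈ S.face i)) using 1
  ext q
  constructor
  · rintro ⟨v, rfl⟩
    exact ⟨v, rfl⟩
  · rintro ⟨v, hv⟩
    exact ⟨v, Subtype.ext hv⟩

lemma mem_compl_of_face {i : Fin 5} (q : ↥((S.faceChart i '' Metric.ball 0 1)ᶜ)) :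
    ((q : S.face i) : Sphere3) ∈ S.compl := by
  rw [mem_compl_iff]
  rintro ⟨⟨j, v⟩, hv, h⟩
  have h' : S.chart j v = q := h
  obtain rfl := S.eq_of_face_region q.1.2 (h' ▸ S.chart_mem_region j v)
  exact q.2 ⟨v, by simpa using hv, Subtype.ext h'⟩

end BallSystem

namespace BallSystem.IsDelta

variable {S : BallSystem} {p : ℕ} [hp : Fact p.Prime] {δ : S.Gamma p → Simplex4}

/-- The inverse image of a `3`-face under `δ` is obtained by a surgery from the face. -/
def surgery (hδ : S.IsDelta p δ) (i : Fin 5) : Surgery p (S.face i) (δ ⁻¹' face3 i) where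
  χ := S.faceChart i
  emb := S.faceChart_isOpenEmbedding i
  closed := ((isCompact_closedBall _ _).image (S.faceChart i).continuous).isClosed
  q := ⟨fun q => ⟨S.bmu p ⟨_, S.mem_compl_of_face q⟩, hδ.face3_mem i _ q.1.2⟩,
    ((S.bmu p).continuous.comp (by fun_prop)).subtype_mk _⟩
  quot := by
    have : CompactSpace (S.face i) := isCompact_iff_compactSpace.1 (S.isClosed_face i).isCompact
    have hK : CompactSpace ↥((S.faceChart i '' Metric.ball 0 1)ᶜ) :=
      isCompact_iff_compactSpace.1 ((S.faceChart_isOpenEmbedding i).isOpenMap _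
        Metric.isOpen_ball).isClosed_compl.isCompact
    let j : ↥((S.faceChart i '' Metric.ball 0 1)ᶜ) → S.M := fun q => ⟨_, S.mem_compl_of_face q⟩
    have hj : Continuous j := by fun_prop
    have hcl : IsClosedMap (S.bmu p ∘ j) := (S.isClosedMap_bmu p).comp hj.isClosedMap
    refine IsClosedMap.isQuotientMap (hcl.codRestrict _) (ContinuousMap.continuous _) ?_
    rintro ⟨g, hg⟩
    obtain ⟨x, hx, rfl⟩ := hδ.exists_of_face hg
    refine ⟨⟨⟨x, hx⟩, ?_⟩, rfl⟩
    rintro ⟨v, hv, h⟩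
    refine S.mem_compl_iff.1 x.2 ⟨(i, v), by simpa using hv, congrArg Subtype.val h⟩
  rel x y := by
    have h0 : ∀ x y : ↥((S.faceChart i '' Metric.ball 0 1)ᶜ),
        (⟨S.bmu p ⟨_, S.mem_compl_of_face x⟩, hδ.face3_mem i _ x.1.2⟩ : δ ⁻¹' face3 i) =
        ⟨S.bmu p ⟨_, S.mem_compl_of_face y⟩, hδ.face3_mem i _ y.1.2⟩ ↔
        S.bmu p ⟨_, S.mem_compl_of_face x⟩ = S.bmu p ⟨_, S.mem_compl_of_face y⟩ :=
      fun x y => Subtype.mk_eq_mk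
    refine (h0 x y).trans ((S.bmu_eq_iff p).trans (or_congr ?_ ?_))
    · rw [Subtype.mk_eq_mk, ← Subtype.ext_iff, ← Subtype.ext_iff]
    · constructor
      · rintro ⟨h1, h2⟩
        have h1' : ((y : S.face i) : Sphere3) ∈ frontier S.compl := by
          rwa [← S.rotPow_mem_frontier p, ← h2, S.rotPow_mem_frontier p]
        obtain ⟨⟨a, u⟩, hu, hux⟩ := S.mem_frontier_iff.1 h1
        obtain ⟨⟨b, v⟩, hv, hvy⟩ := S.mem_frontier_iff.1 h1'
        have hux' : S.chart a u = x := hux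
        have hvy' : S.chart b v = y := hvy
        obtain rfl := S.eq_of_face_region x.1.2 (hux' ▸ S.chart_mem_region a u)
        obtain rfl := S.eq_of_face_region y.1.2 (hvy' ▸ S.chart_mem_region b v)
        refine ⟨u, v, hu, hv, Subtype.ext hux', Subtype.ext hvy', ?_⟩
        -- The chart intertwines the suspended power map with the winding map, so equality of orbits
        -- becomes equality of powers in coordinates.
        apply (S.chart_isOpenEmbedding i).injective
        rw [chart_suspMap, chart_suspMap, hux', hvy']
        exact h2
      · rintro ⟨u, v, hu, hv, hux, hvy, e⟩
        have hux' : S.chart i u = x := congrArg Subtype.val hux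
        have hvy' : S.chart i v = y := congrArg Subtype.val hvy
        refine ⟨S.mem_frontier_iff.2 ⟨(i, u), hu, hux'⟩, ?_⟩
        change rotPow p ((x : S.face i) : Sphere3) = rotPow p ((y : S.face i) : Sphere3)
        rw [← hux', ← hvy', ← chart_suspMap, ← chart_suspMap, e]

end BallSystem.IsDelta

end

/-! ### Collars and vanishing of 2-cycles over the faces -/

noncomputable section

open SingChain PowerMap

namespace BallSystem.IsDelta

variable {S : BallSystem} {p : ℕ} [hp : Fact p.Prime] {δ : S.Gamma p → Simplex4}

lemma erase_nonempty (i : Fin 5) : (Finset.univ.erase i).Nonempty :=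
  Finset.card_pos.1 (by simp)

lemma mem_bdryFace3_iff {i : Fin 5} {x : Simplex4} :
    x ∈ bdryFace3 i ↔ x i = 0 ∧ ∃ j ∈ Finset.univ.erase i, x j = 0 := by
  simp [bdryFace3]

/-- The least relevant coordinate is positive on the compact ball and so attains a positive minimum
there. -/
lemma exists_rim (S : BallSystem) (i : Fin 5) : ∃ ε : ℝ, 0 < ε ∧ ε ≤ 1 ∧
    ∀ q ∈ tubeBall (S.a i) (S.b i) S.r, ε ≤ ((Finset.univ.erase i).card : ℝ) *
      minCoord (Finset.univ.erase i) (erase_nonempty i) (S.h q) := by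
  have hK : IsCompact (tubeBall (S.a i) (S.b i) S.r) := by
    rw [← image_chart]
    exact (isCompact_closedBall _ _).image (S.chart i).continuous
  have hne : (tubeBall (S.a i) (S.b i) S.r).Nonempty := by
    rw [← image_chart]
    exact ⟨_, 0, by simp, rfl⟩
  have hc : Continuous fun q => ((Finset.univ.erase i).card : ℝ) *
      minCoord (Finset.univ.erase i) (erase_nonempty i) (S.h q) :=
    continuous_const.mul ((continuous_minCoord _ _).comp S.continuous_h)
  obtain ⟨q, hq, hmin⟩ := hK.exists_isMinOn hne hc.continuousOn
  refine ⟨min 1 _, lt_min one_pos ?_, min_le_left _ _, fun x hx => (min_le_right _ _).trans (hmin hx)⟩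
  obtain ⟨j, hj, e⟩ := exists_minCoord (hs := erase_nonempty i) (S.h q : Simplex4)
  have h2 := (S.ball_subset i q hq).2 j (Finset.ne_of_mem_erase hj)
  have h3 : (0 : ℝ) < (Finset.univ.erase i).card := by
    exact_mod_cast (erase_nonempty i).card_pos
  exact mul_pos h3 (e ▸ h2)

/-- Near its boundary the face is untouched by the surgery: a thin rim misses the ball and embeds in
the fibre, where the push from the barycenter of the face gives the retraction. -/
lemma hasCollar_face (hδ : S.IsDelta p δ) (i : Fin 5) :
    HasCollar (δ ⁻¹' face3 i) (δ ⁻¹' bdryFace3 i) := by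
  obtain ⟨ε, hε0, hε1, hball⟩ := exists_rim S i
  let s : Finset (Fin 5) := Finset.univ.erase i
  have hs : s.Nonempty := erase_nonempty i
  have hface : ∀ y : Rim s hs ε, y.1 ∈ face3 i := fun y => y.2.1 i (Finset.notMem_erase _ _)
  let back : Rim s hs ε → Sphere3 := fun y => S.h.symm ⟨y.1, i, hface y⟩
  have hback : ∀ y, (S.h (back y) : Simplex4) = y.1 :=
    fun y => congrArg Subtype.val (S.h.apply_symm_apply _)
  have hbackc : Continuous back := S.h.symm.continuous.comp (continuous_subtype_val.subtype_mk _)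
  have hnb : ∀ q, q ∈ S.face i → (s.card : ℝ) * minCoord s hs (S.h q) < ε → q ∉ S.balls := by
    intro q hq hlt h
    obtain ⟨j, hj⟩ := Set.mem_iUnion.1 h
    obtain rfl := S.eq_of_face_region hq (S.ball_subset j q hj)
    exact absurd (hball q hj) (not_le.2 hlt)
  have hbackn : ∀ y, back y ∉ S.balls := fun y => by
    refine hnb _ ?_ ?_
    · change (S.h (back y) : Simplex4) ∈ face3 i
      rw [hback]
      exact hface y
    · rw [hback]
      exact y.2.2
  have hcharts : ∀ y, (⟨back y, by
      change (S.h (back y) : Simplex4) ∈ face3 i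
      rw [hback]
      exact hface y⟩ : S.face i) ∈ (hδ.surgery i).outer := by
    rintro y ⟨v, hv, h⟩
    refine hbackn y (Set.mem_iUnion.2 ⟨i, ?_⟩)
    rw [← image_chart]
    exact ⟨v, hv, congrArg Subtype.val h⟩
  let j : Rim s hs ε → (hδ.surgery i).outer := fun y => ⟨_, hcharts y⟩
  have hj : Topology.IsEmbedding j := by
    refine Topology.IsEmbedding.of_comp
      (g := fun x : (hδ.surgery i).outer => (S.h ((x : S.face i) : Sphere3) : Simplex4))
      ((hbackc.subtype_mk _).subtype_mk _)
      (S.continuous_h.comp (continuous_subtype_val.comp continuous_subtype_val)) ?_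
    convert Topology.IsEmbedding.subtypeVal using 1
    ext1 y
    exact hback y
  let e : Rim s hs ε → S.Gamma p := fun y => ((hδ.surgery i).qOuter (j y) : δ ⁻¹' face3 i)
  have he : Topology.IsEmbedding e := Topology.IsEmbedding.subtypeVal.comp
    ((hδ.surgery i).qOuter_embedding.isEmbedding.comp hj)
  have hev : ∀ y, e y = S.bmu p ⟨back y, S.mem_compl_of_notMem_balls (hbackn y)⟩ := fun y => rfl
  -- The part of the face inside the rim. Its image is closed since `bmu` is a closed map, and the
  -- complement of that image cuts the rim out of the fibre.
  let N : Set S.M := {x | (S.h x : Simplex4) ∈ face3 i ∧ ε ≤ (s.card : ℝ) * minCoord s hs (S.h x)}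
  have hN : IsClosed N := by
    have hc : Continuous fun x : S.M => (S.h x : Simplex4) := S.continuous_h.comp continuous_subtype_val
    exact ((isClosed_face3 i).preimage hc).inter (isClosed_le continuous_const
      (continuous_const.mul ((continuous_minCoord _ _).comp hc)))
  have hmem : ∀ x : S.M, (S.h x : Simplex4) ∈ face3 i →
      (s.card : ℝ) * minCoord s hs (S.h x) < ε → S.bmu p x ∉ S.bmu p '' N := by
    rintro x hx hlt ⟨x', hx', h⟩
    rw [S.bmu_inj p (hnb x hx hlt) h.symm] at hlt
    exact absurd hx'.2 (not_le.2 hlt)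
  refine HasCollar.of_embedding (O := (S.bmu p '' N)ᶜ) (e := e)
    (S.isClosedMap_bmu p N hN).isOpen_compl ?_ he ?_ (rimPush hε1) (rimPush_zero hε1) ?_ ?_
  · intro g hg
    obtain ⟨x, hx, rfl⟩ := hδ.exists_of_bdryFace hg
    refine hmem x hx.1 ?_
    rw [minCoord_eq_zero_iff.2 (mem_bdryFace3_iff.1 hx).2, mul_zero]
    exact hε0
  · ext g
    constructor
    · rintro ⟨y, rfl⟩
      refine ⟨hmem _ ?_ ?_, ((hδ.surgery i).qOuter (j y)).2⟩
      · change (S.h (back y) : Simplex4) ∈ face3 i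
        rw [hback]
        exact hface y
      · change (s.card : ℝ) * minCoord s hs (S.h (back y)) < ε
        rw [hback]
        exact y.2.2
    · rintro ⟨h1, h2⟩
      obtain ⟨x, hx, rfl⟩ := hδ.exists_of_face h2
      have hlt : (s.card : ℝ) * minCoord s hs (S.h x) < ε :=
        not_le.1 fun h => h1 ⟨x, ⟨hx, h⟩, rfl⟩
      refine ⟨⟨S.h x, ?_, hlt⟩, ?_⟩
      · intro v hv
        obtain rfl : v = i := by
          by_contra hvi
          exact hv (Finset.mem_erase.2 ⟨hvi, Finset.mem_univ _⟩)
        exact hx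
      · rw [hev]
        congr 1
        exact Subtype.ext (S.h.symm_apply_apply _)
  · intro y
    have h := rimPush_one hε1 y
    have h' : (rimPush hε1 (1, y)).1 ∈ bdryFace3 i := mem_bdryFace3_iff.2 ⟨hface _, h⟩
    change δ (e (rimPush hε1 (1, y))) ∈ bdryFace3 i
    rw [hev, hδ.bmu_of_skel2 _ (by rw [hback]; exact bdryFace3_subset_skel2 i h'), hback]
    exact h'
  · intro t y hy
    refine rimPush_of_exists hε1 t ?_
    obtain ⟨x, hx, h⟩ := hδ.exists_of_bdryFace hy
    rw [hev] at h
    have h' := S.bmu_inj p (hbackn y) h.symm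
    rw [← hback y]
    have h'' : back y = x := congrArg Subtype.val h'
    rw [h'']
    exact (mem_bdryFace3_iff.1 hx).2

/-- The boundary of the face lies off the closed ball, so the surgery result on 2-cycles outside the
collapsed sphere applies. -/
lemma kills_face (hδ : S.IsDelta p δ) (i : Fin 5) {z : Ch (ZMod p) (S.Gamma p) 2}
    (hz : z ∈ sub (ZMod p) (δ ⁻¹' bdryFace3 i) 2) (hc : bd 1 z = 0) :
    ∃ c ∈ sub (ZMod p) (δ ⁻¹' face3 i) 3, bd 2 c = z := by
  have himg : incl (δ ⁻¹' face3 i) '' (incl (δ ⁻¹' face3 i) ⁻¹' (δ ⁻¹' bdryFace3 i)) =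
      δ ⁻¹' bdryFace3 i := by
    rw [Set.image_preimage_eq_inter_range]
    refine Set.inter_eq_left.2 fun g hg => ⟨⟨g, hg.1⟩, rfl⟩
  rw [← himg] at hz
  obtain ⟨y, hy, rfl⟩ := exists_push_eq (incl_embedding _) hz
  have hyc : bd 1 y = 0 := IsCyc.of_push (n := 2) (incl_embedding _).injective hc
  have hsub : incl (δ ⁻¹' face3 i) ⁻¹' (δ ⁻¹' bdryFace3 i) ⊆ (hδ.surgery i).zOuter := by
    rintro ⟨g, hg⟩ hg'
    obtain ⟨x, hx, rfl⟩ := hδ.exists_of_bdryFace hg'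
    have hx2 : (⟨x, hx.1⟩ : S.face i) ∈ (hδ.surgery i).outer := by
      rintro ⟨v, hv, h⟩
      refine S.notMem_balls_of_skel2 (bdryFace3_subset_skel2 i hx) (Set.mem_iUnion.2 ⟨i, ?_⟩)
      rw [← image_chart]
      exact ⟨v, hv, congrArg Subtype.val h⟩
    exact ⟨⟨_, hx2⟩, rfl⟩
  obtain ⟨c, hc'⟩ := (hδ.surgery i).exists_bd_of_zOuter (S.acycOn_face i) (sub_mono hsub _ hy) hyc
  exact ⟨push (incl _) 3 c, push_incl_mem c, by rw [← push_bd, hc']⟩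

theorem fiberData (hδ : S.IsDelta p δ) : FiberData (ZMod p) (⟨δ, hδ.continuous⟩ : C(_, _)) where
  exists_section := ⟨(S.bmu p).comp (ofSkel S), fun y => by
    have h := h_ofSkel S y
    exact (hδ.bmu_of_skel2 _ (by rw [h]; exact y.2)).trans h, fun g hg => hδ.bmu_ofSkel hg⟩
  collar_face := hδ.hasCollar_face
  collar_univ := by
    change HasCollar Set.univ (δ ⁻¹' bdrySimplex4)
    rw [hδ.preimage_bdry]
    exact MapCyl.hasCollar_bot (S.alphaMap p)
  acycOn_face i n := by
    rw [← acycOn_subtype]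
    exact (hδ.surgery i).acycOn_univ (S.acycOn_face i) n
  kills_face i z hz hc := hδ.kills_face i hz hc
  acycOn_univ n := MapCyl.acycOn_univ (S.alphaMap p) (S.acycOn_gammaTop p n)

end BallSystem.IsDelta

end

/-! ### Comparing the homology of unions along a map -/

noncomputable section

namespace SingChain

variable {X Y : Type} [TopologicalSpace X] [TopologicalSpace Y] {k : Type} [CommRing k]

variable (k) in
/-- Cycles of degree `n + 1` in `A₀` bound in `A` as soon as their images bound in `A'`. -/
def HLift (f : C(X, Y)) (A₀ A : Set X) (A' : Set Y) (n : ℕ) : Prop :=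
  ∀ x ∈ sub k A₀ (n + 1), bd n x = 0 → (∃ c ∈ sub k A' (n + 2), bd (n + 1) c = push f (n + 1) x) →
    ∃ c ∈ sub k A (n + 2), bd (n + 1) c = x

variable (k) in
/-- The map `f : A → A'` is surjective on homology in degree `n + 1`. -/
def HSurj (f : C(X, Y)) (A : Set X) (A' : Set Y) (n : ℕ) : Prop :=
  ∀ w ∈ sub k A' (n + 1), bd n w = 0 → ∃ z ∈ sub k A (n + 1), bd n z = 0 ∧
    ∃ c ∈ sub k A' (n + 2), bd (n + 1) c = w - push f (n + 1) z

variable {f : C(X, Y)} {A B A₀ : Set X} {A' B' : Set Y} {q : ℕ}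

lemma HLift.of_acycOn {n : ℕ} (h : AcycOn k A (n + 1)) : HLift k f A A A' n :=
  fun x hx hc _ => h x hx hc

lemma HSurj.of_acycOn {n : ℕ} (h : AcycOn k A' (n + 1)) : HSurj k f A A' n := by
  intro w hw hc
  obtain ⟨c, hc1, hc2⟩ := h w hw hc
  exact ⟨0, Submodule.zero_mem _, map_zero _, c, hc1, by rw [map_zero, sub_zero, hc2]⟩

lemma HLift.mono {n : ℕ} {A₁ : Set X} (h : HLift k f A₀ A A' n) (hA : A₁ ⊆ A₀) :
    HLift k f A₁ A A' n :=
  fun x hx hc hy => h x (sub_mono hA _ hx) hc hy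

/-- Injectivity in homology after attaching a piece. -/
lemma HLift.attach_self (hA : Set.MapsTo f A A') (hB : Set.MapsTo f B B') (eX : Excisive k A B)
    (eY : Excisive k A' B') (hD : HLift k f (A ∩ B) (A ∩ B) (A' ∩ B') q)
    (hD' : AcycOn k (A' ∩ B') (q + 2)) (hBX : AcycOn k B (q + 2))
    (h : HLift k f A A A' (q + 1)) : HLift k f (A ∪ B) (A ∪ B) (A' ∪ B') (q + 1) := by
  rintro z hz hc ⟨c, hcm, hcz⟩
  obtain ⟨a, ha, b, hb, d, hd, e, h1, h2⟩ := eX.split_cycle hz hc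
  obtain ⟨y, hy, u, hu, v, -, e1, -⟩ := eY.exists_inter (a := push f _ a) (b := -push f _ b)
    (c := c - push f _ d) (push_mem_sub hA ha) (Submodule.neg_mem _ (push_mem_sub hB hb))
    (Submodule.sub_mem _ hcm (push_mem_sub (hA.union_union hB) hd))
    (by
      rw [map_sub, hcz, ← push_bd, e, map_add, map_add]
      abel)
  have hy1 : bd (q + 1) y = push f _ (bd (q + 1) a) := by
    rw [push_bd, e1, map_add, bd_bd, add_zero]
  -- The image of the intersection cycle is filled by `y` in `A' ∩ B'`, so the cycle itself is
  -- filled by `w` in `A ∩ B`.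
  obtain ⟨w, hw, hw'⟩ := hD (bd (q + 1) a) h2 (bd_bd _ _) ⟨y, hy, hy1⟩
  -- The fillings `y` and the image of `w` may differ by a cycle; it bounds because the intersection
  -- downstairs has no homology in this degree.
  obtain ⟨g, hg, hg'⟩ := hD' (push f _ w - y) (Submodule.sub_mem _
    (push_mem_sub (hA.inter_inter hB) hw) hy)
    (show bd (q + 1) _ = 0 by rw [map_sub, hy1, ← hw', push_bd, sub_self])
  obtain ⟨s, hs, hs'⟩ := h (a - w) (Submodule.sub_mem _ ha (sub_mono Set.inter_subset_left _ hw))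
    (by rw [map_sub, hw', sub_self]) ⟨u - g, Submodule.sub_mem _ hu
      (sub_mono Set.inter_subset_left _ hg), by
        rw [map_sub, hg', map_sub, e1]
        abel⟩
  obtain ⟨t, ht, ht'⟩ := hBX (b + w) (Submodule.add_mem _ hb (sub_mono Set.inter_subset_right _ hw))
    (show bd (q + 1) _ = 0 by rw [map_add, hw', h1, neg_add_cancel])
  refine ⟨s + t + d, Submodule.add_mem _ (Submodule.add_mem _ (sub_mono Set.subset_union_left _ hs)
    (sub_mono Set.subset_union_right _ ht)) hd, ?_⟩
  rw [map_add, map_add, hs', ht', e]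
  abel

/-- The lifting property after attaching a piece. -/
lemma HLift.attach (hB : A ∩ B ⊆ A₀) (hA₀ : A₀ ⊆ A) (hA : Set.MapsTo f A A')
    (eY : Excisive k A' B') (hD : HSurj k f (A ∩ B) (A' ∩ B') q)
    (hk : ∀ x ∈ sub k (A ∩ B) (q + 1), bd q x = 0 → ∃ c ∈ sub k B (q + 2), bd (q + 1) c = x)
    (h : HLift k f A₀ A A' q) : HLift k f A₀ (A ∪ B) (A' ∪ B') q := by
  rintro x hx hc ⟨c, hcm, hcx⟩
  obtain ⟨y, hy, u, hu, -, -, e1, -⟩ := eY.exists_inter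
    (push_mem_sub hA (sub_mono hA₀ _ hx)) (Submodule.zero_mem _) hcm (by rw [hcx, sub_zero])
  have hyc : bd q y = 0 := by
    have h1 : y = push f _ x - bd _ u := by rw [e1]; abel
    rw [h1, map_sub, bd_bd, ← push_bd, hc, map_zero, sub_zero]
  -- The part of the image cycle in `A' ∩ B'` comes from a cycle `x'` upstairs. It bounds in the new
  -- piece, while the image of `x - x'` bounds already in `A'`.
  obtain ⟨x', hx', hc', d, hd, hd'⟩ := hD y hy hyc
  obtain ⟨g, hg, hg'⟩ := h (x - x') (Submodule.sub_mem _ hx (sub_mono hB _ hx'))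
    (by rw [map_sub, hc, hc', sub_self]) ⟨u + d, Submodule.add_mem _ hu
      (sub_mono Set.inter_subset_left _ hd), by
        rw [map_add, hd', map_sub, e1]
        abel⟩
  obtain ⟨g', hgm, hgg⟩ := hk x' hx' hc'
  refine ⟨g + g', Submodule.add_mem _ (sub_mono Set.subset_union_left _ hg)
    (sub_mono Set.subset_union_right _ hgm), ?_⟩
  rw [map_add, hg', hgg, sub_add_cancel]

/-- Surjectivity in homology after attaching a piece. -/
lemma HSurj.attach (hA : Set.MapsTo f A A') (hB : Set.MapsTo f B B') (eY : Excisive k A' B')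
    (hD : HSurj k f (A ∩ B) (A' ∩ B') q)
    (hk : ∀ x ∈ sub k (A ∩ B) (q + 1), bd q x = 0 → ∃ c ∈ sub k B (q + 2), bd (q + 1) c = x)
    (hBY : AcycOn k B' (q + 2)) (hl : HLift k f (A ∩ B) A A' q) (h : HSurj k f A A' (q + 1)) :
    HSurj k f (A ∪ B) (A' ∪ B') (q + 1) := by
  intro y hy hc
  obtain ⟨a, ha, b, hb, d, hd, e, h1, h2⟩ := eY.split_cycle hy hc
  obtain ⟨x, hx, hxc, g, hg, hg'⟩ := hD (bd (q + 1) a) h2 (bd_bd _ _)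
  -- The intersection cycle downstairs is represented by `x` upstairs; filling `x` on the side of
  -- `A` is where the lifting property is indispensable.
  obtain ⟨a', ha', hax⟩ := hl x hx hxc ⟨a - g, Submodule.sub_mem _ ha
    (sub_mono Set.inter_subset_left _ hg), by rw [map_sub, hg', sub_sub_cancel]⟩
  obtain ⟨b', hb', hbx⟩ := hk x hx hxc
  -- Subtracting the images of the fillings leaves a cycle in each piece: the one in `A'` is hit by
  -- hypothesis, the one in `B'` bounds.
  obtain ⟨z, hz, hzc, s, hs, hs'⟩ := h (a - g - push f _ a') (Submodule.sub_mem _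
    (Submodule.sub_mem _ ha (sub_mono Set.inter_subset_left _ hg)) (push_mem_sub hA ha'))
    (by rw [map_sub, map_sub, hg', ← push_bd, hax]; abel)
  obtain ⟨t, ht, ht'⟩ := hBY (b + g + push f _ b') (Submodule.add_mem _
    (Submodule.add_mem _ hb (sub_mono Set.inter_subset_right _ hg)) (push_mem_sub hB hb'))
    (show bd (q + 1) _ = 0 by rw [map_add, map_add, hg', ← push_bd, hbx, h1]; abel)
  refine ⟨a' - b' + z, Submodule.add_mem _ (Submodule.sub_mem _
    (sub_mono Set.subset_union_left _ ha') (sub_mono Set.subset_union_right _ hb'))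
    (sub_mono Set.subset_union_left _ hz), by rw [map_add, map_sub, hax, hbx, hzc]; abel,
    s + t + d, Submodule.add_mem _ (Submodule.add_mem _ (sub_mono Set.subset_union_left _ hs)
    (sub_mono Set.subset_union_right _ ht)) hd, ?_⟩
  rw [map_add, map_add, hs', ht', e, map_add, map_sub]
  abel

end SingChain

end

/-! ### Subcomplexes and attaching simplices -/

noncomputable section

open SingChain

namespace Realization

variable {V : Type} {L : PreAbstractSimplicialComplex V} {k : Type} [CommRing k]

variable (L) in
/-- `K` is a subcomplex of `L`. -/
def IsSub (K : Set (Finset V)) : Prop :=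
  K ⊆ L.faces ∧ ∀ s ∈ K, ∀ t ⊆ s, t.Nonempty → t ∈ K

/-- The closed simplex with vertices `s`. -/
def cl (s : Finset V) : Set (Finset V) := {t | t ⊆ s ∧ t.Nonempty}

/-- The boundary of the simplex with vertices `s`. -/
def bdr (s : Finset V) : Set (Finset V) := {t | t ⊂ s ∧ t.Nonempty}

lemma isSub_faces : IsSub L L.faces :=
  ⟨subset_rfl, fun _ hs _ hts ht => (L.isRelLowerSet_faces hs).2 hts ht⟩

lemma isSub_cl {s : Finset V} (hs : s ∈ L.faces) : IsSub L (cl s) :=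
  ⟨fun _ ht => (L.isRelLowerSet_faces hs).2 ht.1 ht.2, fun _ ht _ hut hu => ⟨hut.trans ht.1, hu⟩⟩

lemma isSub_bdr {s : Finset V} (hs : s ∈ L.faces) : IsSub L (bdr s) :=
  ⟨fun _ ht => (L.isRelLowerSet_faces hs).2 ht.1.1 ht.2,
    fun _ ht _ hut hu => ⟨lt_of_le_of_lt hut ht.1, hu⟩⟩

lemma card_bdr {s t : Finset V} {n : ℕ} (hs : s.card = n + 1) (ht : t ∈ bdr s) : t.card ≤ n := by
  have := Finset.card_lt_card ht.1
  omega

lemma inter_cl {K : Set (Finset V)} {s : Finset V} (hs : s ∉ K) (hb : bdr s ⊆ K) :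
    K ∩ cl s = bdr s := by
  ext t
  constructor
  · rintro ⟨h1, h2, h3⟩
    exact ⟨lt_of_le_of_ne h2 fun e => hs (e ▸ h1), h3⟩
  · intro ht
    exact ⟨hb ht, ht.1.1, ht.2⟩

variable [Fintype V]

open Classical in
/-- The vertices with positive coordinate. -/
def supp (x : Realization L) : Finset V := Finset.univ.filter fun v => x.1 v ≠ 0

lemma mem_supp {x : Realization L} {v : V} : v ∈ supp x ↔ x.1 v ≠ 0 := by simp [supp]

lemma supp_nonempty (x : Realization L) : (supp x).Nonempty := by
  by_contra h
  rw [Finset.not_nonempty_iff_eq_empty, Finset.eq_empty_iff_forall_notMem] at h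
  have h1 := x.1.2.2
  rw [Finset.sum_eq_zero] at h1
  · exact zero_ne_one h1
  · intro v _
    by_contra hv
    exact h v (mem_supp.2 hv)

lemma supp_subset_iff {x : Realization L} {s : Finset V} :
    supp x ⊆ s ↔ ∀ v, v ∉ s → x.1 v = 0 := by
  constructor
  · intro h v hv
    by_contra h'
    exact hv (h (mem_supp.2 h'))
  · intro h v hv
    by_contra h'
    exact mem_supp.1 hv (h v h')

lemma supp_mem (x : Realization L) : supp x ∈ L.faces := by
  obtain ⟨s, hs, h⟩ := x.2
  exact (L.isRelLowerSet_faces hs).2 (supp_subset_iff.2 h) (supp_nonempty x)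

variable (L) in
/-- The union of the open simplices in a set of simplices. -/
def carrier (K : Set (Finset V)) : Set (Realization L) := {x | supp x ∈ K}

lemma mem_carrier_cl {s : Finset V} {x : Realization L} :
    x ∈ carrier L (cl s) ↔ ∀ v, v ∉ s → x.1 v = 0 := by
  rw [← supp_subset_iff]
  exact ⟨fun h => h.1, fun h => ⟨h, supp_nonempty x⟩⟩

lemma mem_carrier_bdr {s : Finset V} {x : Realization L} :
    x ∈ carrier L (bdr s) ↔ (∀ v, v ∉ s → x.1 v = 0) ∧ ∃ v ∈ s, x.1 v = 0 := by
  rw [← supp_subset_iff]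
  constructor
  · rintro ⟨h, -⟩
    obtain ⟨v, hv, hv'⟩ := Finset.exists_of_ssubset h
    refine ⟨h.1, v, hv, ?_⟩
    by_contra h0
    exact hv' (mem_supp.2 h0)
  · rintro ⟨h, v, hv, h0⟩
    refine ⟨⟨h, fun h' => mem_supp.1 (h' hv) h0⟩, supp_nonempty x⟩

lemma isClosed_carrier {K : Set (Finset V)} (hK : IsSub L K) : IsClosed (carrier L K) := by
  have : carrier L K = ⋃ s : K, {x | ∀ v, v ∉ s.1 → x.1 v = 0} := by
    ext x
    rw [Set.mem_iUnion]
    constructor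
    · exact fun h => ⟨⟨_, h⟩, supp_subset_iff.1 subset_rfl⟩
    · rintro ⟨s, hs⟩
      exact hK.2 s s.2 _ (supp_subset_iff.2 hs) (supp_nonempty x)
  rw [this]
  refine isClosed_iUnion_of_finite fun s => ?_
  have : {x : Realization L | ∀ v, v ∉ s.1 → x.1 v = 0} =
      ⋂ v : {v // v ∉ s.1}, {x | x.1 v = 0} := by
    ext x
    simp
  rw [this]
  exact isClosed_iInter fun v => isClosed_eq ((continuous_coord v.1).comp continuous_subtype_val)
    continuous_const

/-- Induction over subcomplexes by attaching simplices of the top dimension. -/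
lemma IsSub.induction {P : Set (Finset V) → Prop} (n : ℕ)
    (h0 : ∀ K, IsSub L K → (∀ s ∈ K, s.card ≤ n) → P K)
    (h1 : ∀ K s, IsSub L K → s ∈ L.faces → (∀ t ∈ K, t.card ≤ n + 1) → s.card = n + 1 → s ∉ K →
      bdr s ⊆ K → P K → P (K ∪ cl s))
    {K : Set (Finset V)} (hK : IsSub L K) (hn : ∀ s ∈ K, s.card ≤ n + 1) : P K := by
  induction hm : K.ncard using Nat.strong_induction_on generalizing K with
  | _ m ih =>
    by_cases h : ∃ s ∈ K, s.card = n + 1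
    · obtain ⟨s, hs, hcard⟩ := h
      -- A simplex with the maximal number of vertices is a proper face of no other, so deleting it
      -- leaves a subcomplex that still contains its boundary.
      have hmax : ∀ t ∈ K, s ⊆ t → t = s := fun t ht hst =>
        (Finset.eq_of_subset_of_card_le hst (by rw [hcard]; exact hn t ht)).symm
      have hK1 : IsSub L (K \ {s}) := by
        refine ⟨fun t ht => hK.1 ht.1, fun t ht u hut hu => ⟨hK.2 t ht.1 u hut hu, ?_⟩⟩
        rintro rfl
        exact ht.2 (hmax t ht.1 hut)
      have hne : s.Nonempty := Finset.card_pos.1 (by omega)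
      have hb : bdr s ⊆ K \ {s} := fun t ht => ⟨hK.2 s hs t ht.1.1 ht.2, ht.1.ne⟩
      have hU : K \ {s} ∪ cl s = K := by
        ext t
        constructor
        · rintro (ht | ht)
          · exact ht.1
          · exact hK.2 s hs t ht.1 ht.2
        · intro ht
          by_cases hts : t = s
          · exact Or.inr (hts ▸ (⟨subset_rfl, hne⟩ : s ∈ cl s))
          · exact Or.inl ⟨ht, hts⟩
      rw [← hU]
      refine h1 _ s hK1 (hK.1 hs) (fun t ht => hn t ht.1) hcard (fun h => h.2 rfl) hb ?_
      exact ih _ (hm ▸ Set.ncard_sdiff_singleton_lt_of_mem hs) hK1 (fun t ht => hn t ht.1) rfl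
    · push Not at h
      exact h0 K hK fun s hs => by have h2 := hn s hs; have h3 := h s hs; omega

lemma acycOn_cl {s : Finset V} (hs : s ∈ L.faces) (n : ℕ) :
    AcycOn k (carrier L (cl s)) (n + 1) := by
  classical
  let f : C(Realization L, V → ℝ) :=
    ⟨fun x => (x.1 : V → ℝ), continuous_subtype_val.comp continuous_subtype_val⟩
  have hf : Topology.IsEmbedding f :=
    Topology.IsEmbedding.subtypeVal.comp Topology.IsEmbedding.subtypeVal
  refine AcycOn.of_image hf ?_
  have hr : f '' carrier L (cl s) = {x | x ∈ stdSimplex ℝ V ∧ ∀ v, v ∉ s → x v = 0} := by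
    ext x
    constructor
    · rintro ⟨q, hq, rfl⟩
      exact ⟨q.1.2, mem_carrier_cl.1 hq⟩
    · rintro ⟨h1, h2⟩
      exact ⟨⟨⟨x, h1⟩, s, hs, h2⟩, mem_carrier_cl.2 h2, rfl⟩
  rw [hr]
  have hc : Convex ℝ {x : V → ℝ | x ∈ stdSimplex ℝ V ∧ ∀ v, v ∉ s → x v = 0} := by
    refine (convex_stdSimplex ℝ V).inter ?_
    intro x hx y hy a b _ _ _ v hv
    change a * x v + b * y v = 0
    rw [hx v hv, hy v hv, mul_zero, mul_zero, add_zero]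
  obtain ⟨v, hv⟩ : s.Nonempty := (L.isRelLowerSet_faces hs).1
  have hx : Pi.single v 1 ∈ {x : V → ℝ | x ∈ stdSimplex ℝ V ∧ ∀ v, v ∉ s → x v = 0} := by
    refine ⟨single_mem_stdSimplex ℝ v, fun w hw => Pi.single_eq_of_ne ?_ _⟩
    rintro rfl
    exact hw hv
  exact acycOn_of_starConvex (hc.starConvex hx) ⟨_, hx⟩ n

/-- With `ε = 1` the rim is the whole simplex except its barycenter. -/
lemma hasCollar_cl {s : Finset V} (hs : s ∈ L.faces) :
    HasCollar (carrier L (cl s)) (carrier L (bdr s)) := by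
  have hne : s.Nonempty := (L.isRelLowerSet_faces hs).1
  let e : Rim s hne 1 → Realization L := fun x => ⟨x.1, s, hs, x.2.1⟩
  have he : Topology.IsEmbedding e := by
    refine Topology.IsEmbedding.of_comp (g := Subtype.val) (continuous_subtype_val.subtype_mk _)
      continuous_subtype_val ?_
    exact Topology.IsEmbedding.subtypeVal
  refine HasCollar.of_embedding (O := {x | s.card * minCoord s hne x.1 < 1}) (e := e) ?_ ?_ he ?_
    (rimPush le_rfl) (rimPush_zero le_rfl) ?_ ?_
  · exact isOpen_lt (continuous_const.mul ((continuous_minCoord _ _).comp continuous_subtype_val))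
      continuous_const
  · intro x hx
    change s.card * minCoord s hne x.1 < 1
    rw [minCoord_eq_zero_iff.2 (mem_carrier_bdr.1 hx).2, mul_zero]
    exact one_pos
  · ext x
    constructor
    · rintro ⟨y, rfl⟩
      exact ⟨y.2.2, mem_carrier_cl.2 y.2.1⟩
    · rintro ⟨h1, h2⟩
      exact ⟨⟨x.1, mem_carrier_cl.1 h2, h1⟩, rfl⟩
  · intro x
    exact mem_carrier_bdr.2 ⟨(rimPush le_rfl (1, x)).2.1, rimPush_one le_rfl x⟩
  · intro t x hx
    exact rimPush_of_exists le_rfl t (mem_carrier_bdr.1 hx).2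

lemma excisive_cl {X : Type} [TopologicalSpace X] {π : C(X, Realization L)} {K : Set (Finset V)}
    {s : Finset V} (hK : IsSub L K) (hs : s ∈ L.faces) (hsK : s ∉ K) (hb : bdr s ⊆ K)
    (hc : HasCollar (π ⁻¹' carrier L (cl s)) (π ⁻¹' carrier L (bdr s))) :
    Excisive k (π ⁻¹' carrier L K) (π ⁻¹' carrier L (cl s)) := by
  refine hc.excisive ((isClosed_carrier hK).preimage π.continuous)
    ((isClosed_carrier (isSub_cl hs)).preimage π.continuous) ?_
  rw [← Set.preimage_inter, ← inter_cl hsK hb]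
  rfl

lemma excisive_carrier {K : Set (Finset V)} {s : Finset V} (hK : IsSub L K) (hs : s ∈ L.faces)
    (hsK : s ∉ K) (hb : bdr s ⊆ K) : Excisive k (carrier L K) (carrier L (cl s)) :=
  excisive_cl (π := .id _) hK hs hsK hb (hasCollar_cl hs)

lemma carrier_inter {K : Set (Finset V)} {s : Finset V} (hsK : s ∉ K) (hb : bdr s ⊆ K) :
    carrier L K ∩ carrier L (cl s) = carrier L (bdr s) := by
  rw [← inter_cl hsK hb]
  rfl

/-- A complex has no homology above its dimension. -/
lemma acycOn_carrier (n : ℕ) : ∀ {K : Set (Finset V)}, IsSub L K → (∀ s ∈ K, s.card ≤ n) →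
    ∀ m, n ≤ m → AcycOn k (carrier L K) m := by
  induction n with
  | zero =>
    intro K hK hn m _
    have : carrier L K = ∅ := by
      rw [Set.eq_empty_iff_forall_notMem]
      intro x hx
      have h1 := hn _ hx
      have h2 := (supp_nonempty x).card_pos
      omega
    rw [this]
    exact acycOn_empty m
  | succ n ih =>
    intro K hK hn m hm
    refine IsSub.induction (P := fun K => AcycOn k (carrier L K) m) n
      (fun K hK hn => ih hK hn m (by omega)) (fun K s hK hs hn hcard hsK hb h => ?_) hK hn
    obtain ⟨m, rfl⟩ : ∃ l, m = l + 1 := ⟨m - 1, by omega⟩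
    refine (excisive_carrier hK hs hsK hb).acycOn_union h (acycOn_cl hs m) ?_
    rw [carrier_inter hsK hb]
    exact ih (isSub_bdr hs) (fun t ht => card_bdr hcard ht) m (by omega)

end Realization

end

/-! ### The pull-back over the 2-skeleton and over single simplices -/

noncomputable section

open SingChain

/-- The face of `Δ` with vertices in `F`. -/
def faceSet (F : Finset (Fin 5)) : Set Simplex4 := {y | ∀ j, j ∉ F → y j = 0}

/-- The boundary of the face of `Δ` with vertices in `F`. -/
def bdrySet (F : Finset (Fin 5)) : Set Simplex4 := {y | (∀ j, j ∉ F → y j = 0) ∧ ∃ j ∈ F, y j = 0}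

lemma faceSet_erase (i : Fin 5) : faceSet (Finset.univ.erase i) = face3 i := by
  ext y
  simp [faceSet, face3]

lemma bdrySet_erase (i : Fin 5) : bdrySet (Finset.univ.erase i) = bdryFace3 i := by
  ext y
  simp [bdrySet, bdryFace3]

lemma faceSet_univ : faceSet Finset.univ = Set.univ := by
  ext y
  simp [faceSet]

lemma bdrySet_univ : bdrySet Finset.univ = bdrySimplex4 := by
  ext y
  simp [bdrySet, bdrySimplex4]

lemma exists_eq_erase {F : Finset (Fin 5)} (hF : F.card = 4) : ∃ i, F = Finset.univ.erase i := by
  have h : Fᶜ.card = 1 := by rw [Finset.card_compl, hF]; rfl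
  obtain ⟨i, hi⟩ := Finset.card_eq_one.1 h
  refine ⟨i, ?_⟩
  rw [← compl_compl F, hi]
  ext j
  simp

namespace Realization

variable {V : Type} [Fintype V] {L : PreAbstractSimplicialComplex V} {lam : V → Fin 5}

lemma realizationMap_apply (x : Realization L) (j : Fin 5) :
    realizationMap L lam x j = ∑ v with lam v = j, x.1 v :=
  FunOnFinite.linearMap_apply_apply ℝ ℝ lam _ j

lemma continuous_realizationMap : Continuous (realizationMap L lam) :=
  (stdSimplex.continuous_map lam).comp continuous_subtype_val

/-- Injectivity is tested on the vertices of the simplex. -/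
lemma injOn_of_realizationMap {s : Finset V} (hs : s ∈ L)
    (h : Set.InjOn (realizationMap L lam) {x | ∀ v, v ∉ s → x.1 v = 0}) : Set.InjOn lam s := by
  classical
  intro v hv w hw e
  let pt : ∀ u ∈ s, Realization L := fun u hu => ⟨stdSimplex.vertex u, s, hs, fun t ht => by
    have : t ≠ u := by rintro rfl; exact ht hu
    exact Pi.single_eq_of_ne this _⟩
  have hmem : ∀ u hu, pt u hu ∈ {x : Realization L | ∀ v, v ∉ s → x.1 v = 0} := fun u hu t ht => by
    have : t ≠ u := by rintro rfl; exact ht hu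
    exact Pi.single_eq_of_ne this _
  have h1 : pt v hv = pt w hw := by
    refine h (hmem v hv) (hmem w hw) ?_
    change stdSimplex.map lam (stdSimplex.vertex v) = stdSimplex.map lam (stdSimplex.vertex w)
    rw [stdSimplex.map_vertex, stdSimplex.map_vertex, e]
  have h2 : (pt v hv).1 v = (pt w hw).1 v := by rw [h1]
  by_contra hne
  change (Pi.single v 1 : V → ℝ) v = (Pi.single w 1 : V → ℝ) v at h2
  rw [Pi.single_eq_same, Pi.single_eq_of_ne hne] at h2
  exact one_ne_zero h2

section Section

variable (L lam) in
/-- The image of a point under the simplicial map has support in the image of the support. -/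
lemma realizationMap_eq_zero {x : Realization L} {j : Fin 5} (hj : ∀ v ∈ supp x, lam v ≠ j) :
    realizationMap L lam x j = 0 := by
  rw [realizationMap_apply]
  refine Finset.sum_eq_zero fun v hv => ?_
  by_contra h
  exact hj v (mem_supp.2 h) (Finset.mem_filter.1 hv).2

/-- At most three of the five vertices of `Δ` are hit, so at least two coordinates vanish. -/
lemma realizationMap_mem_skel2 {x : Realization L} (hx : (supp x).card ≤ 3) :
    realizationMap L lam x ∈ skel2 := by
  have h : 1 < ((supp x).image lam)ᶜ.card := by
    rw [Finset.card_compl, Fintype.card_fin]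
    have := Finset.card_image_le (s := supp x) (f := lam)
    omega
  obtain ⟨i, hi, j, hj, hij⟩ := Finset.one_lt_card.1 h
  refine ⟨i, j, hij, ?_, ?_⟩ <;> refine realizationMap_eq_zero L lam fun v hv e => ?_
  · exact Finset.mem_compl.1 hi (e ▸ Finset.mem_image_of_mem lam hv)
  · exact Finset.mem_compl.1 hj (e ▸ Finset.mem_image_of_mem lam hv)

end Section

variable {G : Type} [TopologicalSpace G] {δ : C(G, Simplex4)} {k : Type} [CommRing k]

variable (L lam δ) in
/-- The projection of the pull-back. -/
abbrev prj : C(PullbackSpace (realizationMap L lam) δ, Realization L) :=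
  pullbackFst (realizationMap L lam) δ

variable (L lam δ) in
/-- The inverse image of a set of simplices in the pull-back. -/
def upper (K : Set (Finset V)) : Set (PullbackSpace (realizationMap L lam) δ) :=
  prj L lam δ ⁻¹' carrier L K

lemma mapsTo_upper (K : Set (Finset V)) : Set.MapsTo (prj L lam δ) (upper L lam δ K) (carrier L K) :=
  fun _ hx => hx

/-- Over the `2`-skeleton the projection is a homeomorphism. -/
lemma exists_lift (hδ : FiberData k δ) {K : Set (Finset V)} (hK : ∀ s ∈ K, s.card ≤ 3) :
    ∃ t : C(carrier L K, PullbackSpace (realizationMap L lam) δ),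
      (∀ x, prj L lam δ (t x) = x) ∧
      ∀ y (hy : prj L lam δ y ∈ carrier L K), t ⟨prj L lam δ y, hy⟩ = y := by
  obtain ⟨t, ht1, ht2⟩ := hδ.exists_section
  have hs : ∀ x : carrier L K, realizationMap L lam x ∈ skel2 :=
    fun x => realizationMap_mem_skel2 (hK _ x.2)
  refine ⟨⟨fun x => ⟨(x.1, t ⟨realizationMap L lam x, hs x⟩),
    (ht1 ⟨realizationMap L lam x, hs x⟩).symm⟩, ?_⟩, fun x => rfl, ?_⟩
  · refine Continuous.subtype_mk (continuous_subtype_val.prodMk (t.continuous.comp ?_)) _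
    exact (continuous_realizationMap.comp continuous_subtype_val).subtype_mk _
  · rintro ⟨⟨x, g⟩, e⟩ hy
    apply Subtype.ext
    refine Prod.ext rfl ?_
    change t ⟨realizationMap L lam x, _⟩ = g
    have e' : realizationMap L lam x = δ g := e
    have h2 : δ g ∈ skel2 := e' ▸ hs ⟨x, hy⟩
    exact (congrArg t (Subtype.ext e')).trans (ht2 g h2)

lemma push_lift {K : Set (Finset V)} {t : C(carrier L K, PullbackSpace (realizationMap L lam) δ)}
    (ht : ∀ y (hy : prj L lam δ y ∈ carrier L K), t ⟨prj L lam δ y, hy⟩ = y) {n : ℕ}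
    {x : Ch k (PullbackSpace (realizationMap L lam) δ) n} (hx : x ∈ sub k (upper L lam δ K) n)
    {c : Ch k (carrier L K) n} (hc : push (incl _) n c = push (prj L lam δ) n x) :
    push t n c = x := by
  obtain ⟨x, rfl⟩ := exists_push_incl hx
  let r : C(upper L lam δ K, carrier L K) := ⟨fun y => ⟨prj L lam δ y, y.2⟩, by fun_prop⟩
  have h1 : c = push r n x := by
    apply push_injective (incl_embedding _).injective
    rw [hc, push_push, push_push]
    rfl
  rw [h1, push_push]
  congr 1
  congr 1
  ext1 y
  exact ht y y.2

/-- The bounding chain is carried upstairs by the inverse of the projection. -/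
lemma hLift_of_card (hδ : FiberData k δ) {K : Set (Finset V)} (hK : ∀ s ∈ K, s.card ≤ 3) (n : ℕ) :
    HLift k (prj L lam δ) (upper L lam δ K) (upper L lam δ K) (carrier L K) n := by
  obtain ⟨t, ht1, ht2⟩ := exists_lift (L := L) (lam := lam) hδ hK
  rintro x hx hc ⟨c, hcm, hcx⟩
  obtain ⟨c, rfl⟩ := exists_push_incl hcm
  refine ⟨push t _ c, push_mem_sub (A := Set.univ) (fun y _ => ?_) (mem_sub_univ c), ?_⟩
  · change prj L lam δ (t y) ∈ carrier L K
    rw [ht1]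
    exact y.2
  · rw [← push_bd]
    rw [← push_bd] at hcx
    exact push_lift ht2 hx hcx

lemma hSurj_of_card (hδ : FiberData k δ) {K : Set (Finset V)} (hK : ∀ s ∈ K, s.card ≤ 3) (n : ℕ) :
    HSurj k (prj L lam δ) (upper L lam δ K) (carrier L K) n := by
  obtain ⟨t, ht1, ht2⟩ := exists_lift (L := L) (lam := lam) hδ hK
  intro w hw hc
  obtain ⟨w, rfl⟩ := exists_push_incl hw
  refine ⟨push t _ w, push_mem_sub (A := Set.univ) (fun y _ => ?_) (mem_sub_univ w), ?_, 0,
    Submodule.zero_mem _, ?_⟩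
  · change prj L lam δ (t y) ∈ carrier L K
    rw [ht1]
    exact y.2
  · rw [← push_bd] at hc ⊢
    rw [push_injective (incl_embedding _).injective _ (hc.trans (map_zero _).symm), map_zero]
  · rw [map_zero, push_push, eq_comm, sub_eq_zero]
    congr 1
    congr 1
    ext1 y
    exact (ht1 y).symm

/-! ### The part of the pull-back over a simplex -/

section Cell

open Classical in
variable (lam) in
/-- The point of a simplex of `L` over a point of `Δ`. -/
def cellFun (s : Finset V) (y : Simplex4) (v : V) : ℝ := if v ∈ s then y (lam v) else 0

variable {s : Finset V}

lemma sum_cellFun (hinj : Set.InjOn lam s) (y : Simplex4) (j : Fin 5) (hj : j ∈ s.image lam) :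
    ∑ v with lam v = j, cellFun lam s y v = y j := by
  obtain ⟨w, hw, rfl⟩ := Finset.mem_image.1 hj
  rw [Finset.sum_eq_single_of_mem w (by simp)]
  · exact if_pos hw
  · intro v hv hvw
    refine if_neg fun hvs => hvw (hinj hvs hw (Finset.mem_filter.1 hv).2)

lemma cellFun_mem (hinj : Set.InjOn lam s) {y : Simplex4} (hy : y ∈ faceSet (s.image lam)) :
    cellFun lam s y ∈ stdSimplex ℝ V := by
  classical
  constructor
  · intro v
    rw [cellFun]
    split_ifs
    · exact y.2.1 _
    · exact le_rfl
  · have h1 : ∑ j, y j = 1 := y.2.2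
    rw [← Finset.sum_subset (Finset.subset_univ (s.image lam)) fun j _ hj => hy j hj,
      Finset.sum_image fun a ha b hb => hinj ha hb] at h1
    simpa [cellFun, Finset.sum_ite_mem] using h1

lemma realizationMap_cell {y : Simplex4} (hy : y ∈ faceSet (s.image lam))
    {x : Realization L} (hx : ∀ v, x.1 v = cellFun lam s y v) (hinj : Set.InjOn lam s) :
    realizationMap L lam x = y := by
  apply Subtype.ext
  funext j
  change realizationMap L lam x j = y j
  rw [realizationMap_apply]
  simp only [hx]
  by_cases hj : j ∈ s.image lam
  · exact sum_cellFun hinj y j hj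
  · rw [show y j = 0 from hy j hj]
    refine Finset.sum_eq_zero fun v hv => if_neg fun hvs => hj ?_
    rw [← (Finset.mem_filter.1 hv).2]
    exact Finset.mem_image_of_mem _ hvs

lemma eq_cellFun {x : Realization L} (hx : ∀ v, v ∉ s → x.1 v = 0) (hinj : Set.InjOn lam s) (v : V) :
    x.1 v = cellFun lam s (realizationMap L lam x) v := by
  rw [cellFun]
  split_ifs with hv
  · rw [realizationMap_apply, Finset.sum_eq_single_of_mem v (by simp)]
    intro w hw hwv
    exact hx w fun hws => hwv (hinj hws hv (Finset.mem_filter.1 hw).2)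
  · exact hx v hv

lemma realizationMap_mem_faceSet {x : Realization L} (hx : ∀ v, v ∉ s → x.1 v = 0) :
    realizationMap L lam x ∈ faceSet (s.image lam) := fun _ hj =>
  realizationMap_eq_zero L lam fun _ hv e =>
    hj (e ▸ Finset.mem_image_of_mem _ (supp_subset_iff.2 hx hv))

variable (δ) in
/-- The inverse image of a face of `Δ`, as a subspace of the pull-back. -/
def cell (hs : s ∈ L.faces) (hinj : Set.InjOn lam s) :
    C(δ ⁻¹' faceSet (s.image lam), PullbackSpace (realizationMap L lam) δ) where
  toFun g := ⟨(⟨⟨cellFun lam s (δ g), cellFun_mem hinj g.2⟩, s, hs, fun v hv => if_neg hv⟩, g),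
    realizationMap_cell g.2 (fun v => rfl) hinj⟩
  continuous_toFun := by
    refine Continuous.subtype_mk (Continuous.prodMk (Continuous.subtype_mk (Continuous.subtype_mk
      (continuous_pi fun v => ?_) _) _) continuous_subtype_val) _
    by_cases hv : v ∈ s
    · simp only [cellFun, if_pos hv]
      exact (continuous_coord _).comp (δ.continuous.comp continuous_subtype_val)
    · simp only [cellFun, if_neg hv]
      exact continuous_const

lemma cell_isEmbedding (hs : s ∈ L.faces) (hinj : Set.InjOn lam s) :
    Topology.IsEmbedding (cell δ hs hinj) := by
  refine Topology.IsEmbedding.of_comp (g := fun x => x.1.2) (cell δ hs hinj).continuous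
    (continuous_snd.comp continuous_subtype_val) ?_
  exact Topology.IsEmbedding.subtypeVal

lemma exists_cell (hs : s ∈ L.faces) (hinj : Set.InjOn lam s) {x : PullbackSpace (realizationMap L lam) δ}
    (hx : x ∈ upper L lam δ (cl s)) : ∃ h : δ x.1.2 ∈ faceSet (s.image lam),
      cell δ hs hinj ⟨x.1.2, h⟩ = x := by
  have hx' : ∀ v, v ∉ s → x.1.1.1 v = 0 := mem_carrier_cl.1 hx
  have e : realizationMap L lam x.1.1 = δ x.1.2 := x.2
  refine ⟨e ▸ realizationMap_mem_faceSet hx', ?_⟩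
  apply Subtype.ext
  refine Prod.ext ?_ rfl
  apply Subtype.ext
  apply Subtype.ext
  funext v
  change cellFun lam s (δ x.1.2) v = x.1.1.1 v
  rw [← e]
  exact (eq_cellFun hx' hinj v).symm

lemma cell_mem_cl (hs : s ∈ L.faces) (hinj : Set.InjOn lam s) (g : δ ⁻¹' faceSet (s.image lam)) :
    cell δ hs hinj g ∈ upper L lam δ (cl s) :=
  mem_carrier_cl.2 fun _ hv => if_neg hv

lemma cell_mem_bdr (hs : s ∈ L.faces) (hinj : Set.InjOn lam s) {g : δ ⁻¹' faceSet (s.image lam)} :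
    cell δ hs hinj g ∈ upper L lam δ (bdr s) ↔ δ g ∈ bdrySet (s.image lam) := by
  refine mem_carrier_bdr.trans ?_
  constructor
  · rintro ⟨-, v, hv, h⟩
    refine ⟨g.2, lam v, Finset.mem_image_of_mem _ hv, ?_⟩
    change cellFun lam s (δ g) v = 0 at h
    rwa [cellFun, if_pos hv] at h
  · rintro ⟨-, j, hj, h⟩
    obtain ⟨v, hv, rfl⟩ := Finset.mem_image.1 hj
    exact ⟨fun v hv => if_neg hv, v, hv, (if_pos hv).trans h⟩

lemma hasCollar_upper (hs : s ∈ L.faces) (hinj : Set.InjOn lam s)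
    (h : HasCollar (δ ⁻¹' faceSet (s.image lam)) (δ ⁻¹' bdrySet (s.image lam))) :
    HasCollar (upper L lam δ (cl s)) (upper L lam δ (bdr s)) := by
  obtain ⟨O, hO, hCO, H, H0, H1, HC⟩ := h
  let i : ↥(O ∩ δ ⁻¹' faceSet (s.image lam)) → δ ⁻¹' faceSet (s.image lam) := fun g => ⟨g, g.2.2⟩
  have hi : Topology.IsEmbedding i := Topology.IsEmbedding.of_comp (g := Subtype.val)
    (continuous_subtype_val.subtype_mk _) continuous_subtype_val Topology.IsEmbedding.subtypeVal
  have hbc : upper L lam δ (bdr s) ⊆ upper L lam δ (cl s) := fun x hx => ⟨hx.1.1, hx.2⟩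
  refine HasCollar.of_embedding (O := (fun x => x.1.2) ⁻¹' O) (e := cell δ hs hinj ∘ i)
    (hO.preimage (continuous_snd.comp continuous_subtype_val)) ?_
    ((cell_isEmbedding hs hinj).comp hi) ?_ H H0 ?_ ?_
  · intro x hx
    obtain ⟨h, e⟩ := exists_cell hs hinj (hbc hx)
    refine hCO ?_
    rw [← e, cell_mem_bdr] at hx
    exact hx
  · ext x
    constructor
    · rintro ⟨g, rfl⟩
      exact ⟨g.2.1, cell_mem_cl hs hinj _⟩
    · rintro ⟨h1, h2⟩
      obtain ⟨h, e⟩ := exists_cell hs hinj h2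
      exact ⟨⟨x.1.2, h1, h⟩, e⟩
  · intro x
    exact (cell_mem_bdr hs hinj).2 (H1 x)
  · intro t x hx
    exact HC t x ((cell_mem_bdr hs hinj).1 hx)

lemma image_cell_univ (hs : s ∈ L.faces) (hinj : Set.InjOn lam s) :
    cell δ hs hinj '' Set.univ = upper L lam δ (cl s) := by
  ext x
  constructor
  · rintro ⟨g, -, rfl⟩
    exact cell_mem_cl hs hinj g
  · intro hx
    obtain ⟨h, e⟩ := exists_cell hs hinj hx
    exact ⟨_, trivial, e⟩

lemma acycOn_upper_cl (hs : s ∈ L.faces) (hinj : Set.InjOn lam s) {n : ℕ}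
    (h : AcycOn k (δ ⁻¹' faceSet (s.image lam)) n) : AcycOn k (upper L lam δ (cl s)) n := by
  rw [← image_cell_univ hs hinj]
  exact (acycOn_subtype.2 h).image (cell_isEmbedding hs hinj)

lemma exists_bd_upper_cl (hs : s ∈ L.faces) (hinj : Set.InjOn lam s) {n : ℕ}
    (h : ∀ z ∈ sub k (δ ⁻¹' bdrySet (s.image lam)) (n + 1), bd n z = 0 →
      ∃ c ∈ sub k (δ ⁻¹' faceSet (s.image lam)) (n + 2), bd (n + 1) c = z) :
    ∀ x ∈ sub k (upper L lam δ (bdr s)) (n + 1), bd n x = 0 →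
      ∃ c ∈ sub k (upper L lam δ (cl s)) (n + 2), bd (n + 1) c = x := by
  intro x hx hc
  have himg : cell δ hs hinj '' {g | δ g ∈ bdrySet (s.image lam)} = upper L lam δ (bdr s) := by
    ext y
    constructor
    · rintro ⟨g, hg, rfl⟩
      exact (cell_mem_bdr hs hinj).2 hg
    · intro hy
      obtain ⟨h, e⟩ := exists_cell hs hinj (x := y) ⟨hy.1.1, hy.2⟩
      refine ⟨_, ?_, e⟩
      rw [← e, cell_mem_bdr] at hy
      exact hy
  rw [← himg] at hx
  obtain ⟨z, hz, rfl⟩ := exists_push_eq (cell_isEmbedding hs hinj) hx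
  have hzc : bd n z = 0 := IsCyc.of_push (n := n + 1) (cell_isEmbedding hs hinj).injective hc
  obtain ⟨c, hcm, hcz⟩ := h (push (incl _) _ z) (push_mem_sub (fun g hg => hg) hz)
    (by rw [← push_bd, hzc, map_zero])
  obtain ⟨c, rfl⟩ := exists_push_incl hcm
  rw [← push_bd] at hcz
  refine ⟨push (cell δ hs hinj) _ c, push_mem_sub (A := Set.univ)
    (fun g _ => cell_mem_cl hs hinj g) (mem_sub_univ c), ?_⟩
  rw [← push_bd, push_injective (incl_embedding _).injective _ hcz]

end Cell

end Realization

end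

/-! ### Induction over the simplices of dimension 3 and 4 -/

noncomputable section

open SingChain

namespace Realization

variable {V : Type} {lam : V → Fin 5}

lemma card_image_lam {s : Finset V} (hinj : Set.InjOn lam s) : (s.image lam).card = s.card :=
  Finset.card_image_of_injOn hinj

/-- The simplices of `K` with at most `n` vertices. -/
def skeleton (K : Set (Finset V)) (n : ℕ) : Set (Finset V) := {s | s ∈ K ∧ s.card ≤ n}

/-- Only the top simplex is new, and it has too many vertices for the skeleton. -/
lemma skeleton_union_cl {K : Set (Finset V)} {s : Finset V} {n : ℕ} (hcard : s.card = n + 1)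
    (hb : bdr s ⊆ K) : skeleton (K ∪ cl s) n = skeleton K n := by
  ext t
  constructor
  · rintro ⟨h1 | h1, h2⟩
    · exact ⟨h1, h2⟩
    · refine ⟨hb ⟨lt_of_le_of_ne h1.1 ?_, h1.2⟩, h2⟩
      rintro rfl
      omega
  · rintro ⟨h1, h2⟩
    exact ⟨Or.inl h1, h2⟩

lemma skeleton_of_card {K : Set (Finset V)} {n : ℕ} (hK : ∀ s ∈ K, s.card ≤ n) :
    skeleton K n = K := Set.Subset.antisymm (fun _ h => h.1) fun s h => ⟨h, hK s h⟩

variable [Fintype V] {L : PreAbstractSimplicialComplex V}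
  {G : Type} [TopologicalSpace G] {δ : C(G, Simplex4)} {k : Type} [CommRing k]

lemma hasCollar_upper_of_card (hδ : FiberData k δ) {s : Finset V} (hs : s ∈ L.faces)
    (hinj : Set.InjOn lam s) (hcard : s.card = 4 ∨ s.card = 5) :
    HasCollar (upper L lam δ (cl s)) (upper L lam δ (bdr s)) := by
  refine hasCollar_upper hs hinj ?_
  rw [← card_image_lam hinj] at hcard
  rcases hcard with h | h
  · obtain ⟨i, hi⟩ := exists_eq_erase h
    rw [hi, faceSet_erase, bdrySet_erase]
    exact hδ.collar_face i
  · have : s.image lam = Finset.univ := Finset.eq_univ_of_card _ h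
    rw [this, faceSet_univ, bdrySet_univ]
    exact hδ.collar_univ

lemma acycOn_upper_of_card (hδ : FiberData k δ) {s : Finset V} (hs : s ∈ L.faces)
    (hinj : Set.InjOn lam s) (hcard : s.card = 4 ∨ s.card = 5) (n : ℕ) :
    AcycOn k (upper L lam δ (cl s)) (n + 3) := by
  refine acycOn_upper_cl hs hinj ?_
  rw [← card_image_lam hinj] at hcard
  rcases hcard with h | h
  · obtain ⟨i, hi⟩ := exists_eq_erase h
    rw [hi, faceSet_erase]
    exact hδ.acycOn_face i n
  · have : s.image lam = Finset.univ := Finset.eq_univ_of_card _ h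
    rw [this, faceSet_univ]
    exact hδ.acycOn_univ n

lemma kills_upper (hδ : FiberData k δ) {s : Finset V} (hs : s ∈ L.faces)
    (hinj : Set.InjOn lam s) (hcard : s.card = 4) :
    ∀ x ∈ sub k (upper L lam δ (bdr s)) 2, bd 1 x = 0 →
      ∃ c ∈ sub k (upper L lam δ (cl s)) 3, bd 2 c = x := by
  refine exists_bd_upper_cl (n := 1) hs hinj ?_
  rw [← card_image_lam hinj] at hcard
  obtain ⟨i, hi⟩ := exists_eq_erase hcard
  rw [hi, faceSet_erase, bdrySet_erase]
  exact hδ.kills_face i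

lemma upper_inter {K : Set (Finset V)} {s : Finset V} (hsK : s ∉ K) (hb : bdr s ⊆ K) :
    upper L lam δ K ∩ upper L lam δ (cl s) = upper L lam δ (bdr s) := by
  rw [upper, upper, ← Set.preimage_inter, carrier_inter hsK hb]
  rfl

variable (L lam δ k) in
/-- The comparison between the homology of a subcomplex and of its inverse image in the pull-back. -/
def Compares (K : Set (Finset V)) (q : ℕ) : Prop :=
  HLift k (prj L lam δ) (upper L lam δ K) (upper L lam δ K) (carrier L K) (q + 1) ∧
  HSurj k (prj L lam δ) (upper L lam δ K) (carrier L K) (q + 1) ∧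
  HLift k (prj L lam δ) (upper L lam δ (skeleton K (q + 2))) (upper L lam δ K) (carrier L K) q

/-- The comparison is preserved by attaching a simplex. -/
lemma Compares.attach (hδ : FiberData k δ) {K : Set (Finset V)} {s : Finset V} {q : ℕ}
    (hq : q = 1 ∨ q = 2) (hK : IsSub L K) (hs : s ∈ L.faces) (hinj : Set.InjOn lam s)
    (hcard : s.card = q + 3) (hsK : s ∉ K) (hb : bdr s ⊆ K)
    (hD : HLift k (prj L lam δ) (upper L lam δ (bdr s)) (upper L lam δ (bdr s)) (carrier L (bdr s)) q)
    (hD' : HSurj k (prj L lam δ) (upper L lam δ (bdr s)) (carrier L (bdr s)) q)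
    (hk : ∀ x ∈ sub k (upper L lam δ (bdr s)) (q + 1), bd q x = 0 →
      ∃ c ∈ sub k (upper L lam δ (cl s)) (q + 2), bd (q + 1) c = x)
    (h : Compares lam L δ k K q) : Compares lam L δ k (K ∪ cl s) q := by
  have hc45 : s.card = 4 ∨ s.card = 5 := by omega
  have hXD := upper_inter (L := L) (lam := lam) (δ := δ) hsK hb
  have hYD := carrier_inter (L := L) hsK hb
  have eX : Excisive k (upper L lam δ K) (upper L lam δ (cl s)) :=
    excisive_cl hK hs hsK hb (hasCollar_upper_of_card hδ hs hinj hc45)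
  have eY : Excisive k (carrier L K) (carrier L (cl s)) := excisive_carrier hK hs hsK hb
  have hBX : AcycOn k (upper L lam δ (cl s)) (q + 2) := by
    obtain ⟨r, rfl⟩ : ∃ r, q = r + 1 := ⟨q - 1, by omega⟩
    exact acycOn_upper_of_card hδ hs hinj hc45 r
  have hBY : AcycOn k (carrier L (cl s)) (q + 2) := acycOn_cl hs _
  -- Faces in the boundary have at most `q + 2` vertices, so the boundary has dimension at most `q +
  -- 1`.
  have hDY : AcycOn k (carrier L (bdr s)) (q + 2) :=
    acycOn_carrier (q + 2) (isSub_bdr hs) (fun t ht => card_bdr hcard ht) _ le_rfl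
  have hmK := mapsTo_upper (L := L) (lam := lam) (δ := δ) K
  have hms := mapsTo_upper (L := L) (lam := lam) (δ := δ) (cl s)
  have hsk : bdr s ⊆ skeleton K (q + 2) := fun t ht => ⟨hb ht, card_bdr hcard ht⟩
  have hXU : upper L lam δ (K ∪ cl s) = upper L lam δ K ∪ upper L lam δ (cl s) := rfl
  have hYU : carrier L (K ∪ cl s) = carrier L K ∪ carrier L (cl s) := rfl
  obtain ⟨h1, h2, h3⟩ := h
  refine ⟨?_, ?_, ?_⟩
  · rw [hXU, hYU]
    refine HLift.attach_self hmK hms eX eY ?_ ?_ hBX h1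
    · rw [hXD, hYD]
      exact hD
    · rw [hYD]
      exact hDY
  · rw [hXU, hYU]
    refine HSurj.attach hmK hms eY ?_ ?_ hBY ?_ h2
    · rw [hXD, hYD]
      exact hD'
    · rw [hXD]
      exact hk
    · rw [hXD]
      exact h3.mono fun x hx => hsk hx
  · rw [skeleton_union_cl hcard hb, hXU, hYU]
    refine HLift.attach ?_ (fun x hx => hx.1) hmK eY ?_ ?_ h3
    · rw [hXD]
      exact fun x hx => hsk hx
    · rw [hXD, hYD]
      exact hD'
    · rw [hXD]
      exact hk

lemma acycOn_of_hLift {X Y : Type} [TopologicalSpace X] [TopologicalSpace Y] {f : C(X, Y)}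
    {A : Set X} {A' : Set Y} {n : ℕ} (hf : Set.MapsTo f A A') (h : HLift k f A A A' n)
    (h' : AcycOn k A' (n + 1)) : AcycOn k A (n + 1) := by
  intro x hx hc
  have hc' : bd n x = 0 := hc
  exact h x hx hc (h' _ (push_mem_sub hf hx) (show bd n _ = 0 by rw [← push_bd, hc', map_zero]))

/-- Starts from dimension 2, where the projection is a homeomorphism. Attaching a 3-simplex uses
that 2-cycles over its boundary bound over it, the only point where coefficients mod `p` matter. -/
lemma compares_three (hδ : FiberData k δ) (hinj : ∀ s ∈ L.faces, Set.InjOn lam s)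
    {K : Set (Finset V)} (hK : IsSub L K) (hn : ∀ s ∈ K, s.card ≤ 4) : Compares lam L δ k K 1 := by
  refine IsSub.induction (P := fun K => Compares lam L δ k K 1) 3 (fun K hK hn => ?_)
    (fun K s hK hs hn hcard hsK hb h => ?_) hK hn
  · refine ⟨hLift_of_card hδ hn _, hSurj_of_card hδ hn _, ?_⟩
    rw [skeleton_of_card hn]
    exact hLift_of_card hδ hn _
  · have hbd : ∀ t ∈ bdr s, t.card ≤ 3 := fun t ht => card_bdr hcard ht
    exact h.attach hδ (Or.inl rfl) hK hs (hinj s hs) hcard hsK hb (hLift_of_card hδ hbd _)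
      (hSurj_of_card hδ hbd _) (kills_upper hδ hs (hinj s hs) hcard)

/-- The part over a 3-simplex has no 4-dimensional homology and the part over its boundary none in
degree 3, so Mayer-Vietoris creates no 4-cycles over a complex of dimension 3. -/
lemma acycOn_upper_four (hδ : FiberData k δ) (hinj : ∀ s ∈ L.faces, Set.InjOn lam s)
    {K : Set (Finset V)} (hK : IsSub L K) (hn : ∀ s ∈ K, s.card ≤ 4) :
    AcycOn k (upper L lam δ K) 4 := by
  refine IsSub.induction (P := fun K => AcycOn k (upper L lam δ K) 4) 3 (fun K hK hn => ?_)
    (fun K s hK hs hn hcard hsK hb h => ?_) hK hn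
  · exact acycOn_of_hLift (mapsTo_upper K) (hLift_of_card hδ hn 3)
      (acycOn_carrier 3 hK hn 4 (by norm_num))
  · have hbd : ∀ t ∈ bdr s, t.card ≤ 3 := fun t ht => card_bdr hcard ht
    have eX : Excisive k (upper L lam δ K) (upper L lam δ (cl s)) :=
      excisive_cl hK hs hsK hb (hasCollar_upper_of_card hδ hs (hinj s hs) (Or.inl hcard))
    refine eX.acycOn_union h (acycOn_upper_of_card hδ hs (hinj s hs) (Or.inl hcard) 1) ?_
    rw [upper_inter hsK hb]
    exact acycOn_of_hLift (mapsTo_upper _) (hLift_of_card hδ hbd 2)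
      (acycOn_carrier 3 (isSub_bdr hs) hbd 3 le_rfl)

/-- On the 3-skeleton both sides vanish in degree 4 and the lifting property in degree 3 is
injectivity from `compares_three`. When a 4-simplex is attached, its boundary is again covered by
`compares_three`, and 3-cycles over it bound because `Γ` has no homology in degree 3. -/
lemma compares_four (hδ : FiberData k δ) (hinj : ∀ s ∈ L.faces, Set.InjOn lam s)
    {K : Set (Finset V)} (hK : IsSub L K) (hn : ∀ s ∈ K, s.card ≤ 5) : Compares lam L δ k K 2 := by
  refine IsSub.induction (P := fun K => Compares lam L δ k K 2) 4 (fun K hK hn => ?_)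
    (fun K s hK hs hn hcard hsK hb h => ?_) hK hn
  · refine ⟨HLift.of_acycOn (acycOn_upper_four hδ hinj hK hn),
      HSurj.of_acycOn (acycOn_carrier 4 hK hn 4 le_rfl), ?_⟩
    rw [skeleton_of_card hn]
    exact (compares_three hδ hinj hK hn).1
  · have hbd : ∀ t ∈ bdr s, t.card ≤ 4 := fun t ht => card_bdr hcard ht
    obtain ⟨h1, h2, -⟩ := compares_three hδ hinj (isSub_bdr hs) hbd
    have hbc : upper L lam δ (bdr s) ⊆ upper L lam δ (cl s) := fun y hy => ⟨hy.1.1, hy.2⟩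
    exact h.attach hδ (Or.inr rfl) hK hs (hinj s hs) hcard hsK hb h1 h2
      fun x hx hc => acycOn_upper_of_card hδ hs (hinj s hs) (Or.inr hcard) 0 x
        (sub_mono hbc _ hx) hc

end Realization

end

theorem proposition3 (p : ℕ) [Fact p.Prime] (S : BallSystem)
    (δ : S.Gamma p → Simplex4) (hδ : S.IsDelta p δ)
    (V : Type) [Fintype V] (L : PreAbstractSimplicialComplex V) (lam : V → Fin 5)
    (hlam : ∀ s ∈ L, Set.InjOn (realizationMap L lam) {x | ∀ v, v ∉ s → x.1 v = 0}) :
    IsIso (singularHomologyMap p 4 (pullbackFst (realizationMap L lam) δ)) := by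
  have hinj : ∀ s ∈ L.faces, Set.InjOn lam s :=
    fun s hs => Realization.injOn_of_realizationMap hs (hlam s hs)
  -- The bound on the dimension of `L` comes from injectivity into the five vertices of `Δ`.
  have hcard : ∀ s ∈ L.faces, s.card ≤ 5 := fun s hs => by
    rw [← Finset.card_image_of_injOn (hinj s hs)]
    exact Finset.card_le_univ _
  obtain ⟨h1, h2, -⟩ := Realization.compares_four hδ.fiberData hinj Realization.isSub_faces hcard
  have hY : Realization.carrier L L.faces = Set.univ :=
    Set.eq_univ_of_forall Realization.supp_mem
  rw [Realization.upper, hY, Set.preimage_univ] at h1 h2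
  -- The criterion speaks of degree `n + 1`, hence `n = 3`; likewise `Compares` with `q = 2`
  -- concerns degree `q + 2 = 4`.
  refine SingChain.isIso_singularHomologyMap (k := ZMod p) (n := 3) _ ?_ ?_
  · rintro z hz ⟨c, hc⟩
    obtain ⟨d, -, hd⟩ := h1 z (SingChain.mem_sub_univ z) hz ⟨c, SingChain.mem_sub_univ c, hc⟩
    exact ⟨d, hd⟩
  · intro w hw
    obtain ⟨z, -, hz, c, -, hc⟩ := h2 w (SingChain.mem_sub_univ w) hw
    exact ⟨z, hz, c, hc⟩
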